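/- Let $M>0$, $\ell\in\mathbb N_0$, $\sigma\in\{-3,0,1\}$ with $(\ell,\sigma)\notin\{(0,0),(0,-3),(1,-3)\}$, and let $$V(x)=\Bigl(1-\tfrac{2M}{r(x)}\Bigr)\Bigl(\tfrac{\ell(\ell+1)}{r(x)^2}+\tfrac{2M\sigma}{r(x)^3}\Bigr),\qquad x\in\mathbb R,$$ where $r(x)>2M$ is defined by $x=r+2M\log(\frac r{2M}-1)$. Write $W(f,g)=fg'-f'g$. For $\lambda>0$ let $f_\pm(\cdot,\lambda)$ be the Jost solutions: $-f_\pm''+Vf_\pm=\lambda^2f_\pm$ and $f_\pm(x,\lambda)\sim e^{\pm i\lambda x}$ as $x\to\pm\infty$. Let $u_0,u_1$ be real solutions of $-u''+Vu=0$ with $u_0(x)\sim\frac{x^{\ell+1}}{2\ell+1}$ and $u_1(x)\sim x^{-\ell}$ as $x\to\infty$ and $W(u_0,u_1)=-1$. Let $x_0>0$ be such that $u_0>0$ on $[x_0,\infty)$. For $0<\lambda<\lambda_0$ let $u_0(\cdot,\lambda)$ be the solution of $-u''+Vu=\lambda^2u$ with $u_0(x_0,\lambda)=u_0(x_0)$ and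 $u_0'(x_0,\lambda)=u_0'(x_0)$, where $\delta,\lambda_0>0$ are so small that $x_0\lambda_0\le\delta$ and $|u_0(x,\lambda)/u_0(x)-1|\le\frac12$ for $0<\lambda<\lambda_0$, $x_0\le x\le\delta\lambda^{-1}$. Let $u_1(\cdot,\lambda)$ be the solution of the same equation that equals $u_0(x,\lambda)\int_x^{\delta\lambda^{-1}}u_0(y,\lambda)^{-2}\,dy$ on $[x_0,\delta\lambda^{-1}]$, so that $W(u_0(\cdot,\lambda),u_1(\cdot,\lambda))=-1$. Set $c_j^\pm(\lambda)=W(f_\pm(\cdot,\lambda),u_j(\cdot,\lambda))$ and $$A_{jk}(\lambda)=\mathrm{Im}\left[\frac{c_j^-(\lambda)c_k^+(\lambda)}{c_1^-(\lambda)c_0^+(\lambda)-c_0^-(\lambda)c_1^+(\lambda)}\right],\qquad j,k\in\{0,1\}.$$ For $N\in\mathbb N_0$, a real function $f$ is called $O_{2N+1}(\lambda)$ on $(0,a)$ if $f$ is smooth on $(0,a)$; $|f^{(k)}|\le C_k$ on $(0,a)$ for $k\le2N+1$; $|f^{(2N+1+k)}(\lambda)|\le C_k\lambda^{-k}$ on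 $(0,a)$ for all $k\ge0$; and $\lim_{\lambda\to0+}f^{(2k)}(\lambda)=0$ for $0\le k\le N$. It is called $O(\lambda^{\gamma})$ with symbol behaviour on $(0,a)$ if it is smooth there and $|f^{(k)}(\lambda)|\le C_k\lambda^{\gamma-k}$ on $(0,a)$ for all $k\ge0$. Then the Jost solutions exist for all $\lambda>0$, functions $u_j$, $u_j(\cdot,\lambda)$ and constants $x_0,\delta,\lambda_0$ as above exist, and for every choice of them there is $\lambda_1\in(0,\lambda_0]$ such that on $(0,\lambda_1)$ * $c_1^-c_0^+-c_0^-c_1^+=W(f_-,f_+)\neq0$; * $A_{00}(\lambda)=O_{2\ell+1}(\lambda)$; * $A_{jk}(\lambda)=O(\lambda^{2\ell+1})$ with symbol behaviour whenever $j+k\ge1$. Moreover, for the Green's function $G(x,x',\lambda)=f_-(\min(x,x'),\lambda)f_+(\max(x,x'),\lambda)/W(f_-(\cdot,\lambda),f_+(\cdot,\lambda))$ there is a real polynomial $P_\ell$ of degree at most $\ell-1$ (with $P_0=0$) such that, on some interval $(0,\lambda_1)$ with $\lambda_1>0$, $$\mathrm{Im}\,G(0,0,\lambda)=\lambda P_\ell(\lambda^2)+O(\lambda^{2\ell+1})\quad\text{with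 symbol behaviour}.$$ -/

import Mathlib

open Set Filter Topology
open scoped ContDiff

noncomputable section

namespace ReggeWheeler

/-! ## The Regge-Wheeler potential -/

/-- The tortoise coordinate `x = r + 2M log (r / 2M - 1)` as a function of `r > 2M`. -/
def tortoise (M r : ℝ) : ℝ := r + 2 * M * Real.log (r / (2 * M) - 1)

/-- The tortoise coordinate maps `(2M, ∞)` bijectively onto `ℝ`. -/
theorem tortoise_bijOn {M : ℝ} (hM : 0 < M) :
    BijOn (tortoise M) (Ioi (2 * M)) univ := by
  have h2 : 0 < 2 * M := by positivity
  have hpos : ∀ r ∈ Ioi (2 * M), 0 < r / (2 * M) - 1 := by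
    intro r hr
    rw [sub_pos, lt_div_iff₀ h2, one_mul]
    exact hr
  have hmono : StrictMonoOn (tortoise M) (Ioi (2 * M)) := by
    intro r hr s hs hrs
    have h1 : r / (2 * M) - 1 < s / (2 * M) - 1 :=
      sub_lt_sub_right (div_lt_div_of_pos_right hrs h2) 1
    have h3 := Real.log_lt_log (hpos r hr) h1
    have h4 := mul_lt_mul_of_pos_left h3 h2
    unfold tortoise
    linarith
  have hcont : ContinuousOn (tortoise M) (Ioi (2 * M)) := by
    unfold tortoise
    refine continuousOn_id.add (continuousOn_const.mul (ContinuousOn.log ?_ ?_))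
    · fun_prop
    · intro r hr
      exact (hpos r hr).ne'
  refine ⟨fun _ _ => mem_univ _, hmono.injOn, ?_⟩
  intro x _
  -- the value lies below `x` near the horizon and above `x` far out
  set y : ℝ := -(|x| + 4 * M) / (2 * M) with hy
  have hy0 : y < 0 := by
    rw [hy]
    apply div_neg_of_neg_of_pos _ h2
    have := abs_nonneg x
    linarith
  set a : ℝ := 2 * M * (1 + Real.exp y) with ha
  set b : ℝ := 4 * M + |x| with hb
  have hea : Real.exp y < 1 := by simpa using hy0
  have hea0 := Real.exp_pos y
  have ha1 : a ∈ Ioi (2 * M) := by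
    simp only [mem_Ioi, ha]
    nlinarith
  have hb1 : b ∈ Ioi (2 * M) := by
    have := abs_nonneg x
    simp only [mem_Ioi, hb]
    linarith
  have hab : a ≤ b := by
    have := abs_nonneg x
    simp only [ha, hb]
    nlinarith
  have hfa : tortoise M a ≤ x := by
    have h5 : a / (2 * M) - 1 = Real.exp y := by
      rw [ha]
      field_simp
      ring
    have h6 : 2 * M * y = -(|x| + 4 * M) := by
      rw [hy]
      field_simp
    unfold tortoise
    rw [h5, Real.log_exp, h6]
    have := neg_abs_le x
    simp only [ha]
    nlinarith
  have hfb : x ≤ tortoise M b := by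
    have h7 : 1 ≤ b / (2 * M) - 1 := by
      have : 2 ≤ b / (2 * M) := by
        rw [le_div_iff₀ h2, hb]
        have := abs_nonneg x
        linarith
      linarith
    have h8 := mul_nonneg h2.le (Real.log_nonneg h7)
    have := le_abs_self x
    unfold tortoise
    linarith
  have hsub : Icc a b ⊆ Ioi (2 * M) := fun z hz => lt_of_lt_of_le ha1 hz.1
  obtain ⟨c, hc, hcx⟩ := intermediate_value_Icc hab (hcont.mono hsub) ⟨hfa, hfb⟩
  exact ⟨c, hsub hc, hcx⟩

/-- The radius `r(x) > 2M` as a function of the tortoise coordinate `x`. -/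
def radius (M x : ℝ) : ℝ := Function.invFunOn (tortoise M) (Ioi (2 * M)) x

/-- For `M > 0`, `r(x)` is the unique `r > 2M` whose tortoise coordinate is `x`. -/
theorem radius_spec {M : ℝ} (hM : 0 < M) (x r : ℝ) :
    r = radius M x ↔ 2 * M < r ∧ tortoise M r = x := by
  have hb := tortoise_bijOn hM
  have hx : ∃ s ∈ Ioi (2 * M), tortoise M s = x := hb.surjOn (mem_univ x)
  have h1 : radius M x ∈ Ioi (2 * M) := Function.invFunOn_mem hx
  have h2 : tortoise M (radius M x) = x := Function.invFunOn_eq hx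
  constructor
  · rintro rfl
    exact ⟨h1, h2⟩
  · rintro ⟨h3, h4⟩
    exact hb.injOn h3 h1 (h4.trans h2.symm)

/-- The Regge-Wheeler potential
`V(x) = (1 - 2M/r(x)) (ℓ(ℓ+1)/r(x)² + 2Mσ/r(x)³)`. -/
def potential (M : ℝ) (l : ℕ) (σ : ℝ) (x : ℝ) : ℝ :=
  (1 - 2 * M / radius M x) *
    ((l : ℝ) * ((l : ℝ) + 1) / radius M x ^ 2 + 2 * M * σ / radius M x ^ 3)

/-! ## Solutions of the Schrödinger equation, Wronskians, Jost solutions -/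

/-- `f` is a classical solution of `-f'' + V f = E f` on `ℝ`.
(For smooth `V` such an `f` is automatically smooth.) -/
structure IsSolution {F : Type*} [NormedAddCommGroup F] [NormedSpace ℝ F]
    (V : ℝ → ℝ) (E : ℝ) (f : ℝ → F) : Prop where
  contDiff : ContDiff ℝ 2 f
  eqn : ∀ x : ℝ, -deriv (deriv f) x + V x • f x = E • f x

/-- The Wronskian `W(f, g) = f g' - f' g`, evaluated at `x`. -/
def wronskian {𝕜 : Type*} [RCLike 𝕜] (f g : ℝ → 𝕜) (x : ℝ) : 𝕜 :=
  f x * deriv g x - deriv f x * g x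

/-- `f = f₊(·, lam)`: it solves `-f'' + V f = lam² f` and `f(x) ~ e^{i lam x}` as `x → ∞`. -/
structure IsJostPlus (V : ℝ → ℝ) (lam : ℝ) (f : ℝ → ℂ) : Prop where
  sol : IsSolution V (lam ^ 2) f
  asymp : Tendsto (fun x : ℝ => f x / Complex.exp (Complex.I * lam * x)) atTop (𝓝 1)

/-- `f = f₋(·, lam)`: it solves `-f'' + V f = lam² f` and `f(x) ~ e^{-i lam x}` as `x → -∞`. -/
structure IsJostMinus (V : ℝ → ℝ) (lam : ℝ) (f : ℝ → ℂ) : Prop where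
  sol : IsSolution V (lam ^ 2) f
  asymp : Tendsto (fun x : ℝ => f x / Complex.exp (-(Complex.I * lam * x))) atBot (𝓝 1)

/-- The Green's function built from families `fm lam = f₋(·, lam)`, `fp lam = f₊(·, lam)`:
`f₋(min x x') f₊(max x x') / W(f₋, f₊)`. The Wronskian of two solutions of the same equation
does not depend on the point, and is evaluated at `0`. -/
def green (fm fp : ℝ → ℝ → ℂ) (x x' lam : ℝ) : ℂ :=
  fm lam (min x x') * fp lam (max x x') / wronskian (fm lam) (fp lam) 0

/-! ## The bases `u₀, u₁` at zero energy and `u₀(·, lam), u₁(·, lam)` at small energies -/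

/-- A zero energy basis: solutions of `-u'' + V u = 0` with `u₀(x) ~ x^{ℓ+1}/(2ℓ+1)` and
`u₁(x) ~ x^{-ℓ}` as `x → ∞` and `W(u₀, u₁) = -1`. -/
structure IsZeroEnergyBasis (V : ℝ → ℝ) (l : ℕ) (u : Fin 2 → ℝ → ℝ) : Prop where
  sol : ∀ j, IsSolution V 0 (u j)
  asymp_zero : Tendsto (fun x : ℝ => u 0 x / (x ^ (l + 1) / (2 * (l : ℝ) + 1))) atTop (𝓝 1)
  asymp_one : Tendsto (fun x : ℝ => u 1 x / (x ^ l)⁻¹) atTop (𝓝 1)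
  wronskian_eq : ∀ x, wronskian (u 0) (u 1) x = -1

/-- The basis `U j lam = u_j(·, lam)`, `0 < lam < lam0`, of solutions of `-f'' + V f = lam² f`
obtained from a zero energy basis `u` by perturbation in the energy:
* `x0 > 0` is such that `u₀ > 0` on `[x0, ∞)`, and `u₀(·, lam)` is the solution that agrees with
  `u₀` to first order at `x0`;
* `δ, lam0 > 0` are so small that `x0 ≤ δ / lam` and `|u₀(x, lam) / u₀(x) - 1| ≤ 1/2` for
  `0 < lam < lam0` and `x0 ≤ x ≤ δ / lam`;
* `u₁(·, lam)` is the solution that on `[x0, δ / lam]` equals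
  `u₀(x, lam) ∫_x^{δ / lam} u₀(y, lam)⁻² dy`, hence `W(u₀(·, lam), u₁(·, lam)) = -1`. -/
structure IsEnergyBasis (V : ℝ → ℝ) (u : Fin 2 → ℝ → ℝ) (x0 δ lam0 : ℝ)
    (U : Fin 2 → ℝ → ℝ → ℝ) : Prop where
  x0_pos : 0 < x0
  δ_pos : 0 < δ
  lam0_pos : 0 < lam0
  x0_mul_lam0_le : x0 * lam0 ≤ δ
  u_zero_pos : ∀ x, x0 ≤ x → 0 < u 0 x
  sol : ∀ j, ∀ lam ∈ Ioo 0 lam0, IsSolution V (lam ^ 2) (U j lam)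
  init : ∀ lam ∈ Ioo 0 lam0, U 0 lam x0 = u 0 x0
  init_deriv : ∀ lam ∈ Ioo 0 lam0, deriv (U 0 lam) x0 = deriv (u 0) x0
  close : ∀ lam ∈ Ioo 0 lam0, ∀ x ∈ Icc x0 (δ / lam), |U 0 lam x / u 0 x - 1| ≤ 1 / 2
  U_one : ∀ lam ∈ Ioo 0 lam0, ∀ x ∈ Icc x0 (δ / lam),
    U 1 lam x = U 0 lam x * ∫ y in x..(δ / lam), 1 / (U 0 lam y) ^ 2

/-! ## The coefficients -/

/-- `c_j(lam) = W(f(·, lam), u_j(·, lam))` (independent of the point, evaluated at `0`). -/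
def connCoeff (f : ℝ → ℝ → ℂ) (U : Fin 2 → ℝ → ℝ → ℝ) (j : Fin 2) (lam : ℝ) : ℂ :=
  wronskian (f lam) (fun x => (U j lam x : ℂ)) 0

/-- `c₁⁻ c₀⁺ - c₀⁻ c₁⁺`, which equals `W(f₋, f₊)`. -/
def coeffDet (fm fp : ℝ → ℝ → ℂ) (U : Fin 2 → ℝ → ℝ → ℝ) (lam : ℝ) : ℂ :=
  connCoeff fm U 1 lam * connCoeff fp U 0 lam - connCoeff fm U 0 lam * connCoeff fp U 1 lam

/-- `A_{jk}(lam) = Im [c_j⁻ c_k⁺ / (c₁⁻ c₀⁺ - c₀⁻ c₁⁺)]`. -/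
def spectralCoeff (fm fp : ℝ → ℝ → ℂ) (U : Fin 2 → ℝ → ℝ → ℝ) (j k : Fin 2) (lam : ℝ) : ℝ :=
  (connCoeff fm U j lam * connCoeff fp U k lam / coeffDet fm fp U lam).im

/-! ## The symbol classes -/

/-- `f(x) = O_{2N+1}(x)` on `(0, a)`. -/
structure IsOddO (N : ℕ) (a : ℝ) (f : ℝ → ℝ) : Prop where
  smooth : ContDiffOn ℝ ∞ f (Ioo 0 a)
  bounded : ∀ k ≤ 2 * N + 1, ∃ C : ℝ, ∀ x ∈ Ioo 0 a, |iteratedDeriv k f x| ≤ C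
  symbol : ∀ k : ℕ, ∃ C : ℝ, ∀ x ∈ Ioo 0 a, |iteratedDeriv (2 * N + 1 + k) f x| ≤ C / x ^ k
  even_vanish : ∀ k ≤ N, Tendsto (iteratedDeriv (2 * k) f) (𝓝[>] 0) (𝓝 0)

/-- `f(x) = O(x^γ)` on `(0, a)` with symbol behaviour: `f` is smooth and, for every `k`, its
`k`-th derivative is `O(x^{γ-k})`. -/
structure IsSymbolO (γ : ℝ) (a : ℝ) (f : ℝ → ℝ) : Prop where
  smooth : ContDiffOn ℝ ∞ f (Ioo 0 a)
  symbol : ∀ k : ℕ, ∃ C : ℝ, ∀ x ∈ Ioo 0 a, |iteratedDeriv k f x| ≤ C * x ^ (γ - (k : ℝ))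

end ReggeWheeler

end

namespace ReggeWheeler
open MeasureTheory

/-! ## Volterra equations depending holomorphically on a parameter -/

/-! Write `λ` for the energy parameter and match both Jost solutions with the perturbed growing
solution `U = U 0 λ` at the point `x0`.

On the horizon side the potential decays exponentially. The Volterra equation for `f₋`, with the
plane wave divided out, therefore has a kernel that is holomorphic in a full neighbourhood of `λ =
0`: `A = e^{iλx0} f₋(x0)` and `B = e^{iλx0} f₋'(x0)` are holomorphic there and satisfy `A(-λ) = conj
A(λ)`, `B(-λ) = conj B(λ)` for real `λ` (`exists_near_extension`). So `N = A u'(x0) - B u(x0)`,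
which is `c₀⁻` up to the phase, is holomorphic at `0` as well.

On the far side the decay is only quadratic, and holomorphy at `λ = 0` cannot be expected. But the
potential extends holomorphically to a sector (`exists_complex_potential`), and in the variable `λx`
the equation for `f₊` is bounded uniformly in `λ`. So `f₊` at points `x ~ 1/λ` is holomorphic on
discs of radius comparable to `λ`, with scale-invariant bounds (`exists_far_extension`). By Cauchy's
estimates such bounds are the same as symbol behaviour, which is why all estimates are carried out
in the algebra `IsHolSymbol` and no derivative in `λ` is ever computed by hand.

The two sides are linked by `(f₊/U)' = -c₀⁺/U²`. Integration from `x0` to `X ~ 1/λ` gives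
`f₊(x0)/u(x0) = f₊(X)/U(X) + c₀⁺ ∫ U⁻²`. The integral is an entire function `P(λ²)`, real on the
real axis, up to `O(X^{-(2ℓ+1)})` (`exists_energy_perturbation`, `exists_inv_sq_expansion`), while
`c₀⁺` is exactly of size `λ^{-ℓ}` and `f₊(X)/U(X) = O(λ^{ℓ+1})`. Hence `f₊(x0)/u(x0) = c₀⁺ (P(λ²) -
E)` with `E = O(λ^{2ℓ+1})` (`exists_coeff_symbols`).

Up to the phase, `W(f₋,f₊) = c₀⁺ (Q - E N)` with `Q = -A/u(x0) + P(λ²) N`. Positivity of the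
potential gives `Q(0) < 0`, so there is no resonance at zero energy and the Wronskian does not
vanish. Consequently `Z = c₀⁻c₀⁺/W = N/(Q - E N)` equals `N/Q` up to `O(λ^{2ℓ+1})`. The main term `h
= N/Q` is holomorphic at `0` with `h(-λ) = conj h(λ)`, so `Im h` is odd in `λ`: an odd polynomial
plus `O(λ^{2ℓ+1})` (`exists_im_expansion`). This is the claim for `A₀₀`, and the Green's function is
treated in the same way (`exists_low_energy_expansion`).

For the remaining coefficients, `U 1 λ` vanishes at `X = δ/λ` with slope `-1/U(X)`, so `c₁⁺ =
-f₊(X)/U(X)` and `m = c₁⁺/c₀⁺ = O(λ^{2ℓ+1})`. The determinant identity yields `A₀₁ = A₁₀ = Im(Z m)`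
and `A₁₁ = Im(m + Z m²)` (`exists_coefficient_estimates`).

Existence of the zero energy basis rests on an explicit solution that is a polynomial in `r`
(`exists_polynomial_solution`), followed by reduction of order. -/

theorem differentiableOn_integral_of_dominated {α : Type*} [MeasurableSpace α] {μ : Measure α}
    {U : Set ℂ} (hU : IsOpen U) {f : ℂ → α → ℂ} {g : α → ℝ}
    (hm : ∀ z ∈ U, AEStronglyMeasurable (f z) μ) (hg : Integrable g μ)
    (hb : ∀ᵐ a ∂μ, ∀ z ∈ U, ‖f z a‖ ≤ g a)
    (hd : ∀ᵐ a ∂μ, DifferentiableOn ℂ (fun z => f z a) U) :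
    DifferentiableOn ℂ (fun z => ∫ a, f z a ∂μ) U := by
  intro z₀ hz₀
  obtain ⟨r, hr, hrU⟩ := Metric.isOpen_iff.1 hU z₀ hz₀
  have hr2 : 0 < r / 2 := by positivity
  have hsub : ∀ z ∈ Metric.ball z₀ (r / 2), Metric.closedBall z (r / 2) ⊆ U := by
    intro z hz w hw
    refine hrU ?_
    rw [Metric.mem_ball] at *
    rw [Metric.mem_closedBall] at hw
    linarith [dist_triangle w z z₀]
  have hballU : Metric.ball z₀ (r / 2) ⊆ U := fun z hz =>
    hsub z hz (Metric.mem_closedBall_self hr2.le)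
  have key := hasDerivAt_integral_of_dominated_loc_of_deriv_le (μ := μ) (F := f) (x₀ := z₀)
    (s := Metric.ball z₀ (r / 2)) (bound := fun a => g a / (r / 2))
    (F' := fun z a => deriv (fun w => f w a) z) (Metric.ball_mem_nhds z₀ hr2)
    (by filter_upwards [hU.mem_nhds hz₀] with z hz using hm z hz)
    (hg.mono' (hm z₀ hz₀) (by filter_upwards [hb] with a ha using ha z₀ hz₀))
    ?_ ?_ (hg.div_const _) ?_
  · exact key.2.differentiableAt.differentiableWithinAt
  -- The derivative in `z` is measurable in `a` as an a.e. limit of difference quotients along steps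
  -- `r / (4(n + 1))`, which keep the shifted point inside `U`.
  · have hlim : Tendsto (fun n : ℕ => ((r / 4 / (n + 1) : ℝ) : ℂ)) atTop (𝓝[≠] 0) := by
      rw [tendsto_nhdsWithin_iff]
      constructor
      · have h1 : Tendsto (fun n : ℕ => r / 4 * (1 / ((n : ℝ) + 1))) atTop (𝓝 (r / 4 * 0)) :=
          tendsto_one_div_add_atTop_nhds_zero_nat.const_mul _
        rw [mul_zero] at h1
        have h2 := (Complex.continuous_ofReal.tendsto 0).comp h1
        simp only [Complex.ofReal_zero] at h2
        refine h2.congr fun n => ?_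
        simp only [Function.comp, mul_one_div]
      · refine Eventually.of_forall fun n => ?_
        have : r / 4 / ((n : ℝ) + 1) ≠ 0 := by positivity
        exact Complex.ofReal_ne_zero.2 this
    refine aestronglyMeasurable_of_tendsto_ae atTop
      (f := fun n : ℕ => fun a => ((r / 4 / ((n : ℝ) + 1) : ℝ) : ℂ)⁻¹ *
        (f (z₀ + ((r / 4 / ((n : ℝ) + 1) : ℝ) : ℂ)) a - f z₀ a)) (fun n => ?_) ?_
    · have hmem : z₀ + ((r / 4 / ((n : ℝ) + 1) : ℝ) : ℂ) ∈ U := ?_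
      · exact ((hm _ hmem).sub (hm z₀ hz₀)).const_mul _
      refine hrU ?_
      have h1 : 0 < r / 4 / ((n : ℝ) + 1) := by positivity
      have h2 : r / 4 / ((n : ℝ) + 1) ≤ r / 4 :=
        div_le_self (by positivity) (by linarith [(Nat.cast_nonneg n : (0 : ℝ) ≤ n)])
      rw [Metric.mem_ball, dist_eq_norm, add_sub_cancel_left, Complex.norm_real,
        Real.norm_of_nonneg h1.le]
      linarith
    · filter_upwards [hd] with a ha
      have h1 := ((ha z₀ hz₀).differentiableAt (hU.mem_nhds hz₀)).hasDerivAt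
      exact (hasDerivAt_iff_tendsto_slope_zero.1 h1).comp hlim
  · filter_upwards [hb, hd] with a ha hda z hz
    refine Complex.norm_deriv_le_of_forall_mem_sphere_norm_le hr2 ?_ ?_
    · exact ((hda.mono (hsub z hz)).diffContOnCl_ball subset_rfl)
    · exact fun w hw => ha w (hsub z hz (Metric.sphere_subset_closedBall hw))
  · filter_upwards [hd] with a ha z hz
    exact ((ha z (hballU hz)).differentiableAt (hU.mem_nhds (hballU hz))).hasDerivAt

/-- The Picard iterates of the equation `φ = φ₀ + ∫_S K(t, s) φ(s) ds`. -/
noncomputable def volterraIter (S : Set ℝ) (K : ℝ → ℝ → ℂ) (φ₀ : ℝ → ℂ) : ℕ → ℝ → ℂ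
  | 0 => φ₀
  | n + 1 => fun t => ∫ s in S, K t s * volterraIter S K φ₀ n s

/-- The Neumann series solution of the equation `φ = φ₀ + ∫_S K(t, s) φ(s) ds`. -/
noncomputable def volterraSol (S : Set ℝ) (K : ℝ → ℝ → ℂ) (φ₀ : ℝ → ℂ) (t : ℝ) : ℂ :=
  ∑' n, volterraIter S K φ₀ n t

/-- `wt` is a weight for which the integral operator with kernel bounded by `κ` has norm at most
one half. -/
structure IsVolterraWeight (S : Set ℝ) (κ : ℝ → ℝ → ℝ) (wt : ℝ → ℝ) : Prop where
  meas : MeasurableSet S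
  nonneg : ∀ t ∈ S, 0 ≤ wt t
  integrable : ∀ t ∈ S, IntegrableOn (fun s => κ t s * wt s) S
  integral_le : ∀ t ∈ S, ∫ s in S, κ t s * wt s ≤ wt t / 2

section Volterra

variable {S : Set ℝ} {κ : ℝ → ℝ → ℝ} {wt : ℝ → ℝ} {K : ℝ → ℝ → ℂ} {φ₀ : ℝ → ℂ} {C : ℝ}

theorem volterraIter_measurable (hK : Measurable (fun p : ℝ × ℝ => K p.1 p.2))
    (hφ : Measurable φ₀) (n : ℕ) : Measurable (volterraIter S K φ₀ n) := by
  induction n with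
  | zero => exact hφ
  | succ n ih =>
    have : StronglyMeasurable
        (Function.uncurry fun t s => K t s * volterraIter S K φ₀ n s) :=
      (hK.mul (ih.comp measurable_snd)).stronglyMeasurable
    exact (this.integral_prod_right (ν := volume.restrict S)).measurable

/-- In the sup norm weighted by `wt` the operator is a contraction with factor one half. Convergence
of the Neumann series, uniqueness and holomorphy are all read off from this. -/
theorem IsVolterraWeight.integral_norm_le (h : IsVolterraWeight S κ wt)
    (hK : Measurable (fun p : ℝ × ℝ => K p.1 p.2)) {ψ : ℝ → ℂ} (hψ : Measurable ψ)
    {B : ℝ} (hB : ∀ s ∈ S, ‖ψ s‖ ≤ B * wt s) {t : ℝ} (ht : t ∈ S)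
    (hKb : ∀ s ∈ S, ‖K t s‖ ≤ κ t s) :
    IntegrableOn (fun s => K t s * ψ s) S ∧ ‖∫ s in S, K t s * ψ s‖ ≤ B * (wt t / 2) ∧
      ∫ s in S, ‖K t s * ψ s‖ ≤ B * (wt t / 2) := by
  have hm : AEStronglyMeasurable (fun s => K t s * ψ s) (volume.restrict S) :=
    ((hK.comp (measurable_const.prodMk measurable_id)).mul hψ).aestronglyMeasurable
  have hbd : ∀ s ∈ S, ‖K t s * ψ s‖ ≤ B * (κ t s * wt s) := by
    intro s hs
    rw [norm_mul]
    calc ‖K t s‖ * ‖ψ s‖ ≤ κ t s * (B * wt s) :=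
          mul_le_mul (hKb s hs) (hB s hs) (norm_nonneg _) ((norm_nonneg _).trans (hKb s hs))
      _ = _ := by ring
  have hint : IntegrableOn (fun s => B * (κ t s * wt s)) S := (h.integrable t ht).const_mul B
  have hI : IntegrableOn (fun s => K t s * ψ s) S :=
    hint.mono' hm (by filter_upwards [ae_restrict_mem h.meas] with s hs using hbd s hs)
  have h3 : ∫ s in S, ‖K t s * ψ s‖ ≤ B * (wt t / 2) := by
    by_cases hB0 : 0 ≤ B
    · calc ∫ s in S, ‖K t s * ψ s‖ ≤ ∫ s in S, B * (κ t s * wt s) :=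
            setIntegral_mono_on hI.norm hint h.meas hbd
        _ = B * ∫ s in S, κ t s * wt s := integral_const_mul _ _
        _ ≤ B * (wt t / 2) := mul_le_mul_of_nonneg_left (h.integral_le t ht) hB0
    -- A negative `B` is possible only if the weight vanishes on all of `S`; then both sides are
    -- zero.
    · have hwt : ∀ s ∈ S, wt s = 0 := fun s hs => by
        have h1 := (norm_nonneg _).trans (hB s hs)
        have h2 := h.nonneg s hs
        push Not at hB0
        nlinarith
      have hz : ∫ s in S, ‖K t s * ψ s‖ = 0 := by
        rw [setIntegral_congr_fun (g := fun _ => (0 : ℝ)) h.meas]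
        · simp
        · intro s hs
          have h1 := hB s hs
          rw [hwt s hs, mul_zero] at h1
          simp [norm_le_zero_iff.1 h1]
      rw [hz, hwt t ht]
      simp
  exact ⟨hI, (norm_integral_le_integral_norm _).trans h3, h3⟩

theorem IsVolterraWeight.norm_iter_le (h : IsVolterraWeight S κ wt)
    (hK : Measurable (fun p : ℝ × ℝ => K p.1 p.2)) (hφ : Measurable φ₀)
    (hKb : ∀ t ∈ S, ∀ s ∈ S, ‖K t s‖ ≤ κ t s) (hB : ∀ s ∈ S, ‖φ₀ s‖ ≤ C * wt s) (n : ℕ) :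
    ∀ t ∈ S, ‖volterraIter S K φ₀ n t‖ ≤ C * (1 / 2) ^ n * wt t := by
  induction n with
  | zero => simpa [volterraIter] using hB
  | succ n ih =>
    intro t ht
    have := (h.integral_norm_le hK (volterraIter_measurable (S := S) hK hφ n) ih ht
      (hKb t ht)).2.1
    simp only [volterraIter]
    refine this.trans (le_of_eq ?_)
    ring

theorem summable_geometric_weight (C w : ℝ) :
    Summable (fun n : ℕ => C * (1 / 2 : ℝ) ^ n * w) :=
  ((summable_geometric_of_lt_one (by norm_num) (by norm_num)).mul_left C).mul_right w

theorem IsVolterraWeight.norm_sol_le (h : IsVolterraWeight S κ wt)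
    (hK : Measurable (fun p : ℝ × ℝ => K p.1 p.2)) (hφ : Measurable φ₀)
    (hKb : ∀ t ∈ S, ∀ s ∈ S, ‖K t s‖ ≤ κ t s) (hB : ∀ s ∈ S, ‖φ₀ s‖ ≤ C * wt s) :
    ∀ t ∈ S, ‖volterraSol S K φ₀ t‖ ≤ 2 * C * wt t := by
  intro t ht
  refine tsum_of_norm_bounded ?_ (fun n => h.norm_iter_le hK hφ hKb hB n t ht)
  have := (hasSum_geometric_two.mul_left C).mul_right (wt t)
  convert! this using 1
  ring

theorem volterraSol_measurable (hK : Measurable (fun p : ℝ × ℝ => K p.1 p.2))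
    (hφ : Measurable φ₀) : Measurable (volterraSol S K φ₀) :=
  Measurable.tsum fun n => volterraIter_measurable hK hφ n

/-- Summation and integration may be interchanged because the integrals of the norms are dominated
by a geometric series. -/
theorem IsVolterraWeight.sol_eq (h : IsVolterraWeight S κ wt)
    (hK : Measurable (fun p : ℝ × ℝ => K p.1 p.2)) (hφ : Measurable φ₀)
    (hKb : ∀ t ∈ S, ∀ s ∈ S, ‖K t s‖ ≤ κ t s) (hB : ∀ s ∈ S, ‖φ₀ s‖ ≤ C * wt s) :
    ∀ t ∈ S, volterraSol S K φ₀ t = φ₀ t + ∫ s in S, K t s * volterraSol S K φ₀ s := by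
  intro t ht
  have hsum : ∀ s ∈ S, Summable (fun n => volterraIter S K φ₀ n s) := fun s hs =>
    Summable.of_norm_bounded (summable_geometric_weight C (wt s))
      (fun n => h.norm_iter_le hK hφ hKb hB n s hs)
  have h1 : ∀ n, _ := fun n => h.integral_norm_le hK
    (volterraIter_measurable (S := S) hK hφ n) (h.norm_iter_le hK hφ hKb hB n) ht (hKb t ht)
  have h2 := hasSum_integral_of_summable_integral_norm (μ := volume.restrict S)
    (F := fun n s => K t s * volterraIter S K φ₀ n s) (fun n => (h1 n).1)
    (Summable.of_nonneg_of_le (fun n => integral_nonneg fun s => norm_nonneg _)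
      (fun n => (h1 n).2.2) (summable_geometric_weight C (wt t / 2)))
  have h3 : ∫ s in S, ∑' n, K t s * volterraIter S K φ₀ n s
      = ∫ s in S, K t s * volterraSol S K φ₀ s :=
    setIntegral_congr_fun h.meas fun s hs => tsum_mul_left
  rw [h3] at h2
  rw [volterraSol, (hsum t ht).tsum_eq_zero_add, ← h2.tsum_eq]
  rfl

/-- The difference of two solutions is reproduced by the homogeneous operator, hence is at most
`2⁻ⁿ` times a fixed multiple of the weight for every `n`. This identifies the Neumann series, whose
dependence on parameters is under control, with a Jost solution given only by its asymptotics. -/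
theorem IsVolterraWeight.unique (h : IsVolterraWeight S κ wt)
    (hK : Measurable (fun p : ℝ × ℝ => K p.1 p.2)) (hφ : Measurable φ₀)
    (hKb : ∀ t ∈ S, ∀ s ∈ S, ‖K t s‖ ≤ κ t s) (hB : ∀ s ∈ S, ‖φ₀ s‖ ≤ C * wt s)
    {ψ : ℝ → ℂ} (hψ : Measurable ψ) {B : ℝ} (hψB : ∀ s ∈ S, ‖ψ s‖ ≤ B * wt s)
    (heq : ∀ t ∈ S, ψ t = φ₀ t + ∫ s in S, K t s * ψ s) :
    ∀ t ∈ S, ψ t = volterraSol S K φ₀ t := by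
  have hsm := volterraSol_measurable (S := S) hK hφ
  have hsb := h.norm_sol_le hK hφ hKb hB
  have key : ∀ n : ℕ, ∀ t ∈ S,
      ‖ψ t - volterraSol S K φ₀ t‖ ≤ (B + 2 * C) * (1 / 2) ^ n * wt t := by
    intro n
    induction n with
    | zero =>
      intro t ht
      refine (norm_sub_le _ _).trans ?_
      have h1 := hψB t ht
      have h2 := hsb t ht
      simp only [pow_zero, mul_one, add_mul]
      linarith
    | succ n ih =>
      intro t ht
      have h1 := h.integral_norm_le hK hψ hψB ht (hKb t ht)
      have h2 := h.integral_norm_le hK hsm hsb ht (hKb t ht)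
      have h3 := h.integral_norm_le hK (hψ.sub hsm) ih ht (hKb t ht)
      have h4 : ψ t - volterraSol S K φ₀ t
          = ∫ s in S, K t s * (ψ - volterraSol S K φ₀) s := by
        rw [heq t ht, h.sol_eq hK hφ hKb hB t ht, add_sub_add_left_eq_sub,
          ← integral_sub h1.1 h2.1]
        simp only [Pi.sub_apply, mul_sub]
      rw [h4]
      refine h3.2.1.trans (le_of_eq ?_)
      ring
  intro t ht
  have hlim : Tendsto (fun n : ℕ => (B + 2 * C) * (1 / 2 : ℝ) ^ n * wt t) atTop (𝓝 0) := by
    have := ((tendsto_pow_atTop_nhds_zero_of_lt_one (by norm_num : (0 : ℝ) ≤ 1 / 2)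
      (by norm_num)).const_mul (B + 2 * C)).mul_const (wt t)
    simpa using this
  have := ge_of_tendsto' hlim (fun n => key n t ht)
  exact sub_eq_zero.1 (norm_le_zero_iff.1 this)

/-- Conjugation commutes with every integral and with the sum, convergent or not. This is the source
of the symmetry under `λ ↦ -λ` and of reality on the real axis. -/
theorem volterraSol_conj {K' : ℝ → ℝ → ℂ} {φ₀' : ℝ → ℂ}
    (hK : ∀ t s, K' t s = starRingEnd ℂ (K t s)) (hφ : ∀ t, φ₀' t = starRingEnd ℂ (φ₀ t))
    (t : ℝ) : volterraSol S K' φ₀' t = starRingEnd ℂ (volterraSol S K φ₀ t) := by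
  have : ∀ n t, volterraIter S K' φ₀' n t = starRingEnd ℂ (volterraIter S K φ₀ n t) := by
    intro n
    induction n with
    | zero => exact hφ
    | succ n ih =>
      intro t
      simp only [volterraIter, ← integral_conj, ih, hK, map_mul]
  simp only [volterraSol, Complex.conj_tsum, this]

end Volterra

/-- The bounds `κ`, `wt` and `C` do not depend on `z`. So each Picard iterate is holomorphic by
dominated integration, and the series converges uniformly in `z`. -/
theorem IsVolterraWeight.sol_differentiableOn {S : Set ℝ} {κ : ℝ → ℝ → ℝ} {wt : ℝ → ℝ} {C : ℝ}
    (h : IsVolterraWeight S κ wt) {U : Set ℂ} (hU : IsOpen U)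
    {K : ℂ → ℝ → ℝ → ℂ} {φ₀ : ℂ → ℝ → ℂ}
    (hK : ∀ z ∈ U, Measurable (fun p : ℝ × ℝ => K z p.1 p.2))
    (hφ : ∀ z ∈ U, Measurable (φ₀ z))
    (hKb : ∀ z ∈ U, ∀ t ∈ S, ∀ s ∈ S, ‖K z t s‖ ≤ κ t s)
    (hB : ∀ z ∈ U, ∀ s ∈ S, ‖φ₀ z s‖ ≤ C * wt s)
    (hKd : ∀ t ∈ S, ∀ s ∈ S, DifferentiableOn ℂ (fun z => K z t s) U)
    (hφd : ∀ t ∈ S, DifferentiableOn ℂ (fun z => φ₀ z t) U) :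
    ∀ t ∈ S, DifferentiableOn ℂ (fun z => volterraSol S (K z) (φ₀ z) t) U := by
  have hiter : ∀ n, ∀ t ∈ S,
      DifferentiableOn ℂ (fun z => volterraIter S (K z) (φ₀ z) n t) U := by
    intro n
    induction n with
    | zero => exact hφd
    | succ n ih =>
      intro t ht
      simp only [volterraIter]
      refine differentiableOn_integral_of_dominated hU
        (g := fun s => C * (1 / 2) ^ n * (κ t s * wt s)) ?_ ?_ ?_ ?_
      · intro z hz
        exact (((hK z hz).comp (measurable_const.prodMk measurable_id)).mul
          (volterraIter_measurable (hK z hz) (hφ z hz) n)).aestronglyMeasurable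
      · exact (h.integrable t ht).const_mul _
      · filter_upwards [ae_restrict_mem h.meas] with s hs z hz
        have h1 := hKb z hz t ht s hs
        have h2 := h.norm_iter_le (hK z hz) (hφ z hz) (hKb z hz) (hB z hz) n s hs
        rw [norm_mul]
        refine (mul_le_mul h1 h2 (norm_nonneg _) ((norm_nonneg _).trans h1)).trans (le_of_eq ?_)
        ring
      · filter_upwards [ae_restrict_mem h.meas] with s hs
        exact (hKd t ht s hs).mul (ih s hs)
  intro t ht
  exact Complex.differentiableOn_tsum_of_summable_norm (summable_geometric_weight C (wt t))
    (fun n => hiter n t ht) hU (fun n z hz => h.norm_iter_le (hK z hz) (hφ z hz) (hKb z hz)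
      (hB z hz) n t ht)

end ReggeWheeler

namespace ReggeWheeler
open MeasureTheory

/-! ## Holomorphic symbols -/

/-- `f` extends holomorphically to discs `|z - x| < ε x` around the points `x ∈ (0, a)`, with the
bound `C x ^ γ`. By Cauchy's estimates `f` is then `O(x ^ γ)` with symbol behaviour. -/
def IsHolSymbol (a : ℝ) (γ : ℤ) (f : ℝ → ℂ) : Prop :=
  ∃ ε C : ℝ, 0 < ε ∧ ε ≤ 1 / 2 ∧ 0 ≤ C ∧ ∀ x ∈ Ioo 0 a, ∃ F : ℂ → ℂ,
    DifferentiableOn ℂ F (Metric.ball (x : ℂ) (ε * x)) ∧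
    (∀ z ∈ Metric.ball (x : ℂ) (ε * x), ‖F z‖ ≤ C * x ^ γ) ∧
    ∀ y ∈ Ioo 0 a, (y : ℂ) ∈ Metric.ball (x : ℂ) (ε * x) → F y = f y

namespace IsHolSymbol

variable {a b : ℝ} {γ γ' : ℤ} {f g : ℝ → ℂ}

theorem mono (h : IsHolSymbol a γ f) (hba : b ≤ a) : IsHolSymbol b γ f := by
  obtain ⟨ε, C, h1, h2, h3, H⟩ := h
  refine ⟨ε, C, h1, h2, h3, fun x hx => ?_⟩
  obtain ⟨F, hF, hb, he⟩ := H x ⟨hx.1, hx.2.trans_le hba⟩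
  exact ⟨F, hF, hb, fun y hy => he y ⟨hy.1, hy.2.trans_le hba⟩⟩

theorem congr (h : IsHolSymbol a γ f) (hfg : ∀ x ∈ Ioo 0 a, f x = g x) :
    IsHolSymbol a γ g := by
  obtain ⟨ε, C, h1, h2, h3, H⟩ := h
  refine ⟨ε, C, h1, h2, h3, fun x hx => ?_⟩
  obtain ⟨F, hF, hb, he⟩ := H x hx
  exact ⟨F, hF, hb, fun y hy hyb => (he y hy hyb).trans (hfg y hy)⟩

theorem mem_ball_self {ε x : ℝ} (hε : 0 < ε) (hx : 0 < x) :
    (x : ℂ) ∈ Metric.ball (x : ℂ) (ε * x) := Metric.mem_ball_self (by positivity)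

theorem exists_norm_le (h : IsHolSymbol a γ f) :
    ∃ C, 0 ≤ C ∧ ∀ x ∈ Ioo 0 a, ‖f x‖ ≤ C * x ^ γ := by
  obtain ⟨ε, C, h1, h2, h3, H⟩ := h
  refine ⟨C, h3, fun x hx => ?_⟩
  obtain ⟨F, hF, hb, he⟩ := H x hx
  rw [← he x hx (mem_ball_self h1 hx.1)]
  exact hb _ (mem_ball_self h1 hx.1)

theorem weaken (h : IsHolSymbol a γ f) (hγ : γ' ≤ γ) : IsHolSymbol a γ' f := by
  obtain ⟨ε, C, h1, h2, h3, H⟩ := h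
  obtain ⟨n, hn⟩ := Int.le.dest hγ
  refine ⟨ε, C * |a| ^ n, h1, h2, by positivity, fun x hx => ?_⟩
  obtain ⟨F, hF, hb, he⟩ := H x hx
  refine ⟨F, hF, fun z hz => (hb z hz).trans ?_, he⟩
  rw [← hn, zpow_add₀ hx.1.ne', zpow_natCast, mul_assoc, mul_comm (|a| ^ n)]
  have h4 : x ^ n ≤ |a| ^ n := pow_le_pow_left₀ hx.1.le (hx.2.le.trans (le_abs_self a)) n
  have h5 := zpow_pos hx.1 γ'
  gcongr

/-- Two symbols extend to common discs. -/
theorem exists_common (hf : IsHolSymbol a γ f) (hg : IsHolSymbol a γ' g) :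
    ∃ ε C C' : ℝ, 0 < ε ∧ ε ≤ 1 / 2 ∧ 0 ≤ C ∧ 0 ≤ C' ∧ ∀ x ∈ Ioo 0 a, ∃ F G : ℂ → ℂ,
      DifferentiableOn ℂ F (Metric.ball (x : ℂ) (ε * x)) ∧
      DifferentiableOn ℂ G (Metric.ball (x : ℂ) (ε * x)) ∧
      (∀ z ∈ Metric.ball (x : ℂ) (ε * x), ‖F z‖ ≤ C * x ^ γ ∧ ‖G z‖ ≤ C' * x ^ γ') ∧
      ∀ y ∈ Ioo 0 a, (y : ℂ) ∈ Metric.ball (x : ℂ) (ε * x) → F y = f y ∧ G y = g y := by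
  obtain ⟨ε, C, h1, h2, h3, H⟩ := hf
  obtain ⟨ε', C', h1', h2', h3', H'⟩ := hg
  refine ⟨min ε ε', C, C', lt_min h1 h1', (min_le_left _ _).trans h2, h3, h3', fun x hx => ?_⟩
  obtain ⟨F, hF, hb, he⟩ := H x hx
  obtain ⟨G, hG, hb', he'⟩ := H' x hx
  have s1 : Metric.ball (x : ℂ) (min ε ε' * x) ⊆ Metric.ball (x : ℂ) (ε * x) :=
    Metric.ball_subset_ball (mul_le_mul_of_nonneg_right (min_le_left _ _) hx.1.le)
  have s2 : Metric.ball (x : ℂ) (min ε ε' * x) ⊆ Metric.ball (x : ℂ) (ε' * x) :=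
    Metric.ball_subset_ball (mul_le_mul_of_nonneg_right (min_le_right _ _) hx.1.le)
  exact ⟨F, G, hF.mono s1, hG.mono s2, fun z hz => ⟨hb z (s1 hz), hb' z (s2 hz)⟩,
    fun y hy hyb => ⟨he y hy (s1 hyb), he' y hy (s2 hyb)⟩⟩

theorem add (hf : IsHolSymbol a γ f) (hg : IsHolSymbol a γ g) :
    IsHolSymbol a γ (fun x => f x + g x) := by
  obtain ⟨ε, C, C', h1, h2, h3, h4, H⟩ := exists_common hf hg
  refine ⟨ε, C + C', h1, h2, by positivity, fun x hx => ?_⟩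
  obtain ⟨F, G, hF, hG, hb, he⟩ := H x hx
  refine ⟨fun z => F z + G z, hF.add hG, fun z hz => ?_, fun y hy hyb => ?_⟩
  · rw [add_mul]
    exact (norm_add_le _ _).trans (add_le_add (hb z hz).1 (hb z hz).2)
  · simp only [he y hy hyb]

theorem mul (hf : IsHolSymbol a γ f) (hg : IsHolSymbol a γ' g) :
    IsHolSymbol a (γ + γ') (fun x => f x * g x) := by
  obtain ⟨ε, C, C', h1, h2, h3, h4, H⟩ := exists_common hf hg
  refine ⟨ε, C * C', h1, h2, by positivity, fun x hx => ?_⟩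
  obtain ⟨F, G, hF, hG, hb, he⟩ := H x hx
  refine ⟨fun z => F z * G z, hF.mul hG, fun z hz => ?_, fun y hy hyb => ?_⟩
  · rw [norm_mul, zpow_add₀ hx.1.ne', mul_mul_mul_comm]
    have := zpow_nonneg hx.1.le γ
    exact mul_le_mul (hb z hz).1 (hb z hz).2 (norm_nonneg _) (by positivity)
  · simp only [he y hy hyb]

/-- A function holomorphic near `0` is a symbol of order `0`. -/
theorem of_differentiableOn {h : ℂ → ℂ} {ρ : ℝ}
    (hh : DifferentiableOn ℂ h (Metric.ball 0 ρ)) (ha : 2 * a ≤ ρ) :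
    IsHolSymbol a 0 (fun x => h x) := by
  -- For `a ≤ 0` the closed ball need not lie in the domain of `h`; the zero function replaces `h`
  -- there, since nothing has to be shown in that case.
  obtain ⟨C, hC⟩ := (isCompact_closedBall (0 : ℂ) (3 * a / 2)).exists_bound_of_continuousOn
    (f := fun z => if 0 < a then h z else 0) (by
      by_cases h0 : 0 < a
      · simp only [h0, if_true]
        refine hh.continuousOn.mono (Metric.closedBall_subset_ball (by linarith))
      · simp only [h0, if_false]
        exact continuousOn_const)
  refine ⟨1 / 2, |C|, by norm_num, le_rfl, abs_nonneg _, fun x hx => ?_⟩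
  have ha0 : 0 < a := hx.1.trans hx.2
  have hs : Metric.ball (x : ℂ) (1 / 2 * x) ⊆ Metric.closedBall 0 (3 * a / 2) := by
    intro z hz
    rw [Metric.mem_ball] at hz
    rw [Metric.mem_closedBall]
    have h1 := dist_triangle z x 0
    have h2 : dist (x : ℂ) 0 = x := by simp [abs_of_pos hx.1]
    have := hx.2
    linarith
  refine ⟨h, hh.mono (hs.trans (Metric.closedBall_subset_ball (by linarith))),
    fun z hz => ?_, fun y _ _ => rfl⟩
  have := hC z (hs hz)
  simp only [ha0, if_true] at this
  simpa using this.trans (le_abs_self C)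

theorem const (a : ℝ) (c : ℂ) : IsHolSymbol a 0 (fun _ => c) :=
  of_differentiableOn (h := fun _ => c) (ρ := 2 * a) (differentiableOn_const c) le_rfl

theorem pow (a : ℝ) (n : ℕ) : IsHolSymbol a n (fun x => (x : ℂ) ^ n) := by
  refine ⟨1 / 2, 2 ^ n, by norm_num, le_rfl, by positivity, fun x hx =>
    ⟨fun z => z ^ n, by fun_prop, fun z hz => ?_, fun _ _ _ => rfl⟩⟩
  have h1 : ‖z‖ ≤ 2 * x := by
    rw [Metric.mem_ball, dist_eq_norm] at hz
    have h2 : ‖(x : ℂ)‖ = x := by simp [abs_of_pos hx.1]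
    have h3 := norm_add_le (z - x) x
    rw [sub_add_cancel] at h3
    have := hx.1
    linarith
  rw [norm_pow, zpow_natCast, ← mul_pow]
  exact pow_le_pow_left₀ (norm_nonneg _) h1 n

theorem const_mul (hf : IsHolSymbol a γ f) (c : ℂ) : IsHolSymbol a γ (fun x => c * f x) := by
  simpa using (const a c).mul hf

theorem neg (hf : IsHolSymbol a γ f) : IsHolSymbol a γ (fun x => -f x) := by
  simpa using hf.const_mul (-1)

theorem sub (hf : IsHolSymbol a γ f) (hg : IsHolSymbol a γ g) :
    IsHolSymbol a γ (fun x => f x - g x) := by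
  simpa [sub_eq_add_neg] using hf.add hg.neg

/-- The discs are centred on the real axis, so `z ↦ conj (F (conj z))` is a holomorphic extension on
the same disc. Hence real and imaginary parts of symbols are again symbols. -/
theorem conj (hf : IsHolSymbol a γ f) : IsHolSymbol a γ (fun x => starRingEnd ℂ (f x)) := by
  obtain ⟨ε, C, h1, h2, h3, H⟩ := hf
  refine ⟨ε, C, h1, h2, h3, fun x hx => ?_⟩
  obtain ⟨F, hF, hb, he⟩ := H x hx
  have hm : ∀ z ∈ Metric.ball (x : ℂ) (ε * x),
      starRingEnd ℂ z ∈ Metric.ball (x : ℂ) (ε * x) := by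
    intro z hz
    rw [Metric.mem_ball] at *
    rwa [← Complex.conj_ofReal x, Complex.dist_conj_conj]
  refine ⟨fun z => starRingEnd ℂ (F (starRingEnd ℂ z)), fun z hz => ?_, fun z hz => ?_,
    fun y hy hyb => ?_⟩
  · have h5 := (hF.differentiableAt (Metric.isOpen_ball.mem_nhds (hm z hz))).conj_conj
    rw [Complex.conj_conj] at h5
    exact h5.differentiableWithinAt
  · rw [Complex.norm_conj]
    exact hb _ (hm z hz)
  · simp only [Complex.conj_ofReal, he y hy hyb]

/-- By the Schwarz lemma `F` differs from `F x` by at most `2Cη x ^ γ` on the disc shrunk by the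
factor `η`. The choice of `η` makes this at most `(c / 2) x ^ γ`, so half of the lower bound at the
centre survives on the smaller disc. -/
theorem inv (hf : IsHolSymbol a γ f) {c : ℝ} (hc : 0 < c)
    (hlow : ∀ x ∈ Ioo 0 a, c * x ^ γ ≤ ‖f x‖) : IsHolSymbol a (-γ) (fun x => (f x)⁻¹) := by
  obtain ⟨ε, C, h1, h2, h3, H⟩ := hf
  set η : ℝ := min (1 / 2) (c / (4 * (C + 1))) with hη
  have hη0 : 0 < η := lt_min (by norm_num) (by positivity)
  have hη1 : η ≤ 1 / 2 := min_le_left _ _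
  have hη2 : η * (2 * C) ≤ c / 2 := by
    have : η ≤ c / (4 * (C + 1)) := min_le_right _ _
    rw [le_div_iff₀ (by positivity)] at this
    nlinarith
  refine ⟨ε * η, 2 / c, by positivity, by nlinarith, by positivity, fun x hx => ?_⟩
  obtain ⟨F, hF, hb, he⟩ := H x hx
  have hx0 := hx.1
  have hxγ := zpow_pos hx.1 γ
  have hsub : Metric.ball (x : ℂ) (ε * η * x) ⊆ Metric.ball (x : ℂ) (ε * x) := by
    apply Metric.ball_subset_ball
    have : 0 < ε * x := by positivity
    nlinarith
  have hlow' : ∀ z ∈ Metric.ball (x : ℂ) (ε * η * x), c / 2 * x ^ γ ≤ ‖F z‖ := by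
    intro z hz
    have h5 := Complex.dist_le_div_mul_dist_of_mapsTo_ball (R₂ := 2 * C * x ^ γ) hF
      (fun w hw => by
        rw [Metric.mem_closedBall, dist_eq_norm]
        refine (norm_sub_le _ _).trans ?_
        have := hb w hw
        have := hb x (mem_ball_self h1 hx.1)
        linarith) (hsub hz)
    have h6 : 2 * C * x ^ γ / (ε * x) * dist z x ≤ η * (2 * C) * x ^ γ := by
      rw [Metric.mem_ball] at hz
      calc 2 * C * x ^ γ / (ε * x) * dist z x ≤ 2 * C * x ^ γ / (ε * x) * (ε * η * x) := by
            gcongr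
        _ = _ := by field_simp
    have h7 := hlow x hx
    rw [← he x hx (mem_ball_self h1 hx.1)] at h7
    have h8 := norm_sub_norm_le (F x) (F z)
    rw [← dist_eq_norm, dist_comm] at h8
    have h9 : η * (2 * C) * x ^ γ ≤ c / 2 * x ^ γ := by gcongr
    linarith
  have hpos : 0 < c / 2 * x ^ γ := by positivity
  refine ⟨fun z => (F z)⁻¹, (hF.mono hsub).inv fun z hz => ?_, fun z hz => ?_,
    fun y hy hyb => ?_⟩
  · exact norm_pos_iff.1 (hpos.trans_le (hlow' z hz))
  · rw [norm_inv, zpow_neg, show 2 / c * (x ^ γ)⁻¹ = (c / 2 * x ^ γ)⁻¹ by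
      field_simp]
    exact inv_anti₀ hpos (hlow' z hz)
  · simp only [he y hy (hsub hyb)]

theorem ofReal_re (hf : IsHolSymbol a γ f) : IsHolSymbol a γ (fun x => ((f x).re : ℂ)) := by
  refine ((hf.add hf.conj).const_mul (1 / 2)).congr fun x _ => ?_
  rw [Complex.re_eq_add_conj]
  ring

theorem ofReal_im (hf : IsHolSymbol a γ f) : IsHolSymbol a γ (fun x => ((f x).im : ℂ)) := by
  refine ((hf.sub hf.conj).const_mul (1 / (2 * Complex.I))).congr fun x _ => ?_
  rw [Complex.im_eq_sub_conj]
  ring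

/-- On the real axis the imaginary part of `F` is constantly zero, so its derivative, the imaginary
part of `deriv F x`, vanishes. -/
theorem hasDerivAt_of_real {f : ℝ → ℝ} {F : ℂ → ℂ} {x : ℝ}
    (hF : DifferentiableAt ℂ F x) (he : ∀ᶠ y : ℝ in 𝓝 x, F y = f y) :
    HasDerivAt f (deriv f x) x ∧ deriv F x = ((deriv f x : ℝ) : ℂ) := by
  have h1 : HasDerivAt (fun y : ℝ => (f y : ℂ)) (deriv F x) x :=
    hF.hasDerivAt.comp_ofReal.congr_of_eventuallyEq (by
      filter_upwards [he] with y hy using hy.symm)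
  have h2 : HasDerivAt f (deriv F x).re x := by
    have := Complex.reCLM.hasFDerivAt.comp_hasDerivAt x h1
    simpa [Function.comp_def] using this
  have h3 : HasDerivAt (fun _ : ℝ => (0 : ℝ)) (deriv F x).im x := by
    have := Complex.imCLM.hasFDerivAt.comp_hasDerivAt x h1
    simpa [Function.comp_def] using this
  have h4 : (deriv F x).im = 0 := h3.unique (hasDerivAt_const x 0)
  rw [h2.deriv]
  exact ⟨h2, by apply Complex.ext <;> simp [h4]⟩

theorem eventually_eq {f : ℝ → ℂ} {F : ℂ → ℂ} {ε x a : ℝ}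
    (he : ∀ y ∈ Ioo 0 a, (y : ℂ) ∈ Metric.ball (x : ℂ) (ε * x) → F y = f y)
    {y : ℝ} (hy : y ∈ Ioo 0 a) (hyb : (y : ℂ) ∈ Metric.ball (x : ℂ) (ε * x)) :
    ∀ᶠ t : ℝ in 𝓝 y, F t = f t := by
  have h2 : ∀ᶠ t : ℝ in 𝓝 y, (t : ℂ) ∈ Metric.ball (x : ℂ) (ε * x) :=
    Complex.continuous_ofReal.continuousAt.eventually (Metric.isOpen_ball.mem_nhds hyb)
  filter_upwards [h2, isOpen_Ioo.mem_nhds hy] with t ht1 ht2 using he t ht2 ht1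

/-- Cauchy's estimate on circles of radius `ε x / 2` costs exactly one power of `x`; the disc
shrinks by the factor two so that these circles stay inside the old one. -/
theorem deriv_real {f : ℝ → ℝ} (hf : IsHolSymbol a γ (fun x => (f x : ℂ))) :
    IsHolSymbol a (γ - 1) (fun x => ((deriv f x : ℝ) : ℂ)) := by
  obtain ⟨ε, C, h1, h2, h3, H⟩ := hf
  refine ⟨ε / 2, C * (2 / ε), by positivity, by linarith, by positivity, fun x hx => ?_⟩
  have hx0 := hx.1
  obtain ⟨F, hF, hb, he⟩ := H x hx
  have hsub : Metric.ball (x : ℂ) (ε / 2 * x) ⊆ Metric.ball (x : ℂ) (ε * x) :=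
    Metric.ball_subset_ball (by nlinarith)
  have hcl : ∀ z ∈ Metric.ball (x : ℂ) (ε / 2 * x),
      Metric.closedBall z (ε / 2 * x) ⊆ Metric.ball (x : ℂ) (ε * x) := by
    intro z hz w hw
    rw [Metric.mem_ball] at *
    rw [Metric.mem_closedBall] at hw
    have := dist_triangle w z x
    linarith
  refine ⟨fun z => deriv F z, (hF.deriv Metric.isOpen_ball).mono hsub, fun z hz => ?_,
    fun y hy hyb => ?_⟩
  · have h5 := Complex.norm_deriv_le_of_forall_mem_sphere_norm_le (R := ε / 2 * x)
      (by positivity) ((hF.mono (hcl z hz)).diffContOnCl_ball subset_rfl)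
      (fun w hw => hb w (hcl z hz (Metric.sphere_subset_closedBall hw)))
    refine h5.trans (le_of_eq ?_)
    rw [zpow_sub₀ hx.1.ne', zpow_one]
    field_simp
  · exact (hasDerivAt_of_real (hF.differentiableAt (Metric.isOpen_ball.mem_nhds (hsub hyb)))
      (eventually_eq he hy (hsub hyb))).2

theorem iteratedDeriv_real {f : ℝ → ℝ} (hf : IsHolSymbol a γ (fun x => (f x : ℂ))) (k : ℕ) :
    IsHolSymbol a (γ - k) (fun x => ((iteratedDeriv k f x : ℝ) : ℂ)) := by
  induction k with
  | zero => simpa using hf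
  | succ k ih =>
    have := ih.deriv_real
    rw [iteratedDeriv_succ]
    convert! this using 1
    push_cast
    ring

theorem contDiffOn {f : ℝ → ℝ} (hf : IsHolSymbol a γ (fun x => (f x : ℂ))) :
    ContDiffOn ℝ ∞ f (Ioo 0 a) := by
  obtain ⟨ε, C, h1, h2, h3, H⟩ := hf
  intro x hx
  obtain ⟨F, hF, hb, he⟩ := H x hx
  have hmem := mem_ball_self h1 hx.1
  have h5 : ContDiffAt ℂ ∞ F x :=
    (hF.analyticAt (Metric.isOpen_ball.mem_nhds hmem)).contDiffAt
  have h6 : ContDiffAt ℝ ∞ (fun y : ℝ => (F y).re) x :=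
    Complex.reCLM.contDiff.contDiffAt.comp x
      ((h5.restrict_scalars ℝ).comp x Complex.ofRealCLM.contDiff.contDiffAt)
  refine (h6.congr_of_eventuallyEq ?_).contDiffWithinAt
  filter_upwards [eventually_eq he hx hmem] with y hy
  rw [hy, Complex.ofReal_re]

theorem isSymbolO {f : ℝ → ℝ} (hf : IsHolSymbol a γ (fun x => (f x : ℂ))) :
    IsSymbolO γ a f := by
  refine ⟨hf.contDiffOn, fun k => ?_⟩
  obtain ⟨C, hC, H⟩ := (hf.iteratedDeriv_real k).exists_norm_le
  refine ⟨C, fun x hx => ?_⟩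
  have := H x hx
  rw [Complex.norm_real, Real.norm_eq_abs] at this
  rwa [show ((γ : ℝ) - k) = ((γ - k : ℤ) : ℝ) by push_cast; rfl, Real.rpow_intCast]

end IsHolSymbol

/-! ## Odd parts -/

/-- The odd part of a holomorphic function is an odd polynomial up to a term of high order. -/
theorem exists_odd_expansion (n : ℕ) {ρ : ℝ} :
    ∀ {h : ℂ → ℂ}, DifferentiableOn ℂ h (Metric.ball 0 ρ) →
    ∃ (c : ℕ → ℂ) (R : ℂ → ℂ), DifferentiableOn ℂ R (Metric.ball 0 ρ) ∧
      ∀ z ∈ Metric.ball (0 : ℂ) ρ,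
        h z - h (-z) = z * ∑ i ∈ Finset.range n, c i * (z ^ 2) ^ i + z ^ (2 * n + 1) * R z := by
  have hds : ∀ {h : ℂ → ℂ}, DifferentiableOn ℂ h (Metric.ball 0 ρ) →
      DifferentiableOn ℂ (dslope h 0) (Metric.ball 0 ρ) ∧
        ∀ z, h z = h 0 + z * dslope h 0 z := by
    intro h hh
    refine ⟨?_, fun z => ?_⟩
    · by_cases hρ : 0 < ρ
      · exact (Complex.differentiableOn_dslope (Metric.ball_mem_nhds _ hρ)).2 hh
      · rw [Metric.ball_eq_empty.2 (not_lt.1 hρ)]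
        exact differentiableOn_empty
    · have := sub_smul_dslope h 0 z
      rw [sub_zero, smul_eq_mul] at this
      rw [this]
      ring
  -- With two divided differences, `h(z) = h(0) + z k(z)` and `k(z) = k(0) + z g(z)`, one has `h(z)
  -- - h(-z) = 2 z k(0) + z² (g(z) - g(-z))`, and the induction hypothesis applies to `g`.
  induction n with
  | zero =>
    intro h hh
    obtain ⟨h1, h2⟩ := hds hh
    refine ⟨0, fun z => dslope h 0 z + dslope h 0 (-z), h1.add (h1.comp (differentiableOn_neg _)
      (fun z hz => by simpa using hz)), fun z _ => ?_⟩
    rw [h2 z, h2 (-z)]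
    simp
    ring
  | succ n ih =>
    intro h hh
    obtain ⟨h1, h2⟩ := hds hh
    obtain ⟨h3, h4⟩ := hds h1
    obtain ⟨c, R, hR, hc⟩ := ih h3
    refine ⟨fun i => if i = 0 then 2 * dslope h 0 0 else c (i - 1), R, hR, fun z hz => ?_⟩
    rw [h2 z, h2 (-z), h4 z, h4 (-z), Finset.sum_range_succ']
    have h5 := hc z hz
    simp only [Nat.add_eq_zero_iff, one_ne_zero, and_false, if_false, if_true, Nat.add_sub_cancel]
    have h6 : ∑ i ∈ Finset.range n, c i * (z ^ 2) ^ (i + 1)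
        = z ^ 2 * ∑ i ∈ Finset.range n, c i * (z ^ 2) ^ i := by
      rw [Finset.mul_sum]
      exact Finset.sum_congr rfl fun i _ => by ring
    rw [h6]
    linear_combination z ^ 2 * h5

/-- If `h` is holomorphic near `0` with `h (-x) = conj (h x)`, then `Im h` is, up to a symbol of
order `2 n + 1`, an odd polynomial. -/
theorem exists_im_expansion (n : ℕ) {ρ a : ℝ} (ha : 2 * a ≤ ρ) {h : ℂ → ℂ}
    (hh : DifferentiableOn ℂ h (Metric.ball 0 ρ))
    (hsym : ∀ x ∈ Ioo 0 a, h (-(x : ℂ)) = starRingEnd ℂ (h x)) {f : ℝ → ℝ} {g : ℝ → ℂ}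
    (hg : IsHolSymbol a (2 * n + 1 : ℕ) g) (hf : ∀ x ∈ Ioo 0 a, f x = (h x + g x).im) :
    ∃ P : Polynomial ℝ, P.degree < (n : WithBot ℕ) ∧
      IsHolSymbol a (2 * n + 1 : ℕ) (fun x => ((f x - x * P.eval (x ^ 2) : ℝ) : ℂ)) := by
  obtain ⟨c, R, hR, hc⟩ := exists_odd_expansion n hh
  -- By the symmetry, `h(x) - h(-x)` is `2i` times the imaginary part of `h`. The coefficients `c i
  -- / (2i)` are not known to be real, so real parts are taken of the whole identity.
  refine ⟨∑ i ∈ Finset.range n, Polynomial.monomial i (c i / (2 * Complex.I)).re, ?_, ?_⟩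
  · rw [← Polynomial.mem_degreeLT]
    refine Submodule.sum_mem _ fun i hi => Polynomial.mem_degreeLT.2 ?_
    exact (Polynomial.degree_monomial_le i _).trans_lt
      (by exact_mod_cast Finset.mem_range.1 hi)
  · have h1 := ((IsHolSymbol.pow a (2 * n + 1)).mul
      ((IsHolSymbol.of_differentiableOn hR ha).const_mul (1 / (2 * Complex.I)))).ofReal_re
    rw [add_zero] at h1
    refine (h1.add hg.ofReal_im).congr fun x hx => ?_
    rw [← Complex.ofReal_add, Complex.ofReal_inj, hf x hx, Complex.add_im]
    have hxb : (x : ℂ) ∈ Metric.ball (0 : ℂ) ρ := by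
      rw [Metric.mem_ball, dist_zero_right, Complex.norm_real, Real.norm_of_nonneg hx.1.le]
      linarith [hx.1, hx.2]
    have h2 := hc x hxb
    rw [hsym x hx] at h2
    have h3 : ((h x).im : ℂ) = x * ∑ i ∈ Finset.range n, c i / (2 * Complex.I) * ((x : ℂ) ^ 2) ^ i
        + (x : ℂ) ^ (2 * n + 1) * (1 / (2 * Complex.I) * R x) := by
      rw [Complex.im_eq_sub_conj, h2, add_div, mul_div_assoc, Finset.sum_div]
      congr 1
      · congr 1
        exact Finset.sum_congr rfl fun i _ => by ring
      · ring
    have h4 := congrArg Complex.re h3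
    rw [Complex.ofReal_re, Complex.add_re, Complex.re_ofReal_mul, Complex.re_sum] at h4
    have h5 : Polynomial.eval (x ^ 2)
        (∑ i ∈ Finset.range n, Polynomial.monomial i (c i / (2 * Complex.I)).re)
        = ∑ i ∈ Finset.range n, (c i / (2 * Complex.I) * ((x : ℂ) ^ 2) ^ i).re := by
      rw [Polynomial.eval_finsetSum]
      refine Finset.sum_congr rfl fun i _ => ?_
      rw [Polynomial.eval_monomial, ← Complex.ofReal_pow, ← Complex.ofReal_pow, Complex.re_mul_ofReal]
    rw [h5, h4]
    ring

end ReggeWheeler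

namespace ReggeWheeler

/-! ### From holomorphic symbols to the class `O_{2n+1}` -/

theorem iteratedDeriv_polynomial (q : Polynomial ℝ) (k : ℕ) :
    iteratedDeriv k (fun x => q.eval x) = fun x => (Polynomial.derivative^[k] q).eval x := by
  induction k with
  | zero => simp
  | succ k ih =>
    ext x
    rw [iteratedDeriv_succ, ih, Function.iterate_succ_apply', Polynomial.deriv]

/-- An odd polynomial plus a symbol of order `2 n + 1` is `O_{2n+1}`. -/
theorem IsOddO.of_isHolSymbol {n : ℕ} {a : ℝ} (ha : 0 < a) {f : ℝ → ℝ} (P : Polynomial ℝ)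
    (hf : IsHolSymbol a (2 * n + 1 : ℕ) (fun x => ((f x - x * P.eval (x ^ 2) : ℝ) : ℂ))) :
    IsOddO n a f := by
  -- The polynomial `q` is odd, so its derivatives of even order vanish at `0`; the remainder has
  -- `k`-th derivative of order `x ^ (2n + 1 - k)`, which tends to `0` for `k ≤ 2n`.
  set q : Polynomial ℝ := Polynomial.X * P.comp (Polynomial.X ^ 2) with hq
  have hqe : ∀ x, q.eval x = x * P.eval (x ^ 2) := fun x => by simp [hq]
  set r : ℝ → ℝ := fun x => f x - x * P.eval (x ^ 2) with hr
  have hfr : f = fun x => r x + q.eval x := by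
    ext x
    simp only [hr, hqe]
    ring
  have hrs := hf.contDiffOn
  have hqs : ContDiff ℝ ∞ (fun x => q.eval x) := by simpa using q.contDiff_aeval (𝕜 := ℝ) ∞
  have hder : ∀ k : ℕ, ∀ x ∈ Ioo 0 a,
      iteratedDeriv k f x = iteratedDeriv k r x + (Polynomial.derivative^[k] q).eval x := by
    intro k x hx
    have h1 : ContDiffAt ℝ k r x :=
      ((hrs.contDiffAt (isOpen_Ioo.mem_nhds hx)).of_le (by exact_mod_cast le_top))
    have h2 : ContDiffAt ℝ k (fun x => q.eval x) x :=
      hqs.contDiffAt.of_le (by exact_mod_cast le_top)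
    rw [hfr, iteratedDeriv_fun_add h1 h2, iteratedDeriv_polynomial]
  have hpoly : ∀ k : ℕ, ∃ B : ℝ, 0 ≤ B ∧ ∀ x ∈ Ioo 0 a,
      |(Polynomial.derivative^[k] q).eval x| ≤ B := by
    intro k
    obtain ⟨B, hB⟩ := (isCompact_Icc (a := 0) (b := a)).exists_bound_of_continuousOn
      (Polynomial.derivative^[k] q).continuous.continuousOn
    exact ⟨|B|, abs_nonneg B, fun x hx => (hB x ⟨hx.1.le, hx.2.le⟩).trans (le_abs_self B)⟩
  have hsym : ∀ k : ℕ, ∃ C : ℝ, 0 ≤ C ∧ ∀ x ∈ Ioo 0 a,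
      |iteratedDeriv k r x| ≤ C * x ^ (((2 * n + 1 : ℕ) : ℤ) - k) := by
    intro k
    obtain ⟨C, hC, H⟩ := (hf.iteratedDeriv_real k).exists_norm_le
    refine ⟨C, hC, fun x hx => ?_⟩
    have := H x hx
    rwa [Complex.norm_real] at this
  refine ⟨?_, fun k hk => ?_, fun k => ?_, fun k hk => ?_⟩
  · rw [hfr]
    exact hrs.add hqs.contDiffOn
  · obtain ⟨B, hB, hB'⟩ := hpoly k
    obtain ⟨C, hC, hC'⟩ := hsym k
    refine ⟨C * a ^ (2 * n + 1 - k) + B, fun x hx => ?_⟩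
    rw [hder k x hx]
    refine (abs_add_le _ _).trans (add_le_add ((hC' x hx).trans ?_) (hB' x hx))
    rw [← Nat.cast_sub hk, zpow_natCast]
    exact mul_le_mul_of_nonneg_left (pow_le_pow_left₀ hx.1.le hx.2.le _) hC
  · obtain ⟨B, hB, hB'⟩ := hpoly (2 * n + 1 + k)
    obtain ⟨C, hC, hC'⟩ := hsym (2 * n + 1 + k)
    refine ⟨C + B * a ^ k, fun x hx => ?_⟩
    rw [hder _ x hx, add_div]
    refine (abs_add_le _ _).trans (add_le_add ((hC' x hx).trans (le_of_eq ?_))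
      ((hB' x hx).trans ?_))
    · rw [show (((2 * n + 1 : ℕ) : ℤ) - ((2 * n + 1 + k : ℕ) : ℤ)) = -(k : ℤ) by
        push_cast; ring, zpow_neg, zpow_natCast, div_eq_mul_inv]
    · rw [mul_div_assoc, ← div_pow]
      refine le_mul_of_one_le_right hB (one_le_pow₀ ?_)
      rw [one_le_div hx.1]
      exact hx.2.le
  · obtain ⟨C, hC, hC'⟩ := hsym (2 * k)
    have h0 : (Polynomial.derivative^[2 * k] q).eval 0 = 0 := by
      rw [← Polynomial.coeff_zero_eq_eval_zero, Polynomial.coeff_iterate_derivative, hq, zero_add]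
      have : (Polynomial.X * P.comp (Polynomial.X ^ 2)).coeff (2 * k) = 0 := by
        rw [← Polynomial.expand_eq_comp_X_pow]
        rcases k with _ | k
        · simp
        · rw [show 2 * (k + 1) = (2 * k + 1) + 1 by ring, Polynomial.coeff_X_mul,
            Polynomial.coeff_expand (by norm_num), if_neg (by omega)]
      rw [this, smul_zero]
    have h1 : Tendsto (fun x => (Polynomial.derivative^[2 * k] q).eval x) (𝓝[>] 0) (𝓝 0) := by
      have := (Polynomial.derivative^[2 * k] q).continuous.tendsto 0
      rw [h0] at this
      exact this.mono_left nhdsWithin_le_nhds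
    have h2 : Tendsto (fun x : ℝ => C * x ^ (2 * n + 1 - 2 * k)) (𝓝[>] 0) (𝓝 0) := by
      have : Continuous (fun x : ℝ => C * x ^ (2 * n + 1 - 2 * k)) := by fun_prop
      have := this.tendsto 0
      rw [zero_pow (by omega), mul_zero] at this
      exact this.mono_left nhdsWithin_le_nhds
    have hev : ∀ᶠ x in 𝓝[>] (0 : ℝ), x ∈ Ioo 0 a := Ioo_mem_nhdsGT ha
    have h3 : Tendsto (iteratedDeriv (2 * k) r) (𝓝[>] 0) (𝓝 0) := by
      refine squeeze_zero_norm' ?_ h2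
      filter_upwards [hev] with x hx
      refine (hC' x hx).trans (le_of_eq ?_)
      rw [← Nat.cast_sub (by omega), zpow_natCast]
    have h4 := h3.add h1
    rw [add_zero] at h4
    refine h4.congr' ?_
    filter_upwards [hev] with x hx
    rw [hder _ x hx]

end ReggeWheeler

namespace ReggeWheeler

/-! ## The radius and the potential -/

theorem two_mul_lt_radius {M : ℝ} (hM : 0 < M) (x : ℝ) : 2 * M < radius M x :=
  ((radius_spec hM x _).1 rfl).1

theorem tortoise_radius {M : ℝ} (hM : 0 < M) (x : ℝ) : tortoise M (radius M x) = x :=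
  ((radius_spec hM x _).1 rfl).2

/-- The logarithm is increasing, so the tortoise coordinate has slope at least one. The inverse
function is therefore Lipschitz with constant one. -/
theorem sub_le_tortoise_sub {M : ℝ} (hM : 0 < M) {r s : ℝ} (hr : 2 * M < r) (hrs : r ≤ s) :
    s - r ≤ tortoise M s - tortoise M r := by
  have h1 : 0 < r / (2 * M) - 1 := by
    rw [sub_pos, one_lt_div (by positivity)]
    exact hr
  have h2 : r / (2 * M) - 1 ≤ s / (2 * M) - 1 := by gcongr
  have h3 := Real.log_le_log h1 h2
  unfold tortoise
  nlinarith

theorem abs_radius_sub_le {M : ℝ} (hM : 0 < M) (x y : ℝ) :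
    |radius M x - radius M y| ≤ |x - y| := by
  have key : ∀ x y, radius M x ≤ radius M y → |radius M x - radius M y| ≤ |x - y| := by
    intro x y h
    have := sub_le_tortoise_sub hM (two_mul_lt_radius hM x) h
    rw [tortoise_radius hM, tortoise_radius hM] at this
    rw [abs_sub_comm, abs_of_nonneg (sub_nonneg.2 h), abs_sub_comm]
    exact this.trans (le_abs_self _)
  rcases le_total (radius M x) (radius M y) with h | h
  · exact key x y h
  · rw [abs_sub_comm, abs_sub_comm x]
    exact key y x h

theorem continuous_radius {M : ℝ} (hM : 0 < M) : Continuous (radius M) := by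
  refine LipschitzWith.continuous (K := 1) (LipschitzWith.of_dist_le_mul fun x y => ?_)
  simpa [Real.dist_eq] using abs_radius_sub_le hM x y

theorem hasDerivAt_tortoise {M r : ℝ} (hM : 0 < M) (hr : 2 * M < r) :
    HasDerivAt (tortoise M) (1 - 2 * M / r)⁻¹ r := by
  have h0 : r / (2 * M) - 1 ≠ 0 := by
    rw [sub_ne_zero, Ne, div_eq_one_iff_eq (by positivity)]
    exact hr.ne'
  have h1 := (hasDerivAt_id r).add
    (((((hasDerivAt_id r).div_const (2 * M)).sub_const 1).log h0).const_mul (2 * M))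
  have hr0 : r ≠ 0 := by linarith
  have h3 : r - 2 * M ≠ 0 := by linarith
  refine h1.congr_deriv ?_
  have h4 : 1 - 2 * M / r ≠ 0 := by
    rw [sub_ne_zero, Ne, eq_comm, div_eq_one_iff_eq hr0]
    exact hr.ne
  simp only [id] at *
  field_simp
  ring

theorem hasDerivAt_radius {M : ℝ} (hM : 0 < M) (x : ℝ) :
    HasDerivAt (radius M) (1 - 2 * M / radius M x) x := by
  have h := two_mul_lt_radius hM x
  have h4 : 1 - 2 * M / radius M x ≠ 0 := by
    rw [sub_ne_zero, Ne, eq_comm, div_eq_one_iff_eq (by linarith)]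
    exact h.ne
  have := HasDerivAt.of_local_left_inverse (continuous_radius hM).continuousAt
    (hasDerivAt_tortoise hM h) (inv_ne_zero h4)
    (Eventually.of_forall fun y => tortoise_radius hM y)
  rwa [inv_inv] at this

/-- From `log y ≤ y - 1` at `y = r/(2M) - 1` follows `x ≤ 2r - 4M`. -/
theorem half_le_radius {M : ℝ} (hM : 0 < M) (x : ℝ) : x ≤ 2 * radius M x := by
  have h1 := two_mul_lt_radius hM x
  have h2 := tortoise_radius hM x
  have h3 : 0 < radius M x / (2 * M) - 1 := by
    rw [sub_pos, one_lt_div (by positivity)]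
    exact h1
  have h4 := Real.log_le_sub_one_of_pos h3
  unfold tortoise at h2
  have h5 : 2 * M * (radius M x / (2 * M) - 1 - 1) = radius M x - 4 * M := by
    field_simp
    ring
  nlinarith

/-- Since `2M log (r/(2M) - 1) = x - r ≤ x`, the quantity `r/(2M) - 1` is at most `e^{x/(2M)}`, and
it exceeds `1 - 2M/r` by `(r - 2M)²/(2Mr)`. The resulting exponential decay at the horizon is what
makes `f₋` holomorphic at `λ = 0`. -/
theorem radius_sub_le_exp {M : ℝ} (hM : 0 < M) (x : ℝ) :
    1 - 2 * M / radius M x ≤ Real.exp (x / (2 * M)) := by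
  have h1 := two_mul_lt_radius hM x
  have h2 := tortoise_radius hM x
  have h3 : 0 < radius M x / (2 * M) - 1 := by
    rw [sub_pos, one_lt_div (by positivity)]
    exact h1
  have h4 : 1 - 2 * M / radius M x ≤ radius M x / (2 * M) - 1 := by
    have h6 : 0 < radius M x := by linarith
    have h7 : 0 ≤ (radius M x - 2 * M) ^ 2 / (2 * M * radius M x) := by positivity
    have h8 : (radius M x - 2 * M) ^ 2 / (2 * M * radius M x)
        = (radius M x / (2 * M) - 1) - (1 - 2 * M / radius M x) := by
      field_simp
    linarith
  refine h4.trans ?_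
  rw [← Real.log_le_iff_le_exp h3, le_div_iff₀ (by positivity)]
  unfold tortoise at h2
  nlinarith

theorem continuous_potential {M : ℝ} (hM : 0 < M) (l : ℕ) (σ : ℝ) :
    Continuous (potential M l σ) := by
  have h1 := continuous_radius hM
  have h2 : ∀ x, radius M x ≠ 0 := fun x => by linarith [two_mul_lt_radius hM x]
  unfold potential
  exact (continuous_const.sub (continuous_const.div h1 h2)).mul
    ((continuous_const.div (h1.pow 2) fun x => pow_ne_zero 2 (h2 x)).add
      (continuous_const.div (h1.pow 3) fun x => pow_ne_zero 3 (h2 x)))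

/-- The sign is that of `ℓ(ℓ+1) r + 2Mσ` on `r > 2M`. For the excluded pairs it is zero for `(0,0)`,
negative for `(0,-3)`, and changes sign at `r = 3M` for `(1,-3)`; for `σ = -3` and `ℓ ≥ 2` it is at
least `6r - 6M`. -/
theorem potential_pos {M : ℝ} (hM : 0 < M) {l : ℕ} {σ : ℝ} (hσ : σ = -3 ∨ σ = 0 ∨ σ = 1)
    (hne : ¬(l = 0 ∧ σ = 0) ∧ ¬(l = 0 ∧ σ = -3) ∧ ¬(l = 1 ∧ σ = -3)) (x : ℝ) :
    0 < potential M l σ x := by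
  have h1 := two_mul_lt_radius hM x
  have hr : 0 < radius M x := by linarith
  have h2 : 0 < 1 - 2 * M / radius M x := by
    rw [sub_pos, div_lt_one hr]
    exact h1
  have h3 : 0 < (l : ℝ) * (l + 1) * radius M x + 2 * M * σ := by
    rcases hσ with rfl | rfl | rfl
    · have hl : 2 ≤ l := by
        by_contra hl
        have : l = 0 ∨ l = 1 := by omega
        rcases this with rfl | rfl <;> simp at hne
      have hl' : (2 : ℝ) ≤ l := by exact_mod_cast hl
      nlinarith [mul_nonneg (sub_nonneg.2 hl') hr.le,
        mul_nonneg (sub_nonneg.2 hl') (mul_nonneg (by linarith : (0:ℝ) ≤ l) hr.le)]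
    · have hl : 1 ≤ l := by
        by_contra hl
        have : l = 0 := by omega
        simp [this] at hne
      have hl' : (1 : ℝ) ≤ l := by exact_mod_cast hl
      have : 0 < (l : ℝ) * (l + 1) * radius M x := by positivity
      linarith
    · positivity
  unfold potential
  refine mul_pos h2 ?_
  have : (l : ℝ) * (l + 1) / radius M x ^ 2 + 2 * M * σ / radius M x ^ 3
      = ((l : ℝ) * (l + 1) * radius M x + 2 * M * σ) / radius M x ^ 3 := by
    field_simp
  rw [this]
  positivity

theorem exists_potential_le {M : ℝ} (hM : 0 < M) (l : ℕ) (σ : ℝ) :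
    ∃ C : ℝ, 0 < C ∧ (∀ x, potential M l σ x ≤ C / (1 + x ^ 2)) ∧
      ∀ x, potential M l σ x ≤ C * Real.exp (x / (2 * M)) := by
  set B : ℝ := (l : ℝ) * (l + 1) + |σ| + 1 with hB
  have hB0 : 0 < B := by positivity
  have hbr : ∀ x, potential M l σ x ≤ (1 - 2 * M / radius M x) * (B / radius M x ^ 2) := by
    intro x
    have h1 := two_mul_lt_radius hM x
    have hr : 0 < radius M x := by linarith
    have h2 : 0 < 1 - 2 * M / radius M x := by
      rw [sub_pos, div_lt_one hr]
      exact h1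
    unfold potential
    refine mul_le_mul_of_nonneg_left ?_ h2.le
    have h3 : 2 * M * σ / radius M x ^ 3 = (2 * M / radius M x) * σ / radius M x ^ 2 := by
      field_simp
    rw [h3, ← add_div]
    gcongr
    have h4 : 2 * M / radius M x * σ ≤ |σ| := by
      refine (le_abs_self _).trans ?_
      rw [abs_mul, abs_of_pos (by positivity)]
      exact mul_le_of_le_one_left (abs_nonneg σ) (by linarith)
    linarith
  have hexp : ∀ x, potential M l σ x ≤ B / (4 * M ^ 2) * Real.exp (x / (2 * M)) := by
    intro x
    have h1 := two_mul_lt_radius hM x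
    have hr : 0 < radius M x := by linarith
    refine (hbr x).trans ?_
    rw [mul_comm]
    have h5 : B / radius M x ^ 2 ≤ B / (4 * M ^ 2) := by
      gcongr
      nlinarith
    have h2 : 0 < 1 - 2 * M / radius M x := by
      rw [sub_pos, div_lt_one hr]
      exact h1
    exact mul_le_mul h5 (radius_sub_le_exp hM x) h2.le (by positivity)
  refine ⟨B * (1 / (4 * M ^ 2) + 4) * (1 + 8 * M ^ 2), by positivity, fun x => ?_, fun x => ?_⟩
  · rw [le_div_iff₀ (by positivity)]
    rcases le_total 0 x with hx | hx
    · have h1 := two_mul_lt_radius hM x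
      have hr : 0 < radius M x := by linarith
      have h3 := half_le_radius hM x
      have h4 : potential M l σ x ≤ B / radius M x ^ 2 := by
        refine (hbr x).trans (mul_le_of_le_one_left (by positivity) ?_)
        have : 0 < 2 * M / radius M x := by positivity
        linarith
      have h5 : 1 + x ^ 2 ≤ radius M x ^ 2 * (1 / (4 * M ^ 2) + 4) := by
        have : 1 ≤ radius M x ^ 2 * (1 / (4 * M ^ 2)) := by
          rw [mul_one_div, one_le_div (by positivity)]
          nlinarith
        nlinarith
      calc potential M l σ x * (1 + x ^ 2)
          ≤ B / radius M x ^ 2 * (radius M x ^ 2 * (1 / (4 * M ^ 2) + 4)) :=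
            mul_le_mul h4 h5 (by positivity) (by positivity)
        _ = B * (1 / (4 * M ^ 2) + 4) := by field_simp
        _ ≤ _ := le_mul_of_one_le_right (by positivity) (by nlinarith [sq_nonneg M])
    -- For `x ≤ 0` the quadratic bound follows from the exponential one, because `y²/2 ≤ e^y` at `y
    -- = -x/(2M)`.
    · have h1 := Real.quadratic_le_exp_of_nonneg (x := -x / (2 * M))
        (div_nonneg (by linarith) (by positivity))
      have h2 : 1 + x ^ 2 ≤ (1 + 8 * M ^ 2) * Real.exp (-x / (2 * M)) := by
        have h3 : x ^ 2 = 8 * M ^ 2 * ((-x / (2 * M)) ^ 2 / 2) := by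
          field_simp
          ring
        have h4 : 0 ≤ -x / (2 * M) := div_nonneg (by linarith) (by positivity)
        have h5 : 0 ≤ (-x / (2 * M)) ^ 2 := sq_nonneg _
        nlinarith [sq_nonneg M]
      have h3 : Real.exp (x / (2 * M)) * Real.exp (-x / (2 * M)) = 1 := by
        rw [← Real.exp_add, neg_div, add_neg_cancel, Real.exp_zero]
      calc potential M l σ x * (1 + x ^ 2)
          ≤ (B / (4 * M ^ 2) * Real.exp (x / (2 * M))) *
            ((1 + 8 * M ^ 2) * Real.exp (-x / (2 * M))) :=
            mul_le_mul (hexp x) h2 (by positivity) (by positivity)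
        _ = B / (4 * M ^ 2) * (1 + 8 * M ^ 2) *
            (Real.exp (x / (2 * M)) * Real.exp (-x / (2 * M))) := by ring
        _ = B * (1 / (4 * M ^ 2)) * (1 + 8 * M ^ 2) := by rw [h3]; ring
        _ ≤ _ := by gcongr; linarith
  · refine (hexp x).trans ?_
    gcongr
    calc B / (4 * M ^ 2) = B * (1 / (4 * M ^ 2)) := by ring
      _ ≤ B * (1 / (4 * M ^ 2) + 4) := by gcongr; linarith
      _ ≤ _ := le_mul_of_one_le_right (by positivity) (by nlinarith [sq_nonneg M])

/-! ## The potential in the complex domain -/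

/-- The tortoise coordinate of a complex radius. -/
noncomputable def complexTortoise (M : ℝ) (ρ : ℂ) : ℂ :=
  ρ + 2 * M * Complex.log (ρ / (2 * M) - 1)

/-- A sector around the positive real axis, away from the origin. -/
def sector (R : ℝ) : Set ℂ := {z | R < z.re ∧ |z.im| < z.re}

theorem isOpen_sector (R : ℝ) : IsOpen (sector R) :=
  (isOpen_lt continuous_const Complex.continuous_re).inter
    (isOpen_lt (continuous_abs.comp Complex.continuous_im) Complex.continuous_re)

theorem tortoise_re_pos {M : ℝ} (hM : 0 < M) {ρ : ℂ} (h : 6 * M < ρ.re) :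
    2 < (ρ / (2 * M) - 1).re := by
  have : (ρ / (2 * M) - 1).re = ρ.re / (2 * M) - 1 := by
    rw [show (2 * M : ℂ) = ((2 * M : ℝ) : ℂ) by push_cast; rfl, Complex.sub_re,
      Complex.div_ofReal_re, Complex.one_re]
  rw [this]
  have : 3 < ρ.re / (2 * M) := by
    rw [lt_div_iff₀ (by positivity)]
    linarith
  linarith

/-- The derivative bound one half makes the complex tortoise map a contractive perturbation of the
identity on `Re ρ > 6M`: it is injective with Lipschitz inverse, and it can be inverted by a fixed
point iteration. -/
theorem hasDerivAt_log_tortoise {M : ℝ} (hM : 0 < M) {ρ : ℂ} (h : 6 * M < ρ.re) :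
    HasDerivAt (fun ρ : ℂ => 2 * M * Complex.log (ρ / (2 * M) - 1)) (2 * M / (ρ - 2 * M)) ρ ∧
      ‖2 * M / (ρ - 2 * M)‖ ≤ 1 / 2 := by
  have h1 := tortoise_re_pos hM h
  have hM' : (M : ℂ) ≠ 0 := by exact_mod_cast hM.ne'
  have h2 : 4 * M ≤ ‖ρ - 2 * M‖ := by
    refine le_trans ?_ ((le_abs_self _).trans (Complex.abs_re_le_norm _))
    simp only [Complex.sub_re, Complex.mul_re, Complex.re_ofNat, Complex.ofReal_re,
      Complex.im_ofNat, Complex.ofReal_im]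
    linarith
  have h3 : ρ - 2 * M ≠ 0 := by
    rw [← norm_pos_iff]
    linarith
  constructor
  · have h4 := ((((hasDerivAt_id ρ).div_const (2 * (M : ℂ))).sub_const 1).clog
      (Or.inl (by simp only [id]; linarith))).const_mul (2 * (M : ℂ))
    refine h4.congr_deriv ?_
    have h5 : ρ / (2 * M) - 1 ≠ 0 := by
      intro h0
      simp only [h0, Complex.zero_re] at h1
      linarith
    simp only [id]
    have h6 : ρ / (2 * M) - 1 = (ρ - 2 * M) / (2 * M) := by field_simp
    rw [h6]
    field_simp
  · rw [norm_div, div_le_iff₀ (by linarith)]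
    simp only [norm_mul, Complex.norm_ofNat, Complex.norm_real, Real.norm_of_nonneg hM.le]
    linarith

theorem norm_log_tortoise_sub_le {M : ℝ} (hM : 0 < M) {ρ ρ' : ℂ} (h : 6 * M < ρ.re)
    (h' : 6 * M < ρ'.re) :
    ‖2 * M * Complex.log (ρ / (2 * M) - 1) - 2 * M * Complex.log (ρ' / (2 * M) - 1)‖
      ≤ 1 / 2 * ‖ρ - ρ'‖ := by
  have hc : Convex ℝ {z : ℂ | 6 * M < z.re} := convex_halfSpace_re_gt _
  exact hc.norm_image_sub_le_of_norm_hasDerivWithin_le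
    (fun z hz => (hasDerivAt_log_tortoise hM hz).1.hasDerivWithinAt)
    (fun z hz => (hasDerivAt_log_tortoise hM hz).2) h' h

theorem norm_sub_le_complexTortoise_sub {M : ℝ} (hM : 0 < M) {ρ ρ' : ℂ} (h : 6 * M < ρ.re)
    (h' : 6 * M < ρ'.re) :
    ‖ρ - ρ'‖ ≤ 2 * ‖complexTortoise M ρ - complexTortoise M ρ'‖ := by
  have h1 := norm_log_tortoise_sub_le hM h h'
  have h2 : ρ - ρ' = (complexTortoise M ρ - complexTortoise M ρ') -
      (2 * M * Complex.log (ρ / (2 * M) - 1) - 2 * M * Complex.log (ρ' / (2 * M) - 1)) := by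
    unfold complexTortoise
    ring
  have h3 := norm_sub_le (complexTortoise M ρ - complexTortoise M ρ')
      (2 * M * Complex.log (ρ / (2 * M) - 1) - 2 * M * Complex.log (ρ' / (2 * M) - 1))
  rw [← h2] at h3
  linarith

/-- Banach's fixed point theorem for `ρ ↦ z - 2M log (ρ/(2M) - 1)` on the closed ball of radius `‖z‖
/ 4`. On this ball the logarithmic term is at most `‖z‖/20 + 86M`, which is below `‖z‖/4` because
`‖z‖ ≥ 1000M`. -/
theorem exists_complexTortoise_eq {M : ℝ} (hM : 0 < M) {z : ℂ} (hz : z ∈ sector (1000 * M)) :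
    ∃ ρ : ℂ, 6 * M < ρ.re ∧ ‖ρ - z‖ ≤ ‖z‖ / 4 ∧ complexTortoise M ρ = z := by
  obtain ⟨hz1, hz2⟩ := hz
  have hzn : z.re ≤ ‖z‖ := (le_abs_self _).trans (Complex.abs_re_le_norm z)
  have hzn2 : ‖z‖ ≤ 3 / 2 * z.re := by
    have h1 : ‖z‖ ^ 2 = z.re ^ 2 + z.im ^ 2 := by
      rw [Complex.sq_norm, Complex.normSq_apply]
      ring
    have h2 : z.im ^ 2 ≤ z.re ^ 2 := by
      rw [← sq_abs z.im]
      exact pow_le_pow_left₀ (abs_nonneg _) hz2.le 2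
    have h3 : 0 < z.re := by linarith
    nlinarith [norm_nonneg z]
  have hre : ∀ ρ ∈ Metric.closedBall z (‖z‖ / 4), 6 * M < ρ.re := by
    intro ρ hρ
    rw [Metric.mem_closedBall, dist_eq_norm] at hρ
    have h1 := (Complex.abs_re_le_norm (ρ - z)).trans hρ
    rw [Complex.sub_re, abs_le] at h1
    linarith
  set g : ℂ → ℂ := fun ρ => z - 2 * M * Complex.log (ρ / (2 * M) - 1) with hg
  have hmaps : MapsTo g (Metric.closedBall z (‖z‖ / 4)) (Metric.closedBall z (‖z‖ / 4)) := by
    intro ρ hρ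
    have h0 := tortoise_re_pos hM (hre ρ hρ)
    have h0' : 2 < ‖ρ / (2 * M) - 1‖ :=
      h0.trans_le ((le_abs_self _).trans (Complex.abs_re_le_norm _))
    rw [Metric.mem_closedBall, dist_eq_norm] at *
    have h1 : ‖ρ / (2 * M) - 1‖ ≤ ‖z‖ / M := by
      have h2 : ‖ρ‖ ≤ 5 / 4 * ‖z‖ := by
        have := norm_add_le (ρ - z) z
        rw [sub_add_cancel] at this
        linarith
      refine (norm_sub_le _ _).trans ?_
      rw [norm_div, norm_mul, Complex.norm_ofNat, Complex.norm_real, Real.norm_of_nonneg hM.le,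
        norm_one, div_add_one (by positivity), div_le_div_iff₀ (by positivity) hM]
      nlinarith
    -- Dividing by `40` before using `log y ≤ y - 1` gives a bound of small slope, at the price of a
    -- constant.
    have h3 : Real.log ‖ρ / (2 * M) - 1‖ ≤ ‖z‖ / M / 40 + 39 := by
      have h4 : Real.log (‖ρ / (2 * M) - 1‖ / 40) ≤ ‖ρ / (2 * M) - 1‖ / 40 - 1 :=
        Real.log_le_sub_one_of_pos (by linarith)
      rw [Real.log_div (by linarith) (by norm_num)] at h4
      have h5 : Real.log 40 ≤ 40 - 1 := Real.log_le_sub_one_of_pos (by norm_num)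
      linarith
    have h4 : ‖Complex.log (ρ / (2 * M) - 1)‖ ≤ ‖z‖ / M / 40 + 39 + 4 := by
      refine (Complex.norm_le_abs_re_add_abs_im _).trans ?_
      rw [Complex.log_re, Complex.log_im, abs_of_nonneg (Real.log_nonneg (by linarith))]
      have := Complex.abs_arg_le_pi (ρ / (2 * M) - 1)
      have := Real.pi_le_four
      linarith
    rw [hg]
    simp only [sub_sub_cancel_left, norm_neg, norm_mul, Complex.norm_ofNat, Complex.norm_real,
      Real.norm_of_nonneg hM.le]
    calc 2 * M * ‖Complex.log (ρ / (2 * M) - 1)‖ ≤ 2 * M * (‖z‖ / M / 40 + 39 + 4) := by gcongr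
      _ = ‖z‖ / 20 + 86 * M := by
        field_simp
        ring
      _ ≤ ‖z‖ / 4 := by linarith
  have hcontr : ContractingWith (1 / 2) (hmaps.restrict g _ _) := by
    refine ⟨by norm_num, LipschitzWith.of_dist_le_mul fun a b => ?_⟩
    rw [Subtype.dist_eq, Subtype.dist_eq, dist_eq_norm, dist_eq_norm]
    have := norm_log_tortoise_sub_le hM (hre a a.2) (hre b b.2)
    simp only [MapsTo.val_restrict_apply, hg, sub_sub_sub_cancel_left]
    rw [norm_sub_rev]
    simpa using this
  obtain ⟨ρ, hρ, hfix, -⟩ := hcontr.exists_fixedPoint' Metric.isClosed_closedBall.isComplete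
    hmaps (Metric.mem_closedBall_self (by positivity)) (edist_ne_top _ _)
  refine ⟨ρ, hre ρ hρ, by rwa [Metric.mem_closedBall, dist_eq_norm] at hρ, ?_⟩
  unfold complexTortoise
  have : g ρ = ρ := hfix
  rw [hg] at this
  linear_combination -this

theorem complexTortoise_ofReal {M r : ℝ} (hM : 0 < M) (hr : 2 * M < r) :
    complexTortoise M r = (tortoise M r : ℝ) := by
  have h3 : 0 ≤ r / (2 * M) - 1 := by
    rw [sub_nonneg, one_le_div (by positivity)]
    exact hr.le
  unfold complexTortoise tortoise
  push_cast
  rw [Complex.ofReal_log h3]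
  push_cast
  rfl

/-- The potential extends holomorphically, with quadratic decay, to a sector around `+∞`. -/
theorem exists_complex_potential {M : ℝ} (hM : 0 < M) (l : ℕ) (σ : ℝ) :
    ∃ (Vc : ℂ → ℂ) (R C : ℝ), 0 < R ∧ 0 < C ∧ DifferentiableOn ℂ Vc (sector R) ∧
      (∀ z ∈ sector R, ‖Vc z‖ ≤ C / ‖z‖ ^ 2) ∧
      ∀ x : ℝ, R < x → Vc x = potential M l σ x := by
  -- The root is picked pointwise. The estimate `norm_sub_le_complexTortoise_sub` makes it
  -- Lipschitz, hence differentiable as a local inverse, and forces it to be `radius M x` at real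
  -- points.
  choose! ρ h1 h2 h3 using fun z hz => exists_complexTortoise_eq hM (z := z) hz
  set S := sector (1000 * M) with hS
  have hSo : IsOpen S := isOpen_sector _
  have hρc : ContinuousOn ρ S := by
    refine LipschitzOnWith.continuousOn (K := 2) (LipschitzOnWith.of_dist_le_mul
      fun z hz w hw => ?_)
    have := norm_sub_le_complexTortoise_sub hM (h1 z hz) (h1 w hw)
    rw [h3 z hz, h3 w hw] at this
    simpa [dist_eq_norm] using this
  have hρ0 : ∀ z ∈ S, ρ z ≠ 0 := by
    intro z hz h0
    have := h1 z hz
    rw [h0, Complex.zero_re] at this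
    linarith
  have hρd : DifferentiableOn ℂ ρ S := by
    intro z hz
    have hd := (hasDerivAt_id (ρ z)).add (hasDerivAt_log_tortoise hM (h1 z hz)).1
    have hne : 1 + 2 * (M : ℂ) / (ρ z - 2 * M) ≠ 0 := by
      intro h0
      have h4 := (hasDerivAt_log_tortoise hM (h1 z hz)).2
      rw [← neg_eq_of_add_eq_zero_right h0, norm_neg, norm_one] at h4
      norm_num at h4
    exact (HasDerivAt.of_local_left_inverse (f := complexTortoise M)
      (hρc.continuousAt (hSo.mem_nhds hz)) hd hne
      (by filter_upwards [hSo.mem_nhds hz] with w hw using h3 w hw)).differentiableAt.differentiableWithinAt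
  set B : ℝ := (l : ℝ) * (l + 1) + |σ| + 1 with hB
  have hB0 : 0 < B := by positivity
  refine ⟨fun z => (1 - 2 * M / ρ z) * ((l : ℂ) * (l + 1) / ρ z ^ 2 + 2 * M * σ / ρ z ^ 3),
    1000 * M, 4 * B, by positivity, by positivity, ?_, fun z hz => ?_, fun x hx => ?_⟩
  · exact ((differentiableOn_const _).sub ((differentiableOn_const _).div hρd hρ0)).mul
      (((differentiableOn_const _).div (hρd.pow 2) fun z hz => pow_ne_zero 2 (hρ0 z hz)).add
      ((differentiableOn_const _).div (hρd.pow 3) fun z hz => pow_ne_zero 3 (hρ0 z hz)))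
  · have hz0 : 0 < ‖z‖ := by
      have : z.re ≤ ‖z‖ := (le_abs_self _).trans (Complex.abs_re_le_norm z)
      linarith [hz.1]
    have h4 : 3 / 4 * ‖z‖ ≤ ‖ρ z‖ := by
      have h5 := norm_sub_norm_le z (ρ z)
      have h6 := h2 z hz
      rw [norm_sub_rev] at h6
      linarith
    have hr : 0 < ‖ρ z‖ := by linarith
    have h7 : ‖2 * (M : ℂ) / ρ z‖ ≤ 1 / 2 := by
      rw [norm_div, norm_mul, Complex.norm_ofNat, Complex.norm_real, Real.norm_of_nonneg hM.le,
        div_le_iff₀ hr]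
      have : (ρ z).re ≤ ‖ρ z‖ := (le_abs_self _).trans (Complex.abs_re_le_norm _)
      linarith [h1 z hz]
    have h8 : ‖1 - 2 * (M : ℂ) / ρ z‖ ≤ 3 / 2 := by
      refine (norm_sub_le _ _).trans ?_
      rw [norm_one]
      linarith
    have h9 : ‖(l : ℂ) * (l + 1) / ρ z ^ 2 + 2 * M * σ / ρ z ^ 3‖ ≤ B / ‖ρ z‖ ^ 2 := by
      have e : (l : ℂ) * (l + 1) / ρ z ^ 2 + 2 * M * σ / ρ z ^ 3
          = ((l : ℂ) * (l + 1) + 2 * M / ρ z * σ) / ρ z ^ 2 := by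
        have := hρ0 z hz
        field_simp
      rw [e, norm_div, norm_pow]
      gcongr
      refine (norm_add_le _ _).trans ?_
      have e1 : ‖(l : ℂ) * (l + 1)‖ = (l : ℝ) * (l + 1) := by
        have : (l : ℂ) * (l + 1) = (((l : ℝ) * (l + 1) : ℝ) : ℂ) := by push_cast; rfl
        rw [this, Complex.norm_real, Real.norm_of_nonneg (by positivity)]
      rw [e1, norm_mul, Complex.norm_real, Real.norm_eq_abs]
      nlinarith [abs_nonneg σ]
    rw [norm_mul]
    calc _ ≤ 3 / 2 * (B / ‖ρ z‖ ^ 2) := mul_le_mul h8 h9 (norm_nonneg _) (by norm_num)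
      _ ≤ 3 / 2 * (B / (3 / 4 * ‖z‖) ^ 2) := by gcongr
      _ = 8 / 3 * B / ‖z‖ ^ 2 := by
        field_simp
        ring
      _ ≤ 4 * B / ‖z‖ ^ 2 := by gcongr; norm_num
  · have hxS : (x : ℂ) ∈ S := by
      refine ⟨by simpa using hx, ?_⟩
      simp only [Complex.ofReal_im, Complex.ofReal_re, abs_zero]
      linarith [show 0 < 1000 * M by positivity]
    have hrx : ρ x = (radius M x : ℝ) := by
      have h4 := norm_sub_le_complexTortoise_sub hM (h1 x hxS) (ρ' := (radius M x : ℝ))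
        (by rw [Complex.ofReal_re]; linarith [half_le_radius hM x])
      rw [h3 x hxS, complexTortoise_ofReal hM (two_mul_lt_radius hM x), tortoise_radius hM,
        sub_self, norm_zero, mul_zero] at h4
      exact sub_eq_zero.1 (norm_le_zero_iff.1 h4)
    simp only [hrx, potential]
    push_cast
    rfl

end ReggeWheeler

namespace ReggeWheeler
open MeasureTheory

/-! ## Weights for Volterra operators -/

/-- If `G' = -k` and `G → 0`, then `∫_t^∞ k e^{2G} = (e^{2G(t)} - 1)/2`. The factor two in the
exponent produces the one half, so no smallness of `k` is needed. -/
theorem IsVolterraWeight.of_primitive_Ioi {S : Set ℝ} (hS : MeasurableSet S)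
    (hup : ∀ t ∈ S, Ici t ⊆ S) {k G : ℝ → ℝ} (hk : ∀ s ∈ S, 0 ≤ k s)
    (hG : ∀ s ∈ S, HasDerivAt G (-k s) s) (hlim : Tendsto G atTop (𝓝 0)) :
    IsVolterraWeight S (fun t => (Ioi t).indicator k) (fun t => Real.exp (2 * G t)) := by
  have hder : ∀ s ∈ S, HasDerivAt (fun s => -Real.exp (2 * G s) / 2)
      (k s * Real.exp (2 * G s)) s := by
    intro s hs
    refine ((((hG s hs).const_mul 2).exp.neg).div_const 2).congr_deriv ?_
    ring
  have hl : Tendsto (fun s => -Real.exp (2 * G s) / 2) atTop (𝓝 (-1 / 2)) := by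
    have := (((Real.continuous_exp.tendsto _).comp (hlim.const_mul 2)).neg).div_const 2
    simpa using this
  have hnn : ∀ s ∈ S, 0 ≤ k s * Real.exp (2 * G s) := fun s hs =>
    mul_nonneg (hk s hs) (Real.exp_pos _).le
  have heq : ∀ t, (fun s => (Ioi t).indicator k s * Real.exp (2 * G s))
      = (Ioi t).indicator (fun s => k s * Real.exp (2 * G s)) := by
    intro t
    ext s
    by_cases hs : s ∈ Ioi t <;> simp [hs]
  have hsub : ∀ t ∈ S, Ioi t ⊆ S := fun t ht => Ioi_subset_Ici_self.trans (hup t ht)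
  refine ⟨hS, fun t _ => (Real.exp_pos _).le, fun t ht => ?_, fun t ht => ?_⟩
  · rw [heq]
    exact ((integrable_indicator_iff measurableSet_Ioi).2 (integrableOn_Ioi_deriv_of_nonneg'
      (fun s hs => hder s (hup t ht hs)) (fun s hs => hnn s (hsub t ht hs)) hl)).integrableOn
  · rw [heq, setIntegral_indicator measurableSet_Ioi, inter_eq_self_of_subset_right (hsub t ht),
      integral_Ioi_of_hasDerivAt_of_nonneg' (fun s hs => hder s (hup t ht hs))
        (fun s hs => hnn s (hsub t ht hs)) hl]
    linarith

/-- The forward analogue: `∫_a^t k e^{2G} = (e^{2G(t)} - e^{2G(a)})/2`. -/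
theorem IsVolterraWeight.of_primitive_Iic {a : ℝ} {k G : ℝ → ℝ}
    (hkc : Continuous k) (hG : ∀ s, HasDerivAt G (k s) s) :
    IsVolterraWeight (Ici a) (fun t => (Iic t).indicator k) (fun t => Real.exp (2 * G t)) := by
  have hGc : Continuous G := continuous_iff_continuousAt.2 fun s => (hG s).continuousAt
  have hder : ∀ s, HasDerivAt (fun s => Real.exp (2 * G s) / 2)
      (k s * Real.exp (2 * G s)) s := by
    intro s
    refine ((((hG s).const_mul 2).exp).div_const 2).congr_deriv ?_
    ring
  have heq : ∀ t, (fun s => (Iic t).indicator k s * Real.exp (2 * G s))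
      = (Iic t).indicator (fun s => k s * Real.exp (2 * G s)) := by
    intro t
    ext s
    by_cases hs : s ∈ Iic t <;> simp [hs]
  have hc : Continuous fun s => k s * Real.exp (2 * G s) := by fun_prop
  refine ⟨measurableSet_Ici, fun t _ => (Real.exp_pos _).le, fun t ht => ?_, fun t ht => ?_⟩
  · rw [heq, IntegrableOn, integrable_indicator_iff measurableSet_Iic, IntegrableOn,
      Measure.restrict_restrict measurableSet_Iic]
    rw [inter_comm, Ici_inter_Iic]
    exact hc.continuousOn.integrableOn_compact isCompact_Icc
  · rw [heq, setIntegral_indicator measurableSet_Iic, Ici_inter_Iic, integral_Icc_eq_integral_Ioc,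
      ← intervalIntegral.integral_of_le ht,
      intervalIntegral.integral_eq_sub_of_hasDerivAt (fun s _ => hder s)
        (hc.intervalIntegrable _ _)]
    linarith [Real.exp_pos (2 * G a)]

/-! ## Solutions and Wronskians -/

section Solutions

variable {F : Type*} [NormedAddCommGroup F] [NormedSpace ℝ F] {V : ℝ → ℝ} {E : ℝ} {f g : ℝ → F}

theorem IsSolution.hasDerivAt (h : IsSolution V E f) (x : ℝ) : HasDerivAt f (deriv f x) x :=
  (h.contDiff.differentiable (by norm_num) x).hasDerivAt

theorem IsSolution.hasDerivAt_deriv (h : IsSolution V E f) (x : ℝ) :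
    HasDerivAt (deriv f) ((V x - E) • f x) x := by
  have h1 : ContDiff ℝ 1 (deriv f) := by
    have := h.contDiff
    rw [show (2 : WithTop ℕ∞) = 1 + 1 by norm_num, contDiff_succ_iff_deriv] at this
    exact this.2.2
  have h2 := (h1.differentiable (by norm_num) x).hasDerivAt
  have h3 := h.eqn x
  rw [sub_smul, ← h3]
  simpa using h2

theorem IsSolution.continuous (h : IsSolution V E f) : Continuous f := h.contDiff.continuous

theorem IsSolution.of_hasDerivAt (hV : Continuous V) (hf : ∀ x, HasDerivAt f (g x) x)
    (hg : ∀ x, HasDerivAt g ((V x - E) • f x) x) : IsSolution V E f ∧ deriv f = g := by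
  have hfg : deriv f = g := funext fun x => (hf x).deriv
  have hgg : deriv g = fun x => (V x - E) • f x := funext fun x => (hg x).deriv
  have hfc : Continuous f := continuous_iff_continuousAt.2 fun x => (hf x).continuousAt
  refine ⟨⟨?_, fun x => ?_⟩, hfg⟩
  · rw [show (2 : WithTop ℕ∞) = 1 + 1 by norm_num, contDiff_succ_iff_deriv, hfg]
    refine ⟨fun x => (hf x).differentiableAt, by simp, ?_⟩
    rw [contDiff_one_iff_deriv, hgg]
    exact ⟨fun x => (hg x).differentiableAt, by fun_prop⟩
  · rw [hfg, hgg]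
    simp [sub_smul]

/-- Exchanges the two ends of the line, so that the theory of `f₋` is reduced to that of `f₊`. -/
theorem IsSolution.reflect (h : IsSolution V E f) (hV : Continuous V) (x₀ : ℝ) :
    IsSolution (fun s => V (x₀ - s)) E (fun s => f (x₀ - s)) ∧
      deriv (fun s => f (x₀ - s)) = fun s => -deriv f (x₀ - s) := by
  refine IsSolution.of_hasDerivAt (by fun_prop) (fun s => ?_) (fun s => ?_)
  · have := (h.hasDerivAt (x₀ - s)).scomp s ((hasDerivAt_id s).const_sub x₀)
    simpa [Function.comp_def] using this
  · have := ((h.hasDerivAt_deriv (x₀ - s)).scomp s ((hasDerivAt_id s).const_sub x₀)).neg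
    refine (this.congr_deriv ?_).congr_of_eventuallyEq (Eventually.of_forall fun y => ?_)
    · simp
    · simp

end Solutions

theorem wronskian_const {𝕜 : Type*} [RCLike 𝕜] {V : ℝ → ℝ} {E : ℝ} {f g : ℝ → 𝕜}
    (hf : IsSolution V E f) (hg : IsSolution V E g) (x y : ℝ) :
    wronskian f g x = wronskian f g y := by
  have hd : ∀ x, HasDerivAt (wronskian f g) 0 x := by
    intro x
    have := ((hf.hasDerivAt x).mul (hg.hasDerivAt_deriv x)).sub
      ((hf.hasDerivAt_deriv x).mul (hg.hasDerivAt x))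
    refine this.congr_deriv ?_
    simp only [RCLike.real_smul_eq_coe_mul]
    ring
  exact is_const_of_deriv_eq_zero (fun x => (hd x).differentiableAt) (fun x => (hd x).deriv) x y

theorem IsSolution.ofReal {V : ℝ → ℝ} {E : ℝ} {u : ℝ → ℝ} (hV : Continuous V)
    (h : IsSolution V E u) : IsSolution V E (fun x => (u x : ℂ)) ∧
      deriv (fun x => (u x : ℂ)) = fun x => ((deriv u x : ℝ) : ℂ) := by
  refine IsSolution.of_hasDerivAt hV (fun x => (h.hasDerivAt x).ofReal_comp) (fun x => ?_)
  have := (h.hasDerivAt_deriv x).ofReal_comp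
  refine this.congr_deriv ?_
  simp

theorem IsSolution.conj {V : ℝ → ℝ} {E : ℝ} {f : ℝ → ℂ} (hV : Continuous V)
    (h : IsSolution V E f) : IsSolution V E (fun x => starRingEnd ℂ (f x)) ∧
      deriv (fun x => starRingEnd ℂ (f x)) = fun x => starRingEnd ℂ (deriv f x) := by
  refine IsSolution.of_hasDerivAt hV (fun x => ?_) (fun x => ?_)
  · exact Complex.conjCLE.toContinuousLinearMap.hasFDerivAt.comp_hasDerivAt x (h.hasDerivAt x)
  · refine (Complex.conjCLE.toContinuousLinearMap.hasFDerivAt.comp_hasDerivAt x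
      (h.hasDerivAt_deriv x)).congr_deriv ?_
    simp

theorem IsSolution.re_mul {V : ℝ → ℝ} {E : ℝ} {f : ℝ → ℂ} (hV : Continuous V)
    (h : IsSolution V E f) (c : ℂ) : IsSolution V E (fun x => (c * f x).re) ∧
      deriv (fun x => (c * f x).re) = fun x => (c * deriv f x).re := by
  refine IsSolution.of_hasDerivAt hV (fun x => ?_) (fun x => ?_)
  · exact Complex.reCLM.hasFDerivAt.comp_hasDerivAt x ((h.hasDerivAt x).const_mul c)
  · refine (Complex.reCLM.hasFDerivAt.comp_hasDerivAt x
      ((h.hasDerivAt_deriv x).const_mul c)).congr_deriv ?_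
    simp only [Complex.reCLM_apply, Complex.real_smul, smul_eq_mul]
    rw [mul_left_comm, Complex.re_ofReal_mul]

/-! ## Tail integrals -/

section Tail

variable {F : Type*} [NormedAddCommGroup F]

theorem intervalIntegrable_of_integrableOn_Ioi {h : ℝ → F} (hi : ∀ a, IntegrableOn h (Ioi a))
    (a b : ℝ) : IntervalIntegrable h volume a b := by
  rw [intervalIntegrable_iff]
  exact (hi (min a b)).mono_set Ioc_subset_Ioi_self

variable [NormedSpace ℝ F] {h : ℝ → F}

theorem integral_Ioi_eq_sub (hi : ∀ a, IntegrableOn h (Ioi a)) :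
    (fun x => ∫ y in Ioi x, h y) = fun x => (∫ y in Ioi 0, h y) - ∫ y in (0)..x, h y := by
  ext x
  rw [← intervalIntegral.integral_interval_add_Ioi (hi 0) (hi x)]
  simp

theorem continuous_integral_Ioi (hi : ∀ a, IntegrableOn h (Ioi a)) :
    Continuous fun x => ∫ y in Ioi x, h y := by
  rw [integral_Ioi_eq_sub hi]
  exact continuous_const.sub
    (intervalIntegral.continuous_primitive (intervalIntegrable_of_integrableOn_Ioi hi) 0)

theorem hasDerivAt_integral_Ioi [CompleteSpace F] (hc : Continuous h) (hi : ∀ a, IntegrableOn h (Ioi a))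
    (x : ℝ) : HasDerivAt (fun x => ∫ y in Ioi x, h y) (-h x) x := by
  rw [integral_Ioi_eq_sub hi]
  exact (intervalIntegral.integral_hasDerivAt_right
    (intervalIntegrable_of_integrableOn_Ioi hi 0 x) (hc.stronglyMeasurableAtFilter _ _)
    hc.continuousAt).const_sub _

theorem tendsto_integral_Ioi_zero (hi : ∀ a, IntegrableOn h (Ioi a)) :
    Tendsto (fun x => ∫ y in Ioi x, h y) atTop (𝓝 0) := by
  rw [integral_Ioi_eq_sub hi]
  have := (intervalIntegral_tendsto_integral_Ioi (0 : ℝ) (hi 0) tendsto_id).const_sub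
    (∫ y in Ioi 0, h y)
  rw [sub_self] at this
  exact this

end Tail

/-! ## The integral operators of the Jost solutions -/

/-- `∫_x^∞ sin (lam (y - x)) / lam · h(y) dy`. -/
noncomputable def sinTail (lam : ℝ) (h : ℝ → ℂ) (x : ℝ) : ℂ :=
  ∫ y in Ioi x, ((Real.sin (lam * (y - x)) / lam : ℝ) : ℂ) * h y

/-- `∫_x^∞ cos (lam (y - x)) · h(y) dy`. -/
noncomputable def cosTail (lam : ℝ) (h : ℝ → ℂ) (x : ℝ) : ℂ :=
  ∫ y in Ioi x, ((Real.cos (lam * (y - x)) : ℝ) : ℂ) * h y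

section SinTail

variable {lam : ℝ} {h : ℝ → ℂ}

theorem integrableOn_bdd_mul {s : Set ℝ} (hi : IntegrableOn h s) {b : ℝ → ℝ}
    (hb : Continuous b) (hb1 : ∀ y, |b y| ≤ 1) : IntegrableOn (fun y => (b y : ℂ) * h y) s := by
  refine hi.norm.mono' (((Complex.continuous_ofReal.comp hb).aestronglyMeasurable).mul
    hi.aestronglyMeasurable) (Eventually.of_forall fun y => ?_)
  rw [norm_mul, Complex.norm_real]
  exact mul_le_of_le_one_left (norm_nonneg _) (hb1 y)

theorem integrableOn_cos_mul {s : Set ℝ} (hi : IntegrableOn h s) :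
    IntegrableOn (fun y => ((Real.cos (lam * y) : ℝ) : ℂ) * h y) s :=
  integrableOn_bdd_mul hi (by fun_prop) fun _ => Real.abs_cos_le_one _

theorem integrableOn_sin_mul {s : Set ℝ} (hi : IntegrableOn h s) :
    IntegrableOn (fun y => ((Real.sin (lam * y) : ℝ) : ℂ) * h y) s :=
  integrableOn_bdd_mul hi (by fun_prop) fun _ => Real.abs_sin_le_one _

/-- The addition theorem separates `x` from `y`. Continuity and derivatives then reduce to those of
two tail integrals whose integrands do not depend on `x`. -/
theorem sinTail_eq (hi : ∀ a, IntegrableOn h (Ioi a)) : sinTail lam h = fun x =>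
    (((Real.cos (lam * x) : ℝ) : ℂ) * (∫ y in Ioi x, ((Real.sin (lam * y) : ℝ) : ℂ) * h y)
      - ((Real.sin (lam * x) : ℝ) : ℂ) * (∫ y in Ioi x, ((Real.cos (lam * y) : ℝ) : ℂ) * h y))
      / lam := by
  ext x
  rw [← integral_const_mul, ← integral_const_mul,
    ← integral_sub ((integrableOn_sin_mul (hi x)).const_mul _)
      ((integrableOn_cos_mul (hi x)).const_mul _), ← integral_div, sinTail]
  congr 1
  ext y
  rw [mul_sub, Real.sin_sub]
  push_cast
  ring

theorem cosTail_eq (hi : ∀ a, IntegrableOn h (Ioi a)) : cosTail lam h = fun x =>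
    ((Real.cos (lam * x) : ℝ) : ℂ) * (∫ y in Ioi x, ((Real.cos (lam * y) : ℝ) : ℂ) * h y)
      + ((Real.sin (lam * x) : ℝ) : ℂ) *
        (∫ y in Ioi x, ((Real.sin (lam * y) : ℝ) : ℂ) * h y) := by
  ext x
  rw [← integral_const_mul, ← integral_const_mul,
    ← integral_add ((integrableOn_cos_mul (hi x)).const_mul _)
      ((integrableOn_sin_mul (hi x)).const_mul _), cosTail]
  congr 1
  ext y
  rw [mul_sub, Real.cos_sub]
  push_cast
  ring

theorem continuous_sinTail (hi : ∀ a, IntegrableOn h (Ioi a)) : Continuous (sinTail lam h) := by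
  rw [sinTail_eq hi]
  have h1 := continuous_integral_Ioi fun a => integrableOn_sin_mul (lam := lam) (hi a)
  have h2 := continuous_integral_Ioi fun a => integrableOn_cos_mul (lam := lam) (hi a)
  fun_prop

theorem hasDerivAt_sinTail (hlam : lam ≠ 0) (hc : Continuous h)
    (hi : ∀ a, IntegrableOn h (Ioi a)) (x : ℝ) :
    HasDerivAt (sinTail lam h) (-cosTail lam h x) x := by
  have h1 := hasDerivAt_integral_Ioi (h := fun y => ((Real.sin (lam * y) : ℝ) : ℂ) * h y)
    (by fun_prop) (fun a => integrableOn_sin_mul (lam := lam) (hi a)) x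
  have h2 := hasDerivAt_integral_Ioi (h := fun y => ((Real.cos (lam * y) : ℝ) : ℂ) * h y)
    (by fun_prop) (fun a => integrableOn_cos_mul (lam := lam) (hi a)) x
  have hcs : HasDerivAt (fun x : ℝ => ((Real.cos (lam * x) : ℝ) : ℂ))
      ((-Real.sin (lam * x) * lam : ℝ) : ℂ) x :=
    (((hasDerivAt_id x).const_mul lam).cos.congr_deriv (by simp)).ofReal_comp
  have hsn : HasDerivAt (fun x : ℝ => ((Real.sin (lam * x) : ℝ) : ℂ))
      ((Real.cos (lam * x) * lam : ℝ) : ℂ) x :=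
    (((hasDerivAt_id x).const_mul lam).sin.congr_deriv (by simp)).ofReal_comp
  rw [sinTail_eq hi, cosTail_eq hi]
  refine (((hcs.mul h1).sub (hsn.mul h2)).div_const (lam : ℂ)).congr_deriv ?_
  have : (lam : ℂ) ≠ 0 := by exact_mod_cast hlam
  push_cast
  field_simp
  ring

theorem hasDerivAt_cosTail (hlam : lam ≠ 0) (hc : Continuous h)
    (hi : ∀ a, IntegrableOn h (Ioi a)) (x : ℝ) :
    HasDerivAt (cosTail lam h) (-h x + (lam : ℂ) ^ 2 * sinTail lam h x) x := by
  have h1 := hasDerivAt_integral_Ioi (h := fun y => ((Real.sin (lam * y) : ℝ) : ℂ) * h y)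
    (by fun_prop) (fun a => integrableOn_sin_mul (lam := lam) (hi a)) x
  have h2 := hasDerivAt_integral_Ioi (h := fun y => ((Real.cos (lam * y) : ℝ) : ℂ) * h y)
    (by fun_prop) (fun a => integrableOn_cos_mul (lam := lam) (hi a)) x
  have hcs : HasDerivAt (fun x : ℝ => ((Real.cos (lam * x) : ℝ) : ℂ))
      ((-Real.sin (lam * x) * lam : ℝ) : ℂ) x :=
    (((hasDerivAt_id x).const_mul lam).cos.congr_deriv (by simp)).ofReal_comp
  have hsn : HasDerivAt (fun x : ℝ => ((Real.sin (lam * x) : ℝ) : ℂ))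
      ((Real.cos (lam * x) * lam : ℝ) : ℂ) x :=
    (((hasDerivAt_id x).const_mul lam).sin.congr_deriv (by simp)).ofReal_comp
  rw [sinTail_eq hi, cosTail_eq hi]
  refine ((hcs.mul h2).add (hsn.mul h1)).congr_deriv ?_
  have h3 : (lam : ℂ) ≠ 0 := by exact_mod_cast hlam
  have h4 : ((Real.cos (lam * x) : ℝ) : ℂ) * ((Real.cos (lam * x) : ℝ) : ℂ)
      + ((Real.sin (lam * x) : ℝ) : ℂ) * ((Real.sin (lam * x) : ℝ) : ℂ) = 1 := by
    rw [← Complex.ofReal_mul, ← Complex.ofReal_mul, ← Complex.ofReal_add, ← sq, ← sq,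
      Real.cos_sq_add_sin_sq, Complex.ofReal_one]
  have h5 : ∀ A B : ℂ, (lam : ℂ) ^ 2 * ((((Real.cos (lam * x) : ℝ) : ℂ) * A
      - ((Real.sin (lam * x) : ℝ) : ℂ) * B) / lam) = lam * (((Real.cos (lam * x) : ℝ) : ℂ) * A
      - ((Real.sin (lam * x) : ℝ) : ℂ) * B) := by
    intro A B
    field_simp
  rw [h5]
  push_cast at *
  linear_combination (-h x) * h4

theorem tendsto_tail_zero (hi : ∀ a, IntegrableOn h (Ioi a)) {b : ℝ → ℝ → ℝ} {B : ℝ}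
    (hb : ∀ x y, |b x y| ≤ B) :
    Tendsto (fun x => ∫ y in Ioi x, (b x y : ℂ) * h y) atTop (𝓝 0) := by
  have h1 : Tendsto (fun x => B * ∫ y in Ioi x, ‖h y‖) atTop (𝓝 0) := by
    have := (tendsto_integral_Ioi_zero fun a => (hi a).norm).const_mul B
    rwa [mul_zero] at this
  refine squeeze_zero_norm (fun x => ?_) h1
  rw [← integral_const_mul]
  refine norm_integral_le_of_norm_le ((hi x).norm.const_mul B) (Eventually.of_forall fun y => ?_)
  rw [norm_mul, Complex.norm_real]
  exact mul_le_mul_of_nonneg_right (hb x y) (norm_nonneg _)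

theorem tendsto_sinTail (hi : ∀ a, IntegrableOn h (Ioi a)) :
    Tendsto (sinTail lam h) atTop (𝓝 0) :=
  tendsto_tail_zero hi (b := fun x y => Real.sin (lam * (y - x)) / lam) (B := 1 / |lam|)
    fun x y => by
      rw [abs_div]
      exact div_le_div_of_nonneg_right (Real.abs_sin_le_one _) (abs_nonneg _)

theorem tendsto_cosTail (hi : ∀ a, IntegrableOn h (Ioi a)) :
    Tendsto (cosTail lam h) atTop (𝓝 0) :=
  tendsto_tail_zero hi (b := fun x y => Real.cos (lam * (y - x))) (B := 1)
    fun _ _ => Real.abs_cos_le_one _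

end SinTail

end ReggeWheeler

namespace ReggeWheeler
open MeasureTheory

/-! ## Jost solutions -/

theorem measurable_indicator_Ioi {f : ℝ → ℝ → ℂ} (hf : Measurable (fun p : ℝ × ℝ => f p.1 p.2)) :
    Measurable (fun p : ℝ × ℝ => (Ioi p.1).indicator (f p.1) p.2) := by
  have := hf.indicator (measurableSet_lt measurable_fst measurable_snd)
  convert! this using 1

theorem measurable_indicator_Iic {f : ℝ → ℝ → ℂ} (hf : Measurable (fun p : ℝ × ℝ => f p.1 p.2)) :
    Measurable (fun p : ℝ × ℝ => (Iic p.1).indicator (f p.1) p.2) := by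
  have := hf.indicator (measurableSet_le measurable_snd measurable_fst)
  convert! this using 1

theorem norm_indicator_le_indicator {s : Set ℝ} {f : ℝ → ℂ} {k : ℝ → ℝ} {y : ℝ}
    (h : y ∈ s → ‖f y‖ ≤ k y) : ‖s.indicator f y‖ ≤ s.indicator k y := by
  by_cases hy : y ∈ s
  · simpa [hy] using h hy
  · simp [hy]

theorem norm_exp_I_mul (lam x : ℝ) : ‖Complex.exp (Complex.I * lam * x)‖ = 1 := by
  have : Complex.I * lam * x = ((lam * x : ℝ) : ℂ) * Complex.I := by
    push_cast
    ring
  rw [this, Complex.norm_exp_ofReal_mul_I]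

theorem hasDerivAt_exp_I_mul (lam x : ℝ) :
    HasDerivAt (fun x : ℝ => Complex.exp (Complex.I * lam * x))
      (Complex.I * lam * Complex.exp (Complex.I * lam * x)) x := by
  have h1 : HasDerivAt (fun x : ℝ => (x : ℂ)) 1 x := (hasDerivAt_id x).ofReal_comp
  have := (h1.const_mul (Complex.I * lam)).cexp
  refine this.congr_deriv ?_
  ring

theorem IsSolution.const_mul {V : ℝ → ℝ} {E : ℝ} {f : ℝ → ℂ} (hV : Continuous V)
    (h : IsSolution V E f) (c : ℂ) : IsSolution V E (fun x => c * f x) ∧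
      deriv (fun x => c * f x) = fun x => c * deriv f x := by
  refine IsSolution.of_hasDerivAt hV (fun x => (h.hasDerivAt x).const_mul c) (fun x => ?_)
  refine ((h.hasDerivAt_deriv x).const_mul c).congr_deriv ?_
  simp only [Complex.real_smul]
  ring

section Jost

variable {V : ℝ → ℝ} {C lam : ℝ}

theorem integrableOn_mul_of_bounded (hV : Continuous V) (hVb : ∀ x, |V x| ≤ C / (1 + x ^ 2))
    {f : ℝ → ℂ} (hf : Measurable f) {a B : ℝ} (hB : ∀ x ∈ Ioi a, ‖f x‖ ≤ B) :
    IntegrableOn (fun y => (V y : ℂ) * f y) (Ioi a) := by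
  have h1 : IntegrableOn (fun y : ℝ => B * C * (1 + y ^ 2)⁻¹) (Ioi a) :=
    (integrable_inv_one_add_sq.const_mul (B * C)).integrableOn
  refine h1.mono' ((Complex.measurable_ofReal.comp hV.measurable).mul hf).aestronglyMeasurable ?_
  filter_upwards [ae_restrict_mem measurableSet_Ioi] with y hy
  rw [norm_mul, Complex.norm_real, Real.norm_eq_abs]
  calc |V y| * ‖f y‖ ≤ C / (1 + y ^ 2) * B :=
        mul_le_mul (hVb y) (hB y hy) (norm_nonneg _) ((abs_nonneg _).trans (hVb y))
    _ = _ := by ring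

/-- Solves `f = e^{iλx} + ∫_x^∞ sin(λ(y - x))/λ · V f`. The kernel is dominated by `C/(λ(1 + y²))`,
whose tail integral is an arctangent, so the weight is bounded on the whole line. -/
theorem exists_isJostPlus (hV : Continuous V) (hVb : ∀ x, |V x| ≤ C / (1 + x ^ 2))
    (hlam : 0 < lam) : ∃ f, IsJostPlus V lam f := by
  have hC : 0 ≤ C := by
    have := (abs_nonneg _).trans (hVb 0)
    simpa using this
  set k : ℝ → ℝ := fun s => C / lam / (1 + s ^ 2) with hk
  set G : ℝ → ℝ := fun s => C / lam * (Real.pi / 2 - Real.arctan s) with hG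
  have hk0 : ∀ s, 0 ≤ k s := fun s => by positivity
  have hw := IsVolterraWeight.of_primitive_Ioi (S := univ) MeasurableSet.univ
    (fun _ _ => subset_univ _) (k := k) (G := G) (fun s _ => hk0 s)
    (fun s _ => by
      refine (((Real.hasDerivAt_arctan s).const_sub _).const_mul _).congr_deriv ?_
      simp only [hk]
      ring)
    (by
      have h1 : Tendsto Real.arctan atTop (𝓝 (Real.pi / 2)) :=
        tendsto_nhds_of_tendsto_nhdsWithin Real.tendsto_arctan_atTop
      have := (h1.const_sub (Real.pi / 2)).const_mul (C / lam)
      simpa using this)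
  have hG0 : ∀ s, 0 ≤ G s := fun s =>
    mul_nonneg (by positivity) (by linarith [Real.arctan_lt_pi_div_two s])
  have hG1 : ∀ s, G s ≤ C / lam * Real.pi := fun s =>
    mul_le_mul_of_nonneg_left (by linarith [Real.neg_pi_div_two_lt_arctan s]) (by positivity)
  set k0 : ℝ → ℝ → ℂ := fun t s => ((Real.sin (lam * (s - t)) / lam : ℝ) : ℂ) * (V s : ℂ) with hk0'
  set K : ℝ → ℝ → ℂ := fun t => (Ioi t).indicator (k0 t) with hK
  have hKm : Measurable (fun p : ℝ × ℝ => K p.1 p.2) :=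
    measurable_indicator_Ioi (by
      refine Continuous.measurable ?_
      simp only [hk0']
      fun_prop)
  have hKb : ∀ t ∈ (univ : Set ℝ), ∀ s ∈ (univ : Set ℝ), ‖K t s‖ ≤ (Ioi t).indicator k s := by
    intro t _ s _
    refine norm_indicator_le_indicator fun _ => ?_
    simp only [hk0', hk, norm_mul, Complex.norm_real, norm_div, Real.norm_eq_abs, abs_of_pos hlam]
    have h1 := Real.abs_sin_le_one (lam * (s - t))
    calc |Real.sin (lam * (s - t))| / lam * |V s| ≤ 1 / lam * (C / (1 + s ^ 2)) := by
          gcongr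
          exact hVb s
      _ = _ := by ring
  set e : ℝ → ℂ := fun x => Complex.exp (Complex.I * lam * x) with he
  have hec : Continuous e := by fun_prop
  have heb : ∀ s ∈ (univ : Set ℝ), ‖e s‖ ≤ 1 * Real.exp (2 * G s) := by
    intro s _
    rw [he, norm_exp_I_mul, one_mul]
    exact Real.one_le_exp (by linarith [hG0 s])
  set g := volterraSol univ K e with hg
  have hgm : Measurable g := volterraSol_measurable hKm hec.measurable
  have hgb : ∀ t, ‖g t‖ ≤ 2 * Real.exp (2 * (C / lam * Real.pi)) := by
    intro t
    have h1 := hw.norm_sol_le hKm hec.measurable hKb heb t (mem_univ t)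
    refine h1.trans ?_
    rw [mul_one]
    gcongr
    exact hG1 t
  have hi : ∀ a, IntegrableOn (fun y => (V y : ℂ) * g y) (Ioi a) := fun a =>
    integrableOn_mul_of_bounded hV hVb hgm fun x _ => hgb x
  have hge : ∀ t, g t = e t + sinTail lam (fun y => (V y : ℂ) * g y) t := by
    intro t
    have h1 := hw.sol_eq hKm hec.measurable hKb heb t (mem_univ t)
    rw [← hg] at h1
    rw [h1, sinTail, Measure.restrict_univ, ← integral_indicator measurableSet_Ioi]
    congr 2
    ext s
    by_cases hs : s ∈ Ioi t
    · simp only [hK, hk0', indicator_of_mem hs, mul_assoc]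
    · simp [hK, indicator_of_notMem hs]
  have hgc : Continuous g := by
    rw [show g = fun t => e t + sinTail lam (fun y => (V y : ℂ) * g y) t from funext hge]
    exact hec.add (continuous_sinTail hi)
  have hhc : Continuous (fun y => (V y : ℂ) * g y) := by fun_prop
  have hd1 : ∀ x, HasDerivAt g (Complex.I * lam * e x
      - cosTail lam (fun y => (V y : ℂ) * g y) x) x := by
    intro x
    have := (hasDerivAt_exp_I_mul lam x).add (hasDerivAt_sinTail hlam.ne' hhc hi x)
    rw [← sub_eq_add_neg] at this
    exact this.congr_of_eventuallyEq (Eventually.of_forall hge)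
  have hd2 : ∀ x, HasDerivAt (fun x => Complex.I * lam * e x
      - cosTail lam (fun y => (V y : ℂ) * g y) x) ((V x - lam ^ 2) • g x) x := by
    intro x
    have := ((hasDerivAt_exp_I_mul lam x).const_mul (Complex.I * lam)).sub
      (hasDerivAt_cosTail hlam.ne' hhc hi x)
    refine this.congr_deriv ?_
    have h1 := hge x
    simp only [Complex.real_smul]
    push_cast
    linear_combination (lam : ℂ) ^ 2 * h1 + (lam : ℂ) ^ 2 * e x * Complex.I_sq
  refine ⟨g, (IsSolution.of_hasDerivAt hV hd1 hd2).1, ?_⟩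
  have h2 : Tendsto (fun x => sinTail lam (fun y => (V y : ℂ) * g y) x / e x) atTop (𝓝 0) := by
    refine squeeze_zero_norm (fun x => ?_) (tendsto_norm_zero.comp (tendsto_sinTail hi (lam := lam)))
    rw [norm_div, he, norm_exp_I_mul, div_one]
    rfl
  have h3 := h2.const_add 1
  rw [add_zero] at h3
  refine h3.congr fun x => ?_
  rw [hge x, add_div, div_self (Complex.exp_ne_zero _)]

variable {f : ℝ → ℂ}

theorem IsJostPlus.tendsto_sub (h : IsJostPlus V lam f) :
    Tendsto (fun x : ℝ => f x - Complex.exp (Complex.I * lam * x)) atTop (𝓝 0) := by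
  have h1 := (h.asymp.sub_const 1).norm
  rw [sub_self, norm_zero] at h1
  refine squeeze_zero_norm (fun x => ?_) h1
  rw [div_sub_one (Complex.exp_ne_zero _), norm_div, norm_exp_I_mul, div_one]

theorem IsJostPlus.exists_norm_le (h : IsJostPlus V lam f) (a : ℝ) :
    ∃ B, ∀ x ∈ Ici a, ‖f x‖ ≤ B := by
  have h1 := h.tendsto_sub.norm
  rw [norm_zero] at h1
  obtain ⟨X, hX⟩ := eventually_atTop.1 (h1.eventually (gt_mem_nhds one_pos))
  obtain ⟨B, hB⟩ := (isCompact_Icc (a := a) (b := X)).exists_bound_of_continuousOn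
    h.sol.continuous.continuousOn
  refine ⟨max B 2, fun x hx => ?_⟩
  rcases le_total x X with hx' | hx'
  · exact (hB x ⟨hx, hx'⟩).trans (le_max_left _ _)
  · refine le_trans ?_ (le_max_right _ _)
    have h2 := hX x hx'
    have h3 := norm_add_le (f x - Complex.exp (Complex.I * lam * x))
      (Complex.exp (Complex.I * lam * x))
    rw [sub_add_cancel, norm_exp_I_mul] at h3
    linarith

theorem IsJostPlus.integrableOn (hV : Continuous V) (hVb : ∀ x, |V x| ≤ C / (1 + x ^ 2))
    (h : IsJostPlus V lam f) (a : ℝ) : IntegrableOn (fun y => (V y : ℂ) * f y) (Ioi a) := by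
  obtain ⟨B, hB⟩ := h.exists_norm_le a
  exact integrableOn_mul_of_bounded hV hVb h.sol.continuous.measurable
    fun x hx => hB x (Ioi_subset_Ici_self hx)

/-- A solution of `D'' = -lam² D` that tends to zero at infinity vanishes. -/
theorem eq_zero_of_tendsto_zero (hlam : 0 < lam) {D D' : ℝ → ℂ}
    (h1 : ∀ x, HasDerivAt D (D' x) x) (h2 : ∀ x, HasDerivAt D' (-(lam : ℂ) ^ 2 * D x) x)
    (h0 : Tendsto D atTop (𝓝 0)) (x : ℝ) : D x = 0 ∧ D' x = 0 := by
  have hl : (lam : ℂ) ≠ 0 := by exact_mod_cast hlam.ne'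
  set e : ℝ → ℂ := fun x => Complex.exp (Complex.I * lam * x) with he
  have hconst : ∀ s : ℂ, s ^ 2 = 1 → ∀ x y,
      (D' x + s * (Complex.I * lam * D x)) * Complex.exp (-s * (Complex.I * lam * x)) =
      (D' y + s * (Complex.I * lam * D y)) * Complex.exp (-s * (Complex.I * lam * y)) := by
    intro s hs x y
    have hd : ∀ x : ℝ, HasDerivAt (fun x : ℝ => (D' x + s * (Complex.I * lam * D x)) *
        Complex.exp (-s * (Complex.I * lam * x))) 0 x := by
      intro x
      have h3 : HasDerivAt (fun x : ℝ => (x : ℂ)) 1 x := (hasDerivAt_id x).ofReal_comp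
      refine (((h2 x).add (((h1 x).const_mul (Complex.I * lam)).const_mul s)).mul
        (((h3.const_mul (Complex.I * lam)).const_mul (-s)).cexp)).congr_deriv ?_
      simp only [Pi.add_apply]
      linear_combination (-(lam : ℂ) ^ 2 * D x * Complex.I ^ 2 *
        Complex.exp (-s * (Complex.I * lam * x))) * hs - (lam : ℂ) ^ 2 * D x *
        Complex.exp (-s * (Complex.I * lam * x)) * Complex.I_sq
    exact is_const_of_deriv_eq_zero (fun x => (hd x).differentiableAt) (fun x => (hd x).deriv) x y
  set α := D' 0 + 1 * (Complex.I * lam * D 0) with hα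
  set β := D' 0 + -1 * (Complex.I * lam * D 0) with hβ
  have hA : ∀ x, D' x + Complex.I * lam * D x = α * e x := by
    intro x
    have := hconst 1 (by norm_num) x 0
    simp only [Complex.ofReal_zero, mul_zero, Complex.exp_zero, mul_one] at this
    rw [hα, ← this, he]
    simp only [mul_assoc, ← Complex.exp_add]
    simp
  have hB : ∀ x, D' x - Complex.I * lam * D x = β * Complex.exp (-(Complex.I * lam * x)) := by
    intro x
    have := hconst (-1) (by norm_num) x 0
    simp only [Complex.ofReal_zero, mul_zero, Complex.exp_zero, mul_one] at this
    rw [hβ, ← this]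
    simp only [mul_assoc, ← Complex.exp_add]
    simp [sub_eq_add_neg]
  -- Only `D`, not `D'`, is known to tend to zero. A shift by a quarter period multiplies `e` by
  -- `i`, and the combination of `D x` and `D (x + τ)` in `hlim` cancels `β` and leaves `α e x`,
  -- which has constant modulus.
  set τ : ℝ := Real.pi / (2 * lam) with hτ
  have hshift : ∀ x : ℝ, e (x + τ) = Complex.I * e x := by
    intro x
    have h3 : Complex.I * lam * ((x + τ : ℝ) : ℂ)
        = Complex.I * lam * x + Real.pi / 2 * Complex.I := by
      rw [hτ]
      push_cast
      field_simp
    simp only [he]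
    rw [h3, Complex.exp_add, Complex.exp_pi_div_two_mul_I]
    ring
  have hinv : ∀ x : ℝ, Complex.exp (-(Complex.I * lam * x)) = (e x)⁻¹ := fun x =>
    Complex.exp_neg _
  have hlim : Tendsto (fun x : ℝ => ‖Complex.I * lam * D x - Complex.I * (Complex.I * lam * D (x + τ))‖)
      atTop (𝓝 0) := by
    have h3 := h0.comp (tendsto_atTop_add_const_right atTop τ tendsto_id)
    have := ((h0.const_mul (Complex.I * lam)).sub
      ((h3.const_mul (Complex.I * lam)).const_mul Complex.I)).norm
    simpa using this
  have hnorm : ∀ x, ‖e x‖ = 1 := fun x => norm_exp_I_mul lam x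
  have hα0 : α = 0 := by
    have h3 : ∀ x, ‖Complex.I * lam * D x - Complex.I * (Complex.I * lam * D (x + τ))‖ = ‖α‖ := by
      intro x
      have e1 := hA x
      have e2 := hB x
      have e3 := hA (x + τ)
      have e4 := hB (x + τ)
      rw [hinv] at e2 e4
      rw [hshift] at e3 e4
      have h5 : e x ≠ 0 := Complex.exp_ne_zero _
      rw [mul_inv, Complex.inv_I] at e4
      have h6 : Complex.I * lam * D x - Complex.I * (Complex.I * lam * D (x + τ)) = α * e x := by
        linear_combination (e1 - e2) / 2 - Complex.I * (e3 - e4) / 2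
          - (α * e x + β * (e x)⁻¹) / 2 * Complex.I_sq
      rw [h6, norm_mul, hnorm, mul_one]
    simp only [h3] at hlim
    exact norm_eq_zero.1 (tendsto_nhds_unique tendsto_const_nhds hlim)
  have hβ0 : β = 0 := by
    have h3 : Tendsto (fun x => ‖-(2 * (Complex.I * lam * D x))‖) atTop (𝓝 0) := by
      have := (((h0.const_mul (Complex.I * lam)).const_mul 2).neg).norm
      simpa using this
    have h4 : ∀ x, ‖-(2 * (Complex.I * lam * D x))‖ = ‖β‖ := by
      intro x
      have e1 := hA x
      have e2 := hB x
      rw [hα0] at e1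
      have h6 : -(2 * (Complex.I * lam * D x)) = β * Complex.exp (-(Complex.I * lam * x)) := by
        linear_combination e2 - e1
      rw [h6, norm_mul, hinv, norm_inv, hnorm, inv_one, mul_one]
    simp only [h4] at h3
    exact norm_eq_zero.1 (tendsto_nhds_unique tendsto_const_nhds h3)
  have e1 := hA x
  have e2 := hB x
  rw [hα0, zero_mul] at e1
  rw [hβ0, zero_mul] at e2
  have e3 : D' x = 0 := by linear_combination (e1 + e2) / 2
  rw [e3, zero_add] at e1
  refine ⟨?_, e3⟩
  simpa [hl, Complex.I_ne_zero] using e1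

/-- The difference of the two sides solves the free equation and tends to zero, so it vanishes
together with its derivative. -/
theorem IsJostPlus.eq_integral (hV : Continuous V) (hVb : ∀ x, |V x| ≤ C / (1 + x ^ 2))
    (hlam : 0 < lam) (h : IsJostPlus V lam f) (x : ℝ) :
    f x = Complex.exp (Complex.I * lam * x) + sinTail lam (fun y => (V y : ℂ) * f y) x ∧
    deriv f x = Complex.I * lam * Complex.exp (Complex.I * lam * x)
      - cosTail lam (fun y => (V y : ℂ) * f y) x := by
  have hi := fun a => h.integrableOn hV hVb a
  have hc : Continuous (fun y => (V y : ℂ) * f y) := by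
    have := h.sol.continuous
    fun_prop
  have key := eq_zero_of_tendsto_zero hlam
    (D := fun x => f x - Complex.exp (Complex.I * lam * x)
      - sinTail lam (fun y => (V y : ℂ) * f y) x)
    (D' := fun x => deriv f x - Complex.I * lam * Complex.exp (Complex.I * lam * x)
      - -cosTail lam (fun y => (V y : ℂ) * f y) x)
    (fun x => ((h.sol.hasDerivAt x).sub (hasDerivAt_exp_I_mul lam x)).sub
      (hasDerivAt_sinTail hlam.ne' hc hi x))
    (fun x => by
      refine (((h.sol.hasDerivAt_deriv x).sub
        ((hasDerivAt_exp_I_mul lam x).const_mul (Complex.I * lam))).sub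
        (hasDerivAt_cosTail hlam.ne' hc hi x).neg).congr_deriv ?_
      simp only [Complex.real_smul]
      push_cast
      linear_combination -(lam : ℂ) ^ 2 * Complex.exp (Complex.I * lam * x) * Complex.I_sq)
    (by simpa using h.tendsto_sub.sub (tendsto_sinTail hi)) x
  constructor
  · linear_combination key.1
  · linear_combination key.2

/-- The Wronskian of `f` with its conjugate is constant, and its value is read off at infinity,
where `f' conj f` tends to `iλ`. This nonvanishing determinant allows every real solution to be
expressed through `f`. -/
theorem IsJostPlus.im_deriv_mul_conj (hV : Continuous V) (hVb : ∀ x, |V x| ≤ C / (1 + x ^ 2))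
    (hlam : 0 < lam) (h : IsJostPlus V lam f) (x : ℝ) :
    (deriv f x * starRingEnd ℂ (f x)).im = lam := by
  have hcj := h.sol.conj hV
  have hW : ∀ y, (deriv f y * starRingEnd ℂ (f y)).im = (deriv f x * starRingEnd ℂ (f x)).im := by
    intro y
    have h1 := congrArg Complex.im (wronskian_const h.sol hcj.1 y x)
    simp only [wronskian, hcj.2, Complex.sub_im, Complex.mul_im, Complex.conj_re,
      Complex.conj_im] at h1 ⊢
    linarith
  have hi := fun a => h.integrableOn hV hVb a
  have hs := tendsto_sinTail hi (lam := lam)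
  have hcs := tendsto_cosTail hi (lam := lam)
  set S := sinTail lam (fun y => (V y : ℂ) * f y) with hS
  set T := cosTail lam (fun y => (V y : ℂ) * f y) with hT
  have h2 : Tendsto (fun y => deriv f y * starRingEnd ℂ (f y) - Complex.I * lam) atTop (𝓝 0) := by
    have hb : Tendsto (fun y => lam * ‖S y‖ + ‖T y‖ + ‖T y‖ * ‖S y‖) atTop (𝓝 0) := by
      have h3 := hs.norm
      have h4 := hcs.norm
      rw [norm_zero] at h3 h4
      have := ((h3.const_mul lam).add h4).add (h4.mul h3)
      simpa using this
    refine squeeze_zero_norm (fun y => ?_) hb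
    obtain ⟨e1, e2⟩ := h.eq_integral hV hVb hlam y
    set e := Complex.exp (Complex.I * lam * y) with he
    have hen : ‖e‖ = 1 := norm_exp_I_mul lam y
    have hee : e * starRingEnd ℂ e = 1 := by
      rw [Complex.mul_conj, Complex.normSq_eq_norm_sq, hen]
      simp
    have h5 : deriv f y * starRingEnd ℂ (f y) - Complex.I * lam
        = Complex.I * lam * e * starRingEnd ℂ (S y) - T y * starRingEnd ℂ e
          - T y * starRingEnd ℂ (S y) := by
      rw [e2, e1, map_add]
      linear_combination (Complex.I * lam) * hee
    rw [h5]
    refine (norm_sub_le _ _).trans (add_le_add ((norm_sub_le _ _).trans (add_le_add ?_ ?_)) ?_)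
    · simp [hen, abs_of_pos hlam]
    · simp [hen]
    · simp
  have h3 := (Complex.continuous_im.tendsto 0).comp h2
  have h4 : Tendsto (fun _ : ℝ => (deriv f x * starRingEnd ℂ (f x)).im - lam) atTop (𝓝 0) := by
    refine h3.congr fun y => ?_
    simp only [Function.comp, Complex.sub_im, ← hW y]
    simp
  linarith [tendsto_nhds_unique tendsto_const_nhds h4]

/-- The phase `e^{iλx₀}` restores the normalisation `e^{iλs}` after the reflection at `x₀`. -/
theorem IsJostMinus.reflect (hV : Continuous V) (h : IsJostMinus V lam f) (x₀ : ℝ) :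
    IsJostPlus (fun s => V (x₀ - s)) lam
      (fun s => Complex.exp (Complex.I * lam * x₀) * f (x₀ - s)) := by
  refine ⟨((h.sol.reflect hV x₀).1.const_mul (by fun_prop) _).1, ?_⟩
  have h1 : Tendsto (fun s : ℝ => x₀ - s) atTop atBot :=
    tendsto_atBot_add_const_left _ _ tendsto_neg_atTop_atBot
  refine (h.asymp.comp h1).congr fun s => ?_
  simp only [Function.comp]
  have h2 : Complex.exp (Complex.I * lam * x₀) *
      Complex.exp (-(Complex.I * lam * ((x₀ - s : ℝ) : ℂ))) = Complex.exp (Complex.I * lam * s) := by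
    rw [← Complex.exp_add]
    congr 1
    push_cast
    ring
  rw [div_eq_div_iff (Complex.exp_ne_zero _) (Complex.exp_ne_zero _)]
  linear_combination -f (x₀ - s) * h2

theorem exists_isJostMinus (hV : Continuous V) (hVb : ∀ x, |V x| ≤ C / (1 + x ^ 2))
    (hlam : 0 < lam) : ∃ f, IsJostMinus V lam f := by
  obtain ⟨f, hf⟩ := exists_isJostPlus (V := fun s => V (0 - s)) (by fun_prop)
    (fun x => by simpa using hVb (0 - x)) hlam
  refine ⟨fun s => f (0 - s), ?_, ?_⟩
  · have := (hf.sol.reflect (by fun_prop) 0).1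
    simpa using this
  · have h1 : Tendsto (fun s : ℝ => 0 - s) atBot atTop := by
      simpa using tendsto_neg_atBot_atTop
    refine (hf.asymp.comp h1).congr fun s => ?_
    simp

/-- The initial value problem at a positive energy. -/
theorem exists_isSolution_of_init (hV : Continuous V) (hVb : ∀ x, |V x| ≤ C / (1 + x ^ 2))
    (hlam : 0 < lam) (x₀ α β : ℝ) :
    ∃ u : ℝ → ℝ, IsSolution V (lam ^ 2) u ∧ u x₀ = α ∧ deriv u x₀ = β := by
  obtain ⟨f, hf⟩ := exists_isJostPlus hV hVb hlam
  have him := hf.im_deriv_mul_conj hV hVb hlam x₀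
  -- Cramer's rule for the real system `Re (c f) = α`, `Re (c f') = β` at `x₀`, whose determinant is
  -- `lam` up to sign by `him`.
  set c : ℂ := Complex.I / lam * (α * starRingEnd ℂ (deriv f x₀) - β * starRingEnd ℂ (f x₀))
    with hc
  obtain ⟨h1, h2⟩ := hf.sol.re_mul hV c
  have hl : (lam : ℂ) ≠ 0 := by exact_mod_cast hlam.ne'
  have hcl : c = ((lam⁻¹ : ℝ) : ℂ) * (Complex.I *
      (α * starRingEnd ℂ (deriv f x₀) - β * starRingEnd ℂ (f x₀))) := by
    rw [hc]
    push_cast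
    field_simp
  refine ⟨_, h1, ?_, ?_⟩
  · rw [hcl, mul_assoc, Complex.re_ofReal_mul, inv_mul_eq_iff_eq_mul₀ hlam.ne', ← him]
    simp only [Complex.mul_re, Complex.mul_im, Complex.sub_re, Complex.sub_im, Complex.I_re,
      Complex.I_im, Complex.conj_re, Complex.conj_im, Complex.ofReal_re, Complex.ofReal_im]
    ring
  · rw [h2]
    simp only
    rw [hcl, mul_assoc, Complex.re_ofReal_mul, inv_mul_eq_iff_eq_mul₀ hlam.ne', ← him]
    simp only [Complex.mul_re, Complex.mul_im, Complex.sub_re, Complex.sub_im, Complex.I_re,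
      Complex.I_im, Complex.conj_re, Complex.conj_im, Complex.ofReal_re, Complex.ofReal_im]
    ring

end Jost

end ReggeWheeler

namespace ReggeWheeler
open MeasureTheory

/-! ## Holomorphic dependence of `f₊` on the energy -/

/-- Both `θ + t` and `z` have an imaginary part of at most one ninth of the real part. The argument
of the quotient is thus at most `2 arctan (1/9) < π/4`, and `2Rm ≤ η` pushes its real part beyond
`R`. -/
theorem add_div_mem_sector {m η R : ℝ} (hm : 0 < m) (hη : 0 < η) (hR : 2 * R * m ≤ η)
    {z θ : ℂ} (hz : z ∈ Metric.ball (m : ℂ) (m / 10)) (hθ : ‖θ - η‖ ≤ η / 10) {t : ℝ}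
    (ht : 0 ≤ t) : (θ + t) / z ∈ sector R ∧ 9 / 10 * η + t ≤ ‖θ + t‖ ∧ 0 < ‖z‖ := by
  rw [Metric.mem_ball, dist_eq_norm] at hz
  have z1 := (Complex.abs_re_le_norm (z - m)).trans hz.le
  have z2 := (Complex.abs_im_le_norm (z - m)).trans hz.le
  have t1 := (Complex.abs_re_le_norm (θ - η)).trans hθ
  have t2 := (Complex.abs_im_le_norm (θ - η)).trans hθ
  simp only [Complex.sub_re, Complex.sub_im, Complex.ofReal_re, Complex.ofReal_im, sub_zero,
    abs_le] at z1 z2 t1 t2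
  have hn : 9 / 10 * η + t ≤ ‖θ + t‖ := by
    refine le_trans ?_ ((le_abs_self _).trans (Complex.abs_re_le_norm _))
    simp only [Complex.add_re, Complex.ofReal_re]
    linarith
  have hsq : 0 < Complex.normSq z := by
    rw [Complex.normSq_apply]
    nlinarith
  have hsq2 : Complex.normSq z ≤ 122 / 100 * m ^ 2 := by
    rw [Complex.normSq_apply]
    nlinarith
  have hre : ((θ + t) / z).re = ((θ.re + t) * z.re + θ.im * z.im) / Complex.normSq z := by
    rw [Complex.div_re]
    simp only [Complex.add_re, Complex.add_im, Complex.ofReal_re, Complex.ofReal_im, add_zero]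
    ring
  have him : ((θ + t) / z).im = (θ.im * z.re - (θ.re + t) * z.im) / Complex.normSq z := by
    rw [Complex.div_im]
    simp only [Complex.add_re, Complex.add_im, Complex.ofReal_re, Complex.ofReal_im, add_zero]
    ring
  have p1 : 9 / 10 * η + t ≤ θ.re + t := by linarith
  have p2 : |θ.im| ≤ (θ.re + t) / 9 := by
    rw [abs_le]
    constructor <;> linarith
  have p3 : |z.im| ≤ z.re / 9 := by
    rw [abs_le]
    constructor <;> linarith
  have hzre : 0 < z.re := by linarith
  have hpre : 0 < θ.re + t := by linarith
  have q1 : |θ.im * z.im| ≤ (θ.re + t) * z.re / 81 := by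
    rw [abs_mul]
    calc |θ.im| * |z.im| ≤ (θ.re + t) / 9 * (z.re / 9) :=
          mul_le_mul p2 p3 (abs_nonneg _) (by positivity)
      _ = _ := by ring
  have q2 : |θ.im * z.re| ≤ (θ.re + t) * z.re / 9 := by
    rw [abs_mul, abs_of_pos hzre]
    calc |θ.im| * z.re ≤ (θ.re + t) / 9 * z.re := mul_le_mul_of_nonneg_right p2 hzre.le
      _ = _ := by ring
  have q3 : |(θ.re + t) * z.im| ≤ (θ.re + t) * z.re / 9 := by
    rw [abs_mul, abs_of_pos hpre]
    calc (θ.re + t) * |z.im| ≤ (θ.re + t) * (z.re / 9) := mul_le_mul_of_nonneg_left p3 hpre.le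
      _ = _ := by ring
  have hpz : 0 < (θ.re + t) * z.re := mul_pos hpre hzre
  refine ⟨⟨?_, ?_⟩, hn, ?_⟩
  · rw [hre, lt_div_iff₀ hsq]
    rw [abs_le] at q1
    have h1 : 9 / 10 * η * (9 / 10 * m) ≤ (θ.re + t) * z.re :=
      mul_le_mul (by linarith) (by linarith) (by positivity) hpre.le
    by_cases hR0 : 0 ≤ R
    · have h2 : R * Complex.normSq z ≤ R * (122 / 100 * m ^ 2) :=
        mul_le_mul_of_nonneg_left hsq2 hR0
      have h3 : R * (122 / 100 * m ^ 2) = 61 / 100 * (2 * R * m) * m := by ring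
      have h4 : 61 / 100 * (2 * R * m) * m ≤ 61 / 100 * η * m := by gcongr
      nlinarith [mul_pos hη hm]
    · have : R * Complex.normSq z < 0 := mul_neg_of_neg_of_pos (not_le.1 hR0) hsq
      linarith
  · rw [hre, him, abs_div, abs_of_pos hsq]
    refine div_lt_div_of_pos_right ?_ hsq
    refine (abs_sub _ _).trans_lt ?_
    rw [abs_le] at q1
    linarith
  · rw [norm_pos_iff]
    intro h0
    simp [h0] at hzre

section FarField

variable {V : ℝ → ℝ} {Vc : ℂ → ℂ} {R C D : ℝ}

/-- With `x = (t₀ + t)/y`, the function `e^{-it₀} f₊(x)` solves a Volterra equation with kernel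
`sin(s - t) V((t₀ + s)/y)/y²` and free term `e^{it}`. Replacing `y` by `z` and `t₀` by `θ(z)` keeps
the argument of the potential in the sector, and quadratic decay bounds the kernel by `C/(9η/10 +
s)²`, independently of `m`. The freedom in `θ` covers both a point `δ/y` moving with the energy (`θ`
constant) and a point fixed throughout the disc (`θ` linear). -/
theorem exists_far_extension (hV : Continuous V) (hVb : ∀ x, |V x| ≤ D / (1 + x ^ 2))
    (hC : 0 < C) (hVd : DifferentiableOn ℂ Vc (sector R))
    (hVc : ∀ z ∈ sector R, ‖Vc z‖ ≤ C / ‖z‖ ^ 2) (hVR : ∀ x : ℝ, R < x → Vc x = V x)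
    {η : ℝ} (hη : 0 < η) :
    ∃ B₀ : ℝ, 0 < B₀ ∧ ∀ (m : ℝ) (θ : ℂ → ℂ), 0 < m → 2 * R * m ≤ η →
      DifferentiableOn ℂ θ (Metric.ball (m : ℂ) (m / 10)) →
      (∀ z ∈ Metric.ball (m : ℂ) (m / 10), ‖θ z - η‖ ≤ η / 10) →
      ∃ A B : ℂ → ℂ, DifferentiableOn ℂ A (Metric.ball (m : ℂ) (m / 10)) ∧
        DifferentiableOn ℂ B (Metric.ball (m : ℂ) (m / 10)) ∧
        (∀ z ∈ Metric.ball (m : ℂ) (m / 10), ‖A z‖ ≤ B₀ ∧ ‖B z‖ ≤ B₀) ∧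
        ∀ (y t₀ : ℝ) (f : ℝ → ℂ), 0 < y → (y : ℂ) ∈ Metric.ball (m : ℂ) (m / 10) → θ y = t₀ →
          IsJostPlus V y f → f (t₀ / y) = A y ∧ deriv f (t₀ / y) = y * B y := by
  set c : ℝ := 9 / 10 * η with hc
  have hc0 : 0 < c := by positivity
  set k : ℝ → ℝ := fun s => C / (c + s) ^ 2 with hk
  set G : ℝ → ℝ := fun s => C / (c + s) with hG
  have hw := IsVolterraWeight.of_primitive_Ioi (S := Ici (0 : ℝ)) measurableSet_Ici
    (fun t ht => Ici_subset_Ici.2 ht) (k := k) (G := G) (fun s _ => by positivity)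
    (fun s hs => by
      have h1 : c + s ≠ 0 := by
        have : 0 ≤ s := hs
        positivity
      refine ((hasDerivAt_const s C).div ((hasDerivAt_id s).const_add c) h1).congr_deriv ?_
      simp only [hk, id]
      ring)
    (by
      have h1 : Tendsto (fun s : ℝ => c + s) atTop atTop :=
        tendsto_atTop_add_const_left _ _ tendsto_id
      exact h1.const_div_atTop C)
  set wt : ℝ → ℝ := fun t => Real.exp (2 * G t) with hwt
  have hwt1 : ∀ t ∈ Ici (0 : ℝ), 1 ≤ wt t := by
    intro t ht
    have : 0 ≤ t := ht
    exact Real.one_le_exp (by positivity)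
  set φ₀ : ℝ → ℂ := fun t => Complex.exp (Complex.I * (1 : ℝ) * t) with hφ₀
  have hφm : Measurable φ₀ := by
    refine Continuous.measurable ?_
    fun_prop
  have hφn : ∀ t, ‖φ₀ t‖ = 1 := fun t => norm_exp_I_mul 1 t
  have hφb : ∀ s ∈ Ici (0 : ℝ), ‖φ₀ s‖ ≤ 1 * wt s := by
    intro s hs
    rw [hφn, one_mul]
    exact hwt1 s hs
  refine ⟨Real.exp (2 * η) * (1 + 2 * wt 0), by positivity, fun m θ hm hRm hθd hθ => ?_⟩
  set U := Metric.ball (m : ℂ) (m / 10) with hU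
  -- Only `s ≥ 0` matters; `max s 0` makes `q z` continuous on the whole line, hence the kernel
  -- measurable.
  set q : ℂ → ℝ → ℂ := fun z s => Vc ((θ z + (max s 0 : ℝ)) / z) / z ^ 2 with hq
  have hsec : ∀ z ∈ U, ∀ s : ℝ, _ := fun z hz s =>
    add_div_mem_sector hm hη hRm hz (hθ z hz) (t := max s 0) (le_max_right _ _)
  have hz0 : ∀ z ∈ U, z ≠ 0 := fun z hz => norm_pos_iff.1 (hsec z hz 0).2.2
  have hqc : ∀ z ∈ U, Continuous (q z) := by
    intro z hz
    have h1 : Continuous fun s : ℝ => (θ z + (max s 0 : ℝ)) / z := by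
      have := hz0 z hz
      fun_prop
    exact (hVd.continuousOn.comp_continuous h1 fun s => (hsec z hz s).1).div_const _
  have hqd : ∀ s, DifferentiableOn ℂ (fun z => q z s) U := by
    intro s
    have h1 : DifferentiableOn ℂ (fun z => (θ z + (max s 0 : ℝ)) / z) U :=
      (hθd.add_const _).div differentiableOn_id hz0
    exact (hVd.comp h1 fun z hz => (hsec z hz s).1).div (differentiableOn_pow 2)
      fun z hz => pow_ne_zero 2 (hz0 z hz)
  have hqb : ∀ z ∈ U, ∀ s ∈ Ici (0 : ℝ), ‖q z s‖ ≤ k s := by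
    intro z hz s hs
    have hs0 : 0 ≤ s := hs
    obtain ⟨h1, h2, h3⟩ := hsec z hz s
    have h4 := hVc _ h1
    simp only [hq, hk, norm_div, norm_pow]
    rw [max_eq_left hs0] at h2 h4 ⊢
    rw [norm_div] at h4
    have h5 : 0 < c + s := by positivity
    have h6 : 0 < ‖θ z + (s : ℂ)‖ := h5.trans_le h2
    rw [div_le_iff₀ (by positivity)]
    refine h4.trans ?_
    have h7 : C / (‖θ z + (s : ℂ)‖ / ‖z‖) ^ 2 = C / ‖θ z + (s : ℂ)‖ ^ 2 * ‖z‖ ^ 2 := by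
      field_simp
    rw [h7]
    gcongr
  have hgen : ∀ tr : ℝ → ℝ, Continuous tr → (∀ x, |tr x| ≤ 1) → ∀ z ∈ U,
      Measurable (fun p : ℝ × ℝ =>
        (Ioi p.1).indicator (fun s => ((tr (s - p.1) : ℝ) : ℂ) * q z s) p.2) ∧
      ∀ t ∈ Ici (0 : ℝ), ∀ s ∈ Ici (0 : ℝ),
        ‖(Ioi t).indicator (fun s => ((tr (s - t) : ℝ) : ℂ) * q z s) s‖ ≤
          (Ioi t).indicator k s := by
    intro tr htr htr1 z hz
    constructor
    · refine measurable_indicator_Ioi (f := fun t s => ((tr (s - t) : ℝ) : ℂ) * q z s)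
        (Continuous.measurable ?_)
      have := hqc z hz
      fun_prop
    · intro t _ s hs
      refine norm_indicator_le_indicator fun _ => ?_
      rw [norm_mul, Complex.norm_real]
      exact (mul_le_of_le_one_left (norm_nonneg _) (htr1 _)).trans (hqb z hz s hs)
  have hgend : ∀ (tr : ℝ → ℝ) (t s : ℝ), DifferentiableOn ℂ
      (fun z => (Ioi t).indicator (fun s => ((tr (s - t) : ℝ) : ℂ) * q z s) s) U := by
    intro tr t s
    by_cases hs : s ∈ Ioi t
    · simp only [indicator_of_mem hs]
      exact (hqd s).const_mul _
    · simp only [indicator_of_notMem hs]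
      exact differentiableOn_const _
  set K : ℂ → ℝ → ℝ → ℂ := fun z t =>
    (Ioi t).indicator (fun s => ((Real.sin (s - t) : ℝ) : ℂ) * q z s) with hK
  set K' : ℂ → ℝ → ℝ → ℂ := fun z t =>
    (Ioi t).indicator (fun s => ((Real.cos (s - t) : ℝ) : ℂ) * q z s) with hK'
  have hKs := hgen Real.sin Real.continuous_sin Real.abs_sin_le_one
  have hKc := hgen Real.cos Real.continuous_cos Real.abs_cos_le_one
  set Φ : ℂ → ℝ → ℂ := fun z => volterraSol (Ici 0) (K z) φ₀ with hΦ
  have hΦm : ∀ z ∈ U, Measurable (Φ z) := fun z hz => volterraSol_measurable (hKs z hz).1 hφm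
  have hΦb : ∀ z ∈ U, ∀ t ∈ Ici (0 : ℝ), ‖Φ z t‖ ≤ 2 * wt t := by
    intro z hz t ht
    have := hw.norm_sol_le (hKs z hz).1 hφm (hKs z hz).2 hφb t ht
    rwa [mul_one] at this
  have hΦd : ∀ t ∈ Ici (0 : ℝ), DifferentiableOn ℂ (fun z => Φ z t) U :=
    hw.sol_differentiableOn (K := K) (φ₀ := fun _ => φ₀) Metric.isOpen_ball
      (fun z hz => (hKs z hz).1) (fun _ _ => hφm) (fun z hz => (hKs z hz).2) (fun _ _ => hφb)
      (fun t _ s _ => hgend Real.sin t s) (fun t _ => differentiableOn_const _)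
  have h0 : (0 : ℝ) ∈ Ici (0 : ℝ) := self_mem_Ici
  set I' : ℂ → ℂ := fun z => ∫ s in Ici 0, K' z 0 s * Φ z s with hI'
  have hI'd : DifferentiableOn ℂ I' U := by
    refine differentiableOn_integral_of_dominated Metric.isOpen_ball
      (g := fun s => 2 * ((Ioi 0).indicator k s * wt s)) (fun z hz => ?_)
      ((hw.integrable 0 h0).const_mul 2) ?_ ?_
    · exact (((hKc z hz).1.comp (measurable_const.prodMk measurable_id)).mul
        (hΦm z hz)).aestronglyMeasurable
    · filter_upwards [ae_restrict_mem measurableSet_Ici] with s hs z hz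
      have h1 := (hKc z hz).2 0 h0 s hs
      rw [norm_mul]
      refine (mul_le_mul h1 (hΦb z hz s hs) (norm_nonneg _)
        ((norm_nonneg _).trans h1)).trans (le_of_eq ?_)
      ring
    · filter_upwards [ae_restrict_mem measurableSet_Ici] with s hs
      exact (hgend Real.cos 0 s).mul (hΦd s hs)
  have hI'b : ∀ z ∈ U, ‖I' z‖ ≤ wt 0 := by
    intro z hz
    have := (hw.integral_norm_le (K := K' z) (hKc z hz).1 (hΦm z hz) (hΦb z hz) h0
      ((hKc z hz).2 0 h0)).2.1
    linarith
  have hexp : ∀ z ∈ U, ‖Complex.exp (Complex.I * θ z)‖ ≤ Real.exp (2 * η) := by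
    intro z hz
    rw [Complex.norm_exp]
    refine Real.exp_le_exp.2 ((le_abs_self _).trans ((Complex.abs_re_le_norm _).trans ?_))
    rw [norm_mul, Complex.norm_I, one_mul]
    have h1 := norm_add_le (θ z - η) η
    rw [sub_add_cancel, Complex.norm_real, Real.norm_of_nonneg hη.le] at h1
    linarith [hθ z hz]
  have hexpd : DifferentiableOn ℂ (fun z => Complex.exp (Complex.I * θ z)) U :=
    (hθd.const_mul _).cexp
  refine ⟨fun z => Complex.exp (Complex.I * θ z) * Φ z 0,
    fun z => Complex.exp (Complex.I * θ z) * (Complex.I - I' z), hexpd.mul (hΦd 0 h0),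
    hexpd.mul ((differentiableOn_const _).sub hI'd), fun z hz => ⟨?_, ?_⟩, ?_⟩
  · rw [norm_mul]
    refine mul_le_mul (hexp z hz) ((hΦb z hz 0 h0).trans ?_) (norm_nonneg _) (by positivity)
    linarith
  · rw [norm_mul]
    refine mul_le_mul (hexp z hz) ((norm_sub_le _ _).trans ?_) (norm_nonneg _) (by positivity)
    rw [Complex.norm_I]
    linarith [hI'b z hz, hwt1 0 h0]
  · intro y t₀ f hy hyU hθy hf
    -- At a real energy the rescaled Jost solution is a bounded solution of the same Volterra
    -- equation, so uniqueness identifies it with `Φ y`.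
    set F : ℝ → ℂ := fun t => Complex.exp (-(Complex.I * t₀)) * f ((t₀ + t) / y) with hF
    have hfc := hf.sol.continuous
    have hFm : Measurable F := by
      refine Continuous.measurable ?_
      fun_prop
    have hen : ‖Complex.exp (-(Complex.I * t₀))‖ = 1 := by
      rw [Complex.norm_exp]
      simp
    obtain ⟨B, hB⟩ := hf.exists_norm_le (t₀ / y)
    have hFb : ∀ s ∈ Ici (0 : ℝ), ‖F s‖ ≤ |B| * wt s := by
      intro s hs
      rw [hF]
      simp only
      rw [norm_mul, hen, one_mul]
      have hs0 : 0 ≤ s := hs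
      refine ((hB _ ?_).trans (le_abs_self B)).trans
        (le_mul_of_one_le_right (abs_nonneg _) (hwt1 s hs))
      rw [mem_Ici]
      gcongr
      linarith
    have hVq : ∀ s ∈ Ici (0 : ℝ), q y s = (V ((t₀ + s) / y) : ℂ) / (y : ℂ) ^ 2 := by
      intro s hs
      have hs0 : 0 ≤ s := hs
      obtain ⟨h1, -, -⟩ := hsec y hyU s
      simp only [hq, max_eq_left hs0, hθy] at h1 ⊢
      have h2 : ((t₀ : ℂ) + s) / y = (((t₀ + s) / y : ℝ) : ℂ) := by push_cast; rfl
      rw [h2] at h1 ⊢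
      rw [hVR _ (by simpa using h1.1)]
    have hsubst : ∀ (g : ℝ → ℂ) (t : ℝ), ∫ u in Ioi ((t₀ + t) / y), g u
        = (y : ℂ)⁻¹ * ∫ s in Ioi t, g ((t₀ + s) / y) := by
      intro g t
      have h1 := integral_comp_mul_left_Ioi (fun u => g (t₀ / y + u)) t (inv_pos.2 hy)
      rw [inv_inv] at h1
      have h2 : ∀ s, g ((t₀ + s) / y) = g (t₀ / y + y⁻¹ * s) := fun s => by
        congr 1
        field_simp
      simp only [h2]
      rw [h1]
      have h3 : ∫ x in Ioi (y⁻¹ * t), g (t₀ / y + x) = ∫ u in Ioi ((t₀ + t) / y), g u := by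
        have h4 := (measurePreserving_add_left volume (t₀ / y)).setIntegral_preimage_emb
          (measurableEmbedding_addLeft (t₀ / y)) g (Ioi ((t₀ + t) / y))
        rw [← h4]
        congr 2
        ext x
        simp only [mem_Ioi, mem_preimage]
        rw [add_div, add_lt_add_iff_left, div_eq_inv_mul]
      rw [h3, Complex.real_smul, ← mul_assoc, inv_mul_cancel₀ (by exact_mod_cast hy.ne'), one_mul]
    have hy0 : (y : ℂ) ≠ 0 := by exact_mod_cast hy.ne'
    have harg : ∀ s t : ℝ, y * ((t₀ + s) / y - (t₀ + t) / y) = s - t := fun s t => by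
      field_simp
      ring
    have hFK : ∀ (tr : ℝ → ℝ) (t : ℝ), 0 ≤ t →
        ∫ s in Ici 0, (Ioi t).indicator (fun s => ((tr (s - t) : ℝ) : ℂ) * q y s) s * F s
        = Complex.exp (-(Complex.I * t₀)) * ((y : ℂ)⁻¹ * ∫ u in Ioi ((t₀ + t) / y),
          ((tr (y * (u - (t₀ + t) / y)) : ℝ) : ℂ) * ((V u : ℂ) * f u)) := by
      intro tr t ht
      rw [hsubst, ← mul_assoc ((y : ℂ)⁻¹), ← integral_const_mul, ← integral_const_mul]
      have h1 : ∀ s, (Ioi t).indicator (fun s => ((tr (s - t) : ℝ) : ℂ) * q y s) s * F s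
          = (Ioi t).indicator (fun s => ((tr (s - t) : ℝ) : ℂ) * q y s * F s) s := by
        intro s
        by_cases hs : s ∈ Ioi t
        · simp only [indicator_of_mem hs]
        · simp only [indicator_of_notMem hs, zero_mul]
      simp only [h1]
      rw [setIntegral_indicator measurableSet_Ioi, inter_eq_self_of_subset_right]
      swap
      · exact fun s hs => ht.trans (le_of_lt hs)
      refine setIntegral_congr_fun measurableSet_Ioi fun s hs => ?_
      simp only [harg, hF]
      rw [hVq s (ht.trans (le_of_lt hs))]
      field_simp
    have hFeq : ∀ t ∈ Ici (0 : ℝ), F t = φ₀ t + ∫ s in Ici 0, K y t s * F s := by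
      intro t ht
      have h1 := (hf.eq_integral hV hVb hy ((t₀ + t) / y)).1
      rw [hK, hFK Real.sin t ht]
      simp only [hF]
      rw [h1, mul_add, ← Complex.exp_add]
      congr 1
      · simp only [hφ₀]
        congr 1
        push_cast
        field_simp
        ring
      · congr 1
        rw [sinTail, ← integral_const_mul]
        congr 1
        ext u
        push_cast
        field_simp
    have huniq := hw.unique (hKs y hyU).1 hφm (hKs y hyU).2 hφb hFm hFb hFeq
    have hee : Complex.exp (Complex.I * t₀) * Complex.exp (-(Complex.I * t₀)) = 1 := by
      rw [← Complex.exp_add, add_neg_cancel, Complex.exp_zero]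
    constructor
    · have h1 := huniq 0 h0
      simp only [hθy, hΦ]
      rw [← h1, hF]
      simp only [add_zero]
      linear_combination -f (t₀ / y) * hee
    · have h1 := (hf.eq_integral hV hVb hy (t₀ / y)).2
      have h2 : I' y = ∫ s in Ici 0, K' y 0 s * F s :=
        setIntegral_congr_fun measurableSet_Ici fun s hs => by
          simp only [hΦ]
          rw [huniq s hs]
      simp only [hθy]
      rw [h2, hK', hFK Real.cos 0 le_rfl, add_zero, h1, cosTail]
      have h3 : Complex.I * (y : ℂ) * ((t₀ / y : ℝ) : ℂ) = Complex.I * t₀ := by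
        push_cast
        field_simp
      rw [h3]
      set J := ∫ u in Ioi (t₀ / y), ((Real.cos (y * (u - t₀ / y)) : ℝ) : ℂ) * ((V u : ℂ) * f u)
      have h4 : (y : ℂ) * (y : ℂ)⁻¹ = 1 := mul_inv_cancel₀ hy0
      linear_combination (y : ℂ) * (y : ℂ)⁻¹ * J * hee + J * h4

end FarField

end ReggeWheeler

namespace ReggeWheeler
open MeasureTheory

/-! ## Holomorphic dependence of `f₋` on the energy -/

/-- The entire function `(exp w - 1) / w`. -/
noncomputable def expQuot (w : ℂ) : ℂ := dslope Complex.exp 0 w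

theorem differentiable_expQuot : Differentiable ℂ expQuot := by
  have := (Complex.differentiableOn_dslope (s := univ) (c := 0) univ_mem).2
    Complex.differentiable_exp.differentiableOn
  exact differentiableOn_univ.1 this

theorem mul_expQuot (w : ℂ) : w * expQuot w = Complex.exp w - 1 := by
  have := sub_smul_dslope Complex.exp 0 w
  simpa [expQuot] using this

theorem expQuot_zero : expQuot 0 = 1 := by
  rw [expQuot, dslope_same, Complex.deriv_exp, Complex.exp_zero]

theorem norm_expQuot_le (w : ℂ) : ‖expQuot w‖ ≤ Real.exp ‖w‖ := by
  by_cases hw : w = 0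
  · simp [hw, expQuot_zero]
  · have h1 := Complex.norm_exp_sub_sum_le_norm_mul_exp w 1
    simp only [Finset.range_one, Finset.sum_singleton, pow_zero, Nat.factorial_zero,
      Nat.cast_one, div_one, pow_one] at h1
    rw [← mul_expQuot, norm_mul] at h1
    exact le_of_mul_le_mul_left h1 (norm_pos_iff.2 hw)

theorem expQuot_conj (w : ℂ) : expQuot (starRingEnd ℂ w) = starRingEnd ℂ (expQuot w) := by
  by_cases hw : w = 0
  · simp [hw, expQuot_zero]
  · have h1 := mul_expQuot (starRingEnd ℂ w)
    have h2 := congrArg (starRingEnd ℂ) (mul_expQuot w)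
    rw [map_mul, map_sub, ← Complex.exp_conj, map_one, ← h1] at h2
    exact (mul_left_cancel₀ ((map_ne_zero _).2 hw) h2).symm

/-- Half of the decay `e^{-bs}` pays for the linear factor and for the growth `e^{bs/4}` of the
kernel at complex energies. -/
theorem self_mul_exp_le {b s : ℝ} (hb : 0 < b) :
    s * Real.exp (b / 4 * s) * Real.exp (-b * s) ≤ (4 / b) * Real.exp (-b / 2 * s) := by
  have h1 : s ≤ 4 / b * Real.exp (b / 4 * s) := by
    have := Real.add_one_le_exp (b / 4 * s)
    calc s = 4 / b * (b / 4 * s) := by field_simp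
      _ ≤ _ := by
        gcongr
        linarith
  calc s * Real.exp (b / 4 * s) * Real.exp (-b * s)
      ≤ 4 / b * Real.exp (b / 4 * s) * Real.exp (b / 4 * s) * Real.exp (-b * s) := by gcongr
    _ = 4 / b * (Real.exp (b / 4 * s) * Real.exp (b / 4 * s) * Real.exp (-b * s)) := by ring
    _ = _ := by
      rw [← Real.exp_add, ← Real.exp_add]
      congr 2
      ring

/-- With a nonnegative kernel all Picard iterates are nonnegative, and the first one is `1`. Applied
at zero energy, this gives the signs of `A 0` and `B 0`. -/
theorem volterraSol_real_ge {S : Set ℝ} {κ : ℝ → ℝ → ℝ} {wt : ℝ → ℝ} {K : ℝ → ℝ → ℂ} {C : ℝ}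
    (h : IsVolterraWeight S κ wt) (hK : Measurable (fun p : ℝ × ℝ => K p.1 p.2))
    (hKb : ∀ t ∈ S, ∀ s ∈ S, ‖K t s‖ ≤ κ t s) (hB : ∀ s ∈ S, ‖(1 : ℂ)‖ ≤ C * wt s)
    {k : ℝ → ℝ → ℝ} (hk : ∀ t s, K t s = k t s) (hk0 : ∀ t ∈ S, ∀ s ∈ S, 0 ≤ k t s) :
    ∃ u : ℝ → ℝ, ∀ t ∈ S, volterraSol S K (fun _ => 1) t = u t ∧ 1 ≤ u t := by
  have hiter : ∀ n, ∃ v : ℝ → ℝ, (∀ t, volterraIter S K (fun _ => 1) n t = v t) ∧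
      ∀ t ∈ S, 0 ≤ v t := by
    intro n
    induction n with
    | zero => exact ⟨fun _ => 1, fun t => by simp [volterraIter], fun _ _ => zero_le_one⟩
    | succ n ih =>
      obtain ⟨v, hv, hv0⟩ := ih
      refine ⟨fun t => ∫ s in S, k t s * v s, fun t => ?_, fun t ht =>
        setIntegral_nonneg h.meas fun s hs => mul_nonneg (hk0 t ht s hs) (hv0 s hs)⟩
      simp only [volterraIter, hv, hk]
      rw [← integral_complex_ofReal]
      simp
  choose v hv hv0 using hiter
  refine ⟨fun t => ∑' n, v n t, fun t ht => ⟨?_, ?_⟩⟩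
  · simp only [volterraSol, hv, Complex.ofReal_tsum]
  · have hs : Summable fun n => v n t := by
      refine Summable.of_norm_bounded (summable_geometric_weight C (wt t)) fun n => ?_
      have := h.norm_iter_le hK measurable_const hKb hB n t ht
      rwa [hv, Complex.norm_real] at this
    have h1 : v 0 t = 1 := by
      have := hv 0 t
      simp only [volterraIter] at this
      exact_mod_cast this.symm
    rw [← h1]
    exact hs.le_tsum 0 fun n _ => hv0 n t ht

section NearHorizon

variable {V : ℝ → ℝ} {C D b : ℝ}

/-- After reflection at `x₀` and division by the plane wave, `f₋` solves a Volterra equation with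
kernel `τ · (e^{2izτ} - 1)/(2izτ) · V(x₀ - s)`, `τ = s - t`. This is entire in `z` also across `z =
0`, and the exponential decay of `V` bounds it uniformly on a disc around `0`. Changing `z = x` to
`-x` conjugates the kernel, and at `z = 0` the kernel is nonnegative. -/
theorem exists_near_extension (hV : Continuous V) (hVb : ∀ x, |V x| ≤ D / (1 + x ^ 2))
    (hb : 0 < b) (hVe : ∀ x, |V x| ≤ C * Real.exp (b * x)) (hVpos : ∀ x, 0 < V x) (x₀ : ℝ) :
    ∃ (ρ : ℝ) (A B : ℂ → ℂ), 0 < ρ ∧ DifferentiableOn ℂ A (Metric.ball 0 ρ) ∧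
      DifferentiableOn ℂ B (Metric.ball 0 ρ) ∧
      (∀ x : ℝ, A (-(x : ℂ)) = starRingEnd ℂ (A x) ∧ B (-(x : ℂ)) = starRingEnd ℂ (B x)) ∧
      (∃ α β : ℝ, 0 < α ∧ 0 < β ∧ A 0 = α ∧ B 0 = β) ∧
      ∀ (y : ℝ) (f : ℝ → ℂ), y ∈ Ioo 0 ρ → IsJostMinus V y f →
        Complex.exp (Complex.I * y * x₀) * f x₀ = A y ∧
        Complex.exp (Complex.I * y * x₀) * deriv f x₀ = B y := by
  set Q : ℝ → ℝ := fun s => V (x₀ - s) with hQ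
  have hQc : Continuous Q := by fun_prop
  set C₁ : ℝ := C * Real.exp (b * x₀) with hC₁
  have hQe : ∀ s, |Q s| ≤ C₁ * Real.exp (-b * s) := by
    intro s
    refine (hVe _).trans (le_of_eq ?_)
    rw [hC₁, mul_assoc, ← Real.exp_add]
    congr 2
    ring
  have hC₁0 : 0 < C₁ := by
    have := (abs_pos.2 (hVpos (x₀ - 0)).ne').trans_le (hQe 0)
    simpa using this
  obtain ⟨D', hQb⟩ : ∃ D', ∀ s, |Q s| ≤ D' / (1 + s ^ 2) := by
    refine ⟨D * (2 + 2 * x₀ ^ 2), fun s => (hVb _).trans ?_⟩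
    have hD : 0 ≤ D := by
      have := (abs_nonneg _).trans (hVb 0)
      simpa using this
    rw [div_le_div_iff₀ (by positivity) (by positivity), mul_assoc]
    refine mul_le_mul_of_nonneg_left ?_ hD
    nlinarith [sq_nonneg (x₀ - s), sq_nonneg (x₀ * (x₀ - s)), sq_nonneg (2 * x₀ - s)]
  set c₁ : ℝ := C₁ * (4 / b + 1) with hc₁
  set k : ℝ → ℝ := fun s => c₁ * Real.exp (-b / 2 * s) with hk
  set G : ℝ → ℝ := fun s => c₁ * (2 / b) * Real.exp (-b / 2 * s) with hG
  have hw := IsVolterraWeight.of_primitive_Ioi (S := Ici (0 : ℝ)) measurableSet_Ici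
    (fun t ht => Ici_subset_Ici.2 ht) (k := k) (G := G) (fun s _ => by positivity)
    (fun s _ => by
      refine ((((hasDerivAt_id s).const_mul (-b / 2)).exp).const_mul _).congr_deriv ?_
      simp only [hk, id]
      field_simp)
    (by
      have h1 : Tendsto (fun s : ℝ => -b / 2 * s) atTop atBot :=
        tendsto_id.const_mul_atTop_of_neg (by linarith)
      have := (Real.tendsto_exp_atBot.comp h1).const_mul (c₁ * (2 / b))
      simpa using this)
  set wt : ℝ → ℝ := fun t => Real.exp (2 * G t) with hwt
  have hwt1 : ∀ t, 1 ≤ wt t := fun t => Real.one_le_exp (by positivity)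
  have hφb : ∀ s ∈ Ici (0 : ℝ), ‖(1 : ℂ)‖ ≤ 1 * wt s := by
    intro s _
    rw [norm_one, one_mul]
    exact hwt1 s
  -- For `‖z‖ < b/8` the exponent `2izτ` has norm at most `bτ/4`, which leaves enough of the decay
  -- `e^{-bs}`.
  set U := Metric.ball (0 : ℂ) (b / 8) with hU
  have hUn : ∀ z ∈ U, ∀ τ : ℝ, 0 ≤ τ → ‖2 * Complex.I * z * τ‖ ≤ b / 4 * τ := by
    intro z hz τ hτ
    rw [hU, Metric.mem_ball, dist_zero_right] at hz
    simp only [norm_mul, Complex.norm_ofNat, Complex.norm_I, Complex.norm_real,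
      Real.norm_of_nonneg hτ]
    nlinarith
  set k0 : ℂ → ℝ → ℝ → ℂ := fun z t s =>
    ((s - t : ℝ) : ℂ) * expQuot (2 * Complex.I * z * ((s - t : ℝ) : ℂ)) * (Q s : ℂ) with hk0
  -- The kernel for the derivative: `(e^{2izτ} + 1)/2 = cos(zτ) e^{izτ}`.
  set k1 : ℂ → ℝ → ℝ → ℂ := fun z t s =>
    ((Complex.exp (2 * Complex.I * z * ((s - t : ℝ) : ℂ)) + 1) / 2) * (Q s : ℂ) with hk1
  set K : ℂ → ℝ → ℝ → ℂ := fun z t => (Ioi t).indicator (k0 z t) with hK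
  set K' : ℂ → ℝ → ℝ → ℂ := fun z t => (Ioi t).indicator (k1 z t) with hK'
  have hEc := differentiable_expQuot.continuous
  have hKm : ∀ z, Measurable (fun p : ℝ × ℝ => K z p.1 p.2) := fun z =>
    measurable_indicator_Ioi (Continuous.measurable (by
      simp only [hk0]
      fun_prop))
  have hK'm : ∀ z, Measurable (fun p : ℝ × ℝ => K' z p.1 p.2) := fun z =>
    measurable_indicator_Ioi (Continuous.measurable (by
      simp only [hk1]
      fun_prop))
  have hKb : ∀ z ∈ U, ∀ t ∈ Ici (0 : ℝ), ∀ s ∈ Ici (0 : ℝ),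
      ‖K z t s‖ ≤ (Ioi t).indicator k s := by
    intro z hz t ht s hs
    refine norm_indicator_le_indicator fun hst => ?_
    have ht0 : 0 ≤ t := ht
    have hst' : t < s := hst
    have hτ : 0 ≤ s - t := by linarith
    simp only [hk0, hk, norm_mul, Complex.norm_real, Real.norm_eq_abs, abs_of_nonneg hτ]
    have h1 : ‖expQuot (2 * Complex.I * z * ((s - t : ℝ) : ℂ))‖ ≤ Real.exp (b / 4 * s) := by
      refine (norm_expQuot_le _).trans (Real.exp_le_exp.2 ((hUn z hz _ hτ).trans ?_))
      gcongr
      linarith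
    calc (s - t) * ‖expQuot (2 * Complex.I * z * ((s - t : ℝ) : ℂ))‖ * |Q s|
        ≤ s * Real.exp (b / 4 * s) * (C₁ * Real.exp (-b * s)) := by
          have hs0 : 0 ≤ s := hs
          gcongr
          · linarith
          · exact hQe s
      _ = C₁ * (s * Real.exp (b / 4 * s) * Real.exp (-b * s)) := by ring
      _ ≤ C₁ * ((4 / b) * Real.exp (-b / 2 * s)) := by
          gcongr C₁ * ?_
          exact self_mul_exp_le hb
      _ ≤ _ := by
          rw [show c₁ * Real.exp (-b / 2 * s) = C₁ * ((4 / b + 1) * Real.exp (-b / 2 * s)) by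
            rw [hc₁]
            ring]
          have : 0 < 4 / b := by positivity
          exact mul_le_mul_of_nonneg_left (mul_le_mul_of_nonneg_right (by linarith)
            (Real.exp_pos _).le) hC₁0.le
  have hK'b : ∀ z ∈ U, ∀ t ∈ Ici (0 : ℝ), ∀ s ∈ Ici (0 : ℝ),
      ‖K' z t s‖ ≤ (Ioi t).indicator k s := by
    intro z hz t ht s hs
    refine norm_indicator_le_indicator fun hst => ?_
    have ht0 : 0 ≤ t := ht
    have hst' : t < s := hst
    have hs0 : 0 ≤ s := hs
    have hτ : 0 ≤ s - t := by linarith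
    simp only [hk1, hk, norm_mul, Complex.norm_real, Real.norm_eq_abs, norm_div,
      Complex.norm_ofNat]
    have h1 : ‖Complex.exp (2 * Complex.I * z * ((s - t : ℝ) : ℂ)) + 1‖ / 2
        ≤ Real.exp (b / 4 * s) := by
      have h2 := norm_add_le (Complex.exp (2 * Complex.I * z * ((s - t : ℝ) : ℂ))) 1
      have h3 : ‖Complex.exp (2 * Complex.I * z * ((s - t : ℝ) : ℂ))‖ ≤ Real.exp (b / 4 * s) := by
        rw [Complex.norm_exp]
        refine Real.exp_le_exp.2 ((le_abs_self _).trans ((Complex.abs_re_le_norm _).trans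
          ((hUn z hz _ hτ).trans ?_)))
        gcongr
        linarith
      have h4 : 1 ≤ Real.exp (b / 4 * s) := Real.one_le_exp (by positivity)
      rw [norm_one] at h2
      linarith
    calc _ ≤ Real.exp (b / 4 * s) * (C₁ * Real.exp (-b * s)) := by
          gcongr
          exact hQe s
      _ = C₁ * (Real.exp (b / 4 * s) * Real.exp (-b * s)) := by ring
      _ ≤ C₁ * (1 * Real.exp (-b / 2 * s)) := by
          rw [← Real.exp_add, one_mul]
          gcongr
          nlinarith
      _ ≤ _ := by
          rw [show c₁ * Real.exp (-b / 2 * s) = C₁ * ((4 / b + 1) * Real.exp (-b / 2 * s)) by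
            rw [hc₁]
            ring]
          have : 0 < 4 / b := by positivity
          exact mul_le_mul_of_nonneg_left (mul_le_mul_of_nonneg_right (by linarith)
            (Real.exp_pos _).le) hC₁0.le
  have hKd : ∀ t s, DifferentiableOn ℂ (fun z => K z t s) U := by
    intro t s
    by_cases hs : s ∈ Ioi t
    · simp only [hK, indicator_of_mem hs, hk0]
      refine Differentiable.differentiableOn ?_
      exact ((differentiable_expQuot.comp (((differentiable_id.const_mul _).mul_const _))).const_mul
        _).mul_const _
    · simp only [hK, indicator_of_notMem hs]
      exact differentiableOn_const _
  have hK'd : ∀ t s, DifferentiableOn ℂ (fun z => K' z t s) U := by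
    intro t s
    by_cases hs : s ∈ Ioi t
    · simp only [hK', indicator_of_mem hs, hk1]
      refine Differentiable.differentiableOn ?_
      fun_prop
    · simp only [hK', indicator_of_notMem hs]
      exact differentiableOn_const _
  set Φ : ℂ → ℝ → ℂ := fun z => volterraSol (Ici 0) (K z) (fun _ => 1) with hΦ
  have hΦm : ∀ z, Measurable (Φ z) := fun z => volterraSol_measurable (hKm z) measurable_const
  have hΦb : ∀ z ∈ U, ∀ t ∈ Ici (0 : ℝ), ‖Φ z t‖ ≤ 2 * wt t := by
    intro z hz t ht
    have := hw.norm_sol_le (hKm z) measurable_const (hKb z hz) hφb t ht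
    rwa [mul_one] at this
  have hΦd : ∀ t ∈ Ici (0 : ℝ), DifferentiableOn ℂ (fun z => Φ z t) U :=
    hw.sol_differentiableOn (K := K) (φ₀ := fun _ _ => 1) Metric.isOpen_ball
      (fun z _ => hKm z) (fun _ _ => measurable_const) hKb (fun _ _ => hφb)
      (fun t _ s _ => hKd t s) (fun t _ => differentiableOn_const _)
  have h0 : (0 : ℝ) ∈ Ici (0 : ℝ) := self_mem_Ici
  have h0U : (0 : ℂ) ∈ U := Metric.mem_ball_self (by positivity)
  set I' : ℂ → ℂ := fun z => ∫ s in Ici 0, K' z 0 s * Φ z s with hI'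
  have hI'd : DifferentiableOn ℂ I' U := by
    refine differentiableOn_integral_of_dominated Metric.isOpen_ball
      (g := fun s => 2 * ((Ioi 0).indicator k s * wt s)) (fun z hz => ?_)
      ((hw.integrable 0 h0).const_mul 2) ?_ ?_
    · exact (((hK'm z).comp (measurable_const.prodMk measurable_id)).mul
        (hΦm z)).aestronglyMeasurable
    · filter_upwards [ae_restrict_mem measurableSet_Ici] with s hs z hz
      have h1 := hK'b z hz 0 h0 s hs
      rw [norm_mul]
      refine (mul_le_mul h1 (hΦb z hz s hs) (norm_nonneg _)
        ((norm_nonneg _).trans h1)).trans (le_of_eq ?_)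
      ring
    · filter_upwards [ae_restrict_mem measurableSet_Ici] with s hs
      exact (hK'd 0 s).mul (hΦd s hs)
  have hcj : ∀ (x τ : ℝ), 2 * Complex.I * (-(x : ℂ)) * (τ : ℂ)
      = starRingEnd ℂ (2 * Complex.I * x * τ) := by
    intro x τ
    rw [map_mul, map_mul, map_mul, Complex.conj_I, Complex.conj_ofReal, Complex.conj_ofReal,
      Complex.conj_ofNat]
    ring
  have hΦsym : ∀ (x t : ℝ), Φ (-(x : ℂ)) t = starRingEnd ℂ (Φ x t) := by
    intro x t
    refine volterraSol_conj (fun t s => ?_) (fun t => (map_one _).symm) t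
    by_cases hs : s ∈ Ioi t
    · simp only [hK, indicator_of_mem hs, hk0]
      rw [hcj, expQuot_conj]
      simp only [map_mul, Complex.conj_ofReal]
    · simp only [hK, indicator_of_notMem hs, map_zero]
  have hI'sym : ∀ x : ℝ, I' (-(x : ℂ)) = starRingEnd ℂ (I' x) := by
    intro x
    simp only [hI', ← integral_conj, map_mul, hΦsym]
    congr 1
    ext s
    congr 1
    by_cases hs : s ∈ Ioi (0 : ℝ)
    · simp only [hK', indicator_of_mem hs, hk1]
      rw [hcj, Complex.exp_conj]
      simp only [map_mul, map_div₀, map_add, map_one, Complex.conj_ofReal, Complex.conj_ofNat]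
    · simp only [hK', indicator_of_notMem hs, map_zero]
  refine ⟨b / 8, fun z => Φ z 0, fun z => -(Complex.I * z) + I' z, by positivity, hΦd 0 h0,
    ((differentiableOn_id.const_mul _).neg).add hI'd, fun x => ⟨hΦsym x 0, ?_⟩, ?_, ?_⟩
  · simp only [hI'sym, map_add, map_neg, map_mul, Complex.conj_I, Complex.conj_ofReal]
    ring
  · obtain ⟨u, hu⟩ := volterraSol_real_ge hw (hKm 0) (hKb 0 h0U) hφb
      (k := fun t => (Ioi t).indicator fun s => (s - t) * Q s)
      (fun t s => by
        by_cases hs : s ∈ Ioi t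
        · simp only [hK, indicator_of_mem hs, hk0, mul_zero, zero_mul, expQuot_zero, mul_one]
          push_cast
          rfl
        · simp only [hK, indicator_of_notMem hs, Complex.ofReal_zero])
      (fun t _ s _ => indicator_nonneg (fun s hs =>
        mul_nonneg (sub_nonneg.2 (le_of_lt hs)) (hVpos _).le) s)
    -- At zero energy `B` is the integral of `V(x₀ - s) u(s)` with `u ≥ 1`, hence strictly positive.
    have h1 : I' 0 = ((∫ s in Ioi 0, Q s * u s : ℝ) : ℂ) := by
      rw [← integral_complex_ofReal, hI']
      simp only [hK']
      rw [integral_Ici_eq_integral_Ioi]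
      refine setIntegral_congr_fun measurableSet_Ioi fun s hs => ?_
      simp only [indicator_of_mem hs, hk1, mul_zero, zero_mul, Complex.exp_zero]
      rw [hΦ]
      simp only
      rw [(hu s (Ioi_subset_Ici_self hs)).1]
      push_cast
      ring
    have hint : IntegrableOn (fun s => Q s * u s) (Ioi 0) := by
      have h2 := (hw.integral_norm_le (K := K' 0) (hK'm 0) (hΦm 0) (hΦb 0 h0U) h0
        (hK'b 0 h0U 0 h0)).1.mono_set Ioi_subset_Ici_self
      have h3 := h2.re
      refine h3.congr ?_
      filter_upwards [ae_restrict_mem measurableSet_Ioi] with s hs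
      simp only [hK', indicator_of_mem hs, hk1, mul_zero, zero_mul, Complex.exp_zero]
      rw [hΦ]
      simp only
      rw [(hu s (Ioi_subset_Ici_self hs)).1, ← Complex.ofReal_one, ← Complex.ofReal_add]
      rw [show (((1 + 1 : ℝ) : ℂ) / 2 * (Q s : ℂ) * (u s : ℂ)) = ((Q s * u s : ℝ) : ℂ) by
        push_cast
        ring]
      exact Complex.ofReal_re _
    have hpos : 0 < ∫ s in Ioi 0, Q s * u s := by
      have hnn : ∀ s ∈ Ioi (0 : ℝ), 0 < Q s * u s := fun s hs =>
        mul_pos (hVpos _) (by linarith [(hu s (Ioi_subset_Ici_self hs)).2])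
      rw [setIntegral_pos_iff_support_of_nonneg_ae _ hint]
      · have : Function.support (fun s => Q s * u s) ∩ Ioi 0 = Ioi 0 :=
          inter_eq_self_of_subset_right fun s hs => (hnn s hs).ne'
        rw [this, Real.volume_Ioi]
        exact ENNReal.zero_lt_top
      · filter_upwards [ae_restrict_mem measurableSet_Ioi] with s hs using (hnn s hs).le
    refine ⟨u 0, _, by linarith [(hu 0 h0).2], hpos, (hu 0 h0).1, ?_⟩
    simp only [h1, mul_zero, neg_zero, zero_add]
  · intro y f hy hf
    have hy0 : (y : ℂ) ≠ 0 := by exact_mod_cast hy.1.ne'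
    have hyU : (y : ℂ) ∈ U := by
      rw [hU, Metric.mem_ball, dist_zero_right, Complex.norm_real, Real.norm_of_nonneg hy.1.le]
      exact hy.2
    have hr := hf.reflect hV x₀
    set ft : ℝ → ℂ := fun s => Complex.exp (Complex.I * y * x₀) * f (x₀ - s) with hft
    have hftc := hr.sol.continuous
    set H : ℝ → ℂ := fun t => Complex.exp (-(Complex.I * y * t)) * ft t with hH
    have hHm : Measurable H := by
      refine Continuous.measurable ?_
      fun_prop
    obtain ⟨B, hB⟩ := hr.exists_norm_le 0
    have hHb : ∀ s ∈ Ici (0 : ℝ), ‖H s‖ ≤ |B| * wt s := by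
      intro s hs
      simp only [hH]
      rw [norm_mul, Complex.exp_neg, norm_inv, norm_exp_I_mul, inv_one, one_mul]
      exact ((hB s hs).trans (le_abs_self B)).trans
        (le_mul_of_one_le_right (abs_nonneg _) (hwt1 s))
    have hft_eq : ∀ s, ft s = Complex.exp (Complex.I * y * s) * H s := by
      intro s
      simp only [hH]
      rw [← mul_assoc, ← Complex.exp_add, add_neg_cancel, Complex.exp_zero, one_mul]
    have hker : ∀ τ : ℝ, ((Real.sin (y * τ) / y : ℝ) : ℂ) * Complex.exp (Complex.I * y * τ)
        = (τ : ℂ) * expQuot (2 * Complex.I * y * τ) := by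
      intro τ
      have h1 := mul_expQuot (2 * Complex.I * y * τ)
      have h2 : Complex.exp (2 * Complex.I * y * τ)
          = Complex.exp (Complex.I * y * τ) * Complex.exp (Complex.I * y * τ) := by
        rw [← Complex.exp_add]
        congr 1
        ring
      have h3 : Complex.exp (Complex.I * y * τ) * Complex.exp (-(Complex.I * y * τ)) = 1 := by
        rw [← Complex.exp_add, add_neg_cancel, Complex.exp_zero]
      push_cast
      rw [Complex.sin]
      have e1 : -((y : ℂ) * τ) * Complex.I = -(Complex.I * y * τ) := by ring
      have e2 : ((y : ℂ) * τ) * Complex.I = Complex.I * y * τ := by ring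
      rw [e1, e2]
      have h4 : 2 * Complex.I * (y : ℂ) ≠ 0 := by
        simp [hy0, Complex.I_ne_zero]
      refine mul_left_cancel₀ h4 ?_
      rw [h2] at h1
      have h5 : 2 * Complex.I * (y : ℂ) * ((τ : ℂ) * expQuot (2 * Complex.I * y * τ))
          = 2 * Complex.I * y * τ * expQuot (2 * Complex.I * y * τ) := by ring
      rw [h5, h1]
      field_simp
      linear_combination (Complex.exp (Complex.I * y * τ) * Complex.exp (-(Complex.I * y * τ))
        - Complex.exp (Complex.I * y * τ) ^ 2) * Complex.I_sq - h3
    have hHeq : ∀ t ∈ Ici (0 : ℝ), H t = 1 + ∫ s in Ici 0, K y t s * H s := by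
      intro t ht
      have h1 := (hr.eq_integral hQc hQb hy.1 t).1
      simp only [hH]
      rw [h1, mul_add, ← Complex.exp_add, neg_add_cancel, Complex.exp_zero]
      congr 1
      have h2 : ∀ s, K y t s * (Complex.exp (-(Complex.I * y * s)) * ft s)
          = (Ioi t).indicator (fun s => k0 y t s * (Complex.exp (-(Complex.I * y * s)) * ft s)) s := by
        intro s
        by_cases hs : s ∈ Ioi t
        · simp only [hK, indicator_of_mem hs]
        · simp only [hK, indicator_of_notMem hs, zero_mul]
      simp only [h2]
      rw [setIntegral_indicator measurableSet_Ioi, show Ici (0 : ℝ) ∩ Ioi t = Ioi t from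
        inter_eq_self_of_subset_right fun s hs => le_trans (mem_Ici.1 ht) (le_of_lt hs), sinTail,
        ← integral_const_mul]
      refine setIntegral_congr_fun measurableSet_Ioi fun s _ => ?_
      simp only [hk0, ← hker]
      have h3 : Complex.exp (Complex.I * y * ((s - t : ℝ) : ℂ)) * Complex.exp (-(Complex.I * y * s))
          = Complex.exp (-(Complex.I * y * t)) := by
        rw [← Complex.exp_add]
        congr 1
        push_cast
        ring
      rw [← h3]
      ring
    have huniq := hw.unique (hKm y) measurable_const (hKb y hyU) hφb hHm hHb hHeq
    constructor
    · have h1 := huniq 0 h0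
      rw [hΦ]
      simp only
      rw [← h1]
      simp [hH, hft]
    · have h1 := (hr.eq_integral hQc hQb hy.1 0).2
      have h2 : deriv ft 0 = -(Complex.exp (Complex.I * y * x₀) * deriv f x₀) := by
        have h3 := hf.sol.reflect hV x₀
        have h4 := (h3.1.const_mul (by fun_prop) (Complex.exp (Complex.I * y * x₀))).2
        rw [hft, h4, h3.2]
        simp
      rw [h2, cosTail] at h1
      have h3 : I' y = ∫ u in Ioi 0, ((Real.cos (y * (u - 0)) : ℝ) : ℂ) * ((Q u : ℂ) * ft u) := by
        simp only [hI', hK']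
        rw [integral_Ici_eq_integral_Ioi]
        refine setIntegral_congr_fun measurableSet_Ioi fun s hs => ?_
        simp only [indicator_of_mem hs, hk1]
        rw [hΦ]
        simp only
        rw [← huniq s (Ioi_subset_Ici_self hs), hft_eq s]
        have h4 : Complex.exp (2 * Complex.I * y * ((s - 0 : ℝ) : ℂ)) + 1
            = 2 * ((Real.cos (y * (s - 0)) : ℝ) : ℂ) * Complex.exp (Complex.I * y * s) := by
          push_cast
          rw [Complex.cos, mul_div_cancel₀ _ (two_ne_zero), add_mul, ← Complex.exp_add,
            ← Complex.exp_add]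
          rw [show (y : ℂ) * (s - 0) * Complex.I + Complex.I * y * s
              = 2 * Complex.I * y * (s - 0) by ring,
            show -((y : ℂ) * (s - 0)) * Complex.I + Complex.I * y * s = 0 by ring,
            Complex.exp_zero]
        rw [h4]
        ring
      simp only [Complex.ofReal_zero, mul_zero, Complex.exp_zero, mul_one] at h1
      simp only [h3]
      linear_combination -h1

end NearHorizon

end ReggeWheeler

namespace ReggeWheeler
open MeasureTheory

/-! ## The zero energy basis -/

section ZeroEnergy

-- The ansatz `∑ b_k r^{s+1+k}` starts at the indicial exponent `s + 1` of the singular point `r =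
-- 0` and leads to a two-term recursion. Its coefficient `c k` is the difference `(s+k)(s+k+1) -
-- ℓ(ℓ+1)` with `ℓ = s + m`: nonzero for `k < m` and zero for `k = m`, so the series terminates
-- exactly at degree `ℓ + 1`.
open Polynomial in
theorem exists_polynomial_solution {M : ℝ} (hM : 0 < M) (s m : ℕ) :
    ∃ P : ℝ[X], (∀ r : ℝ, r ^ 2 * (r - 2 * M) * P.derivative.derivative.eval r
        + 2 * M * r * P.derivative.eval r
        = (((s + m : ℕ) : ℝ) * (((s + m : ℕ) : ℝ) + 1) * r + 2 * M * (1 - (s : ℝ) ^ 2))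
          * P.eval r) ∧
      Tendsto (fun r : ℝ => P.eval r / r ^ (s + m + 1)) atTop (𝓝 1) := by
  set L : ℝ := ((s + m : ℕ) : ℝ) with hL
  set c : ℕ → ℝ := fun k => ((s : ℝ) + 1 + k) * (s + k) - L * (L + 1) with hc
  set d : ℕ → ℝ := fun k => ((s : ℝ) + k) ^ 2 - s ^ 2 with hd
  have hd1 : ∀ k, d (k + 1) ≠ 0 := by
    intro k
    simp only [hd]
    push_cast
    have : (0 : ℝ) < (s + (k + 1)) ^ 2 - s ^ 2 := by
      have h1 : (0 : ℝ) ≤ s := by positivity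
      have h2 : (0 : ℝ) ≤ k := by positivity
      nlinarith
    exact this.ne'
  obtain ⟨b, hb0, hb⟩ : ∃ b : ℕ → ℝ, b 0 = 1 ∧
      ∀ k, b (k + 1) = b k * c k / (2 * M * d (k + 1)) :=
    ⟨fun n => Nat.rec 1 (fun k v => v * c k / (2 * M * d (k + 1))) n, rfl, fun _ => rfl⟩
  have hbne : ∀ k ≤ m, b k ≠ 0 := by
    intro k hk
    induction k with
    | zero => rw [hb0]; exact one_ne_zero
    | succ k ih =>
      rw [hb]
      refine div_ne_zero (mul_ne_zero (ih (by omega)) ?_)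
        (mul_ne_zero (by positivity) (hd1 k))
      simp only [hc, hL]
      have h1 : (k : ℝ) + 1 ≤ m := by exact_mod_cast hk
      have h2 : (0 : ℝ) ≤ s := by positivity
      have h3 : (0 : ℝ) ≤ k := by positivity
      push_cast
      have : ((s : ℝ) + 1 + k) * (s + k) < (s + m) * (s + m + 1) := by nlinarith
      linarith
  have hrec : ∀ k, b k * c k = 2 * M * d (k + 1) * b (k + 1) := by
    intro k
    rw [hb]
    have := hd1 k
    field_simp
  set Q : ℝ[X] := ∑ k ∈ Finset.range (m + 1), C (b k) * X ^ (s + 1 + k) with hQ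
  have hQe : ∀ r, Q.eval r = ∑ k ∈ Finset.range (m + 1), b k * r ^ (s + 1 + k) := by
    intro r
    simp [hQ, eval_finsetSum]
  have hQd : ∀ r, Q.derivative.eval r
      = ∑ k ∈ Finset.range (m + 1), b k * ((s : ℝ) + 1 + k) * r ^ (s + k) := by
    intro r
    simp only [hQ, derivative_sum, eval_finsetSum]
    refine Finset.sum_congr rfl fun k _ => ?_
    rw [derivative_C_mul_X_pow, show s + 1 + k - 1 = s + k by omega]
    simp
  have hQdd : ∀ r, r ^ 2 * Q.derivative.derivative.eval r
      = ∑ k ∈ Finset.range (m + 1), b k * ((s : ℝ) + 1 + k) * (s + k) * r ^ (s + 1 + k) := by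
    intro r
    simp only [hQ, derivative_sum, eval_finsetSum, Finset.mul_sum]
    refine Finset.sum_congr rfl fun k _ => ?_
    rw [derivative_C_mul_X_pow, derivative_C_mul_X_pow, show s + 1 + k - 1 = s + k by omega]
    simp only [eval_mul, eval_C, eval_pow, eval_X]
    rcases Nat.eq_zero_or_pos (s + k) with h | h
    · have h1 : (s : ℝ) + k = 0 := by exact_mod_cast h
      rw [h, h1]
      simp
    · obtain ⟨n, hn⟩ := Nat.exists_eq_succ_of_ne_zero h.ne'
      rw [show s + 1 + k = n + 2 by omega, hn]
      have h1 : (s : ℝ) + k = n + 1 := by exact_mod_cast hn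
      rw [show (s : ℝ) + 1 + k = n + 2 by linarith, h1]
      simp only [Nat.succ_eq_add_one, Nat.add_sub_cancel]
      push_cast
      ring
  have hode : ∀ r : ℝ, r ^ 2 * (r - 2 * M) * Q.derivative.derivative.eval r
        + 2 * M * r * Q.derivative.eval r
        = (L * (L + 1) * r + 2 * M * (1 - (s : ℝ) ^ 2)) * Q.eval r := by
    intro r
    -- After insertion of the recursion the residual of the equation telescopes; the lower end
    -- vanishes by `d 0 = 0` and the upper one by `c m = 0`.
    have hT := Finset.sum_range_sub (fun k => 2 * M * d k * b k * r ^ (s + 1 + k)) (m + 1)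
    have hTm : 2 * M * d (m + 1) * b (m + 1) = 0 := by
      rw [← hrec]
      simp only [hc, hL]
      push_cast
      ring
    have hT0 : d 0 = 0 := by simp [hd]
    rw [hTm, hT0] at hT
    have h1 : r ^ 2 * (r - 2 * M) * Q.derivative.derivative.eval r
        = (r - 2 * M) * (r ^ 2 * Q.derivative.derivative.eval r) := by ring
    rw [h1, hQdd, hQd, hQe]
    have h2 : (r - 2 * M) * ∑ k ∈ Finset.range (m + 1),
          b k * ((s : ℝ) + 1 + k) * (s + k) * r ^ (s + 1 + k)
        + 2 * M * r * ∑ k ∈ Finset.range (m + 1), b k * ((s : ℝ) + 1 + k) * r ^ (s + k)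
        - (L * (L + 1) * r + 2 * M * (1 - (s : ℝ) ^ 2))
          * ∑ k ∈ Finset.range (m + 1), b k * r ^ (s + 1 + k) = 0 := by
      rw [Finset.mul_sum, Finset.mul_sum, Finset.mul_sum, ← Finset.sum_add_distrib,
        ← Finset.sum_sub_distrib]
      refine Eq.trans (Finset.sum_congr rfl fun k _ => ?_) (hT.trans (by ring))
      rw [← hrec]
      simp only [hc, hd]
      rw [show s + 1 + (k + 1) = (s + k) + 2 by ring, show s + 1 + k = (s + k) + 1 by ring]
      ring
    linarith
  have hlim : Tendsto (fun r : ℝ => Q.eval r / r ^ (s + m + 1)) atTop (𝓝 (b m)) := by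
    have h1 : Tendsto (fun r : ℝ => ∑ k ∈ Finset.range (m + 1),
        b k * (r ^ (s + 1 + k) / r ^ (s + m + 1))) atTop
        (𝓝 (∑ k ∈ Finset.range (m + 1), b k * if k = m then 1 else 0)) := by
      refine tendsto_finsetSum _ fun k hk => Tendsto.const_mul _ ?_
      by_cases hkm : k = m
      · simp only [hkm, if_true]
        refine tendsto_const_nhds.congr' ?_
        filter_upwards [eventually_gt_atTop 0] with r hr
        rw [show s + 1 + m = s + m + 1 by ring, div_self (by positivity)]
      · simp only [hkm, if_false]
        refine tendsto_pow_div_pow_atTop_zero ?_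
        have := Finset.mem_range.1 hk
        omega
    simp only [mul_ite, mul_one, mul_zero, Finset.sum_ite_eq', Finset.mem_range,
      Nat.lt_succ_self, if_true] at h1
    refine h1.congr fun r => ?_
    rw [hQe, Finset.sum_div]
    exact Finset.sum_congr rfl fun k _ => (mul_div_assoc _ _ _).symm
  refine ⟨C (b m)⁻¹ * Q, fun r => ?_, ?_⟩
  · simp only [derivative_C_mul, eval_mul, eval_C]
    have := hode r
    linear_combination (b m)⁻¹ * this
  · have := hlim.const_mul (b m)⁻¹
    rw [inv_mul_cancel₀ (hbne m le_rfl)] at this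
    refine this.congr fun r => ?_
    rw [eval_mul, eval_C, mul_div_assoc]

/-! ### Asymptotics of the radius and the growing zero energy solution -/

theorem tendsto_radius_atTop {M : ℝ} (hM : 0 < M) : Tendsto (radius M) atTop atTop := by
  refine tendsto_atTop_mono (f := fun x => x / 2) (fun x => ?_)
    (tendsto_id.atTop_div_const two_pos)
  have := half_le_radius hM x
  linarith

theorem tendsto_radius_div_self {M : ℝ} (hM : 0 < M) :
    Tendsto (fun x => radius M x / x) atTop (𝓝 1) := by
  have h1 : Tendsto (fun r : ℝ => tortoise M r / r) atTop (𝓝 1) := by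
    have h2 : Tendsto (fun r : ℝ => r / (2 * M) - 1) atTop atTop :=
      tendsto_atTop_add_const_right _ _ (tendsto_id.atTop_div_const (by positivity))
    have h3 := ((Real.tendsto_pow_log_div_mul_add_atTop (2 * M) (2 * M) 1
      (by positivity)).comp h2).const_mul (2 * M)
    rw [mul_zero] at h3
    have h4 := h3.const_add 1
    rw [add_zero] at h4
    refine h4.congr' ?_
    filter_upwards [eventually_gt_atTop 0] with r hr
    have : 2 * M * (r / (2 * M) - 1) + 2 * M = r := by
      field_simp
      ring
    simp only [Function.comp, pow_one, this, tortoise]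
    field_simp
  have h5 := (h1.comp (tendsto_radius_atTop hM)).inv₀ one_ne_zero
  rw [inv_one] at h5
  refine h5.congr fun x => ?_
  simp only [Function.comp, tortoise_radius hM, inv_div]

theorem tendsto_radius_atBot {M : ℝ} (hM : 0 < M) :
    Tendsto (radius M) atBot (𝓝 (2 * M)) := by
  have h1 : Tendsto (fun x => 2 * M / radius M x) atBot (𝓝 1) := by
    have h2 : Tendsto (fun x : ℝ => 1 - Real.exp (x / (2 * M))) atBot (𝓝 1) := by
      have := (Real.tendsto_exp_atBot.comp
        (tendsto_id.atBot_div_const (show 0 < 2 * M by positivity))).const_sub 1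
      simpa using this
    refine tendsto_of_tendsto_of_tendsto_of_le_of_le h2 tendsto_const_nhds (fun x => ?_)
      (fun x => ?_)
    · have := radius_sub_le_exp hM x
      simp only
      linarith
    · have := two_mul_lt_radius hM x
      exact (div_le_one (by linarith)).2 this.le
  have h3 := (h1.inv₀ one_ne_zero).const_mul (2 * M)
  rw [inv_one, mul_one] at h3
  refine h3.congr fun x => ?_
  have := two_mul_lt_radius hM x
  field_simp

/-- A solution of `u'' = V u` with `V ≥ 0` that is bounded with vanishing derivative at `-∞`
has a monotone square. -/
theorem IsSolution.mul_deriv_nonneg {V u : ℝ → ℝ} (hV : ∀ x, 0 ≤ V x) (h : IsSolution V 0 u)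
    (h0 : Tendsto (fun x => u x * deriv u x) atBot (𝓝 0)) (x : ℝ) : 0 ≤ u x * deriv u x := by
  have hm : Monotone fun x => u x * deriv u x := by
    refine monotone_of_hasDerivAt_nonneg
      (fun x => (h.hasDerivAt x).mul (h.hasDerivAt_deriv x)) fun x => ?_
    have := hV x
    simp only [Pi.zero_apply, smul_eq_mul, sub_zero]
    nlinarith [sq_nonneg (deriv u x), mul_nonneg this (sq_nonneg (u x))]
  exact hm.le_of_tendsto h0 x

/-- The three values of `σ` are `1 - s²` for `s = 2, 1, 0`, and the excluded pairs are exactly those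
with `ℓ < s`. The polynomial solution is bounded at the horizon with derivative tending to zero
there, so its square is increasing; a zero would force it to vanish on a half-line, giving the
polynomial infinitely many roots. -/
theorem exists_growing_solution {M : ℝ} (hM : 0 < M) {l : ℕ} {σ : ℝ}
    (hσ : σ = -3 ∨ σ = 0 ∨ σ = 1)
    (hne : ¬(l = 0 ∧ σ = 0) ∧ ¬(l = 0 ∧ σ = -3) ∧ ¬(l = 1 ∧ σ = -3)) :
    ∃ u : ℝ → ℝ, IsSolution (potential M l σ) 0 u ∧ (∀ x, 0 < u x) ∧
      Tendsto (fun x : ℝ => u x / (x ^ (l + 1) / (2 * (l : ℝ) + 1))) atTop (𝓝 1) := by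
  obtain ⟨s, m, rfl, rfl⟩ : ∃ s m : ℕ, l = s + m ∧ σ = 1 - (s : ℝ) ^ 2 := by
    rcases hσ with rfl | rfl | rfl
    · refine ⟨2, l - 2, ?_, by norm_num⟩
      have h1 : l ≠ 0 := fun h => hne.2.1 ⟨h, rfl⟩
      have h2 : l ≠ 1 := fun h => hne.2.2 ⟨h, rfl⟩
      omega
    · refine ⟨1, l - 1, ?_, by norm_num⟩
      have h1 : l ≠ 0 := fun h => hne.1 ⟨h, rfl⟩
      omega
    · exact ⟨0, l, by simp, by norm_num⟩
  obtain ⟨P, hode, hlim⟩ := exists_polynomial_solution hM s m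
  set l := s + m with hl
  have hV := continuous_potential hM l (1 - (s : ℝ) ^ 2)
  have hL : (0 : ℝ) < 2 * (l : ℝ) + 1 := by positivity
  set u : ℝ → ℝ := fun x => P.eval (radius M x) / (2 * (l : ℝ) + 1) with hu
  have hr0 : ∀ x, 0 < radius M x := fun x => by linarith [two_mul_lt_radius hM x]
  have hsol := IsSolution.of_hasDerivAt (V := potential M l (1 - (s : ℝ) ^ 2)) (E := 0) (f := u)
    (g := fun x => P.derivative.eval (radius M x) * (1 - 2 * M / radius M x)
      / (2 * (l : ℝ) + 1)) hV
    (fun x => ((P.hasDerivAt _).comp x (hasDerivAt_radius hM x)).div_const _)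
    (fun x => by
      have h1 := (P.derivative.hasDerivAt (radius M x)).comp x (hasDerivAt_radius hM x)
      have h2 := ((hasDerivAt_radius hM x).inv (hr0 x).ne').const_mul (2 * M)
      have h3 := (h1.mul (h2.const_sub 1)).div_const (2 * (l : ℝ) + 1)
      refine (h3.congr_deriv ?_).congr_of_eventuallyEq (Eventually.of_forall fun y => ?_)
      · have h4 := hode (radius M x)
        have h5 := (hr0 x).ne'
        simp only [smul_eq_mul, sub_zero, hu, potential, Function.comp, Pi.inv_apply]
        rw [← mul_div_assoc]
        field_simp
        linear_combination (radius M x - 2 * M) * h4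
      · simp [div_eq_mul_inv])
  obtain ⟨hs, hsd⟩ := hsol
  have hpot := potential_pos hM hσ hne
  have hbot := tendsto_radius_atBot hM
  have hnn : ∀ x, 0 ≤ u x * deriv u x := by
    refine hs.mul_deriv_nonneg (fun x => (hpot x).le) ?_
    have h1 : Tendsto (fun x => 1 - 2 * M / radius M x) atBot (𝓝 0) := by
      have := ((tendsto_const_nhds (x := 2 * M)).div hbot (by positivity)).const_sub 1
      rwa [div_self (by positivity), sub_self] at this
    have h2 := ((P.continuous.tendsto _).comp hbot).div_const (2 * (l : ℝ) + 1)
    have h3 := (((P.derivative.continuous.tendsto _).comp hbot).mul h1).div_const (2 * (l : ℝ) + 1)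
    have h4 := h2.mul h3
    rw [mul_zero, zero_div, mul_zero] at h4
    rw [hsd]
    exact h4
  have hmono : Monotone fun x => u x ^ 2 := by
    refine monotone_of_hasDerivAt_nonneg (fun x => (hs.hasDerivAt x).pow 2) fun x => ?_
    have := hnn x
    simp only [Pi.zero_apply]
    push_cast
    nlinarith
  have hu_lim : Tendsto (fun x : ℝ => u x / (x ^ (l + 1) / (2 * (l : ℝ) + 1))) atTop (𝓝 1) := by
    have h1 := (hlim.comp (tendsto_radius_atTop hM)).mul ((tendsto_radius_div_self hM).pow (l + 1))
    rw [one_pow, one_mul] at h1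
    refine h1.congr' ?_
    filter_upwards [eventually_gt_atTop 0] with x hx
    have := hr0 x
    simp only [Function.comp, hu, div_pow]
    field_simp
  have hev : ∀ᶠ x in atTop, 0 < u x := by
    filter_upwards [hu_lim.eventually (lt_mem_nhds one_pos), eventually_gt_atTop 0] with x hx hx0
    have : 0 < x ^ (l + 1) / (2 * (l : ℝ) + 1) := by positivity
    rw [lt_div_iff₀ this, zero_mul] at hx
    exact hx
  have hne0 : ∀ x, u x ≠ 0 := by
    intro a ha
    have hz : ∀ x ≤ a, u x = 0 := by
      intro x hx
      have := hmono hx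
      simp only [ha] at this
      have h1 : u x ^ 2 = 0 := le_antisymm (by simpa using this) (sq_nonneg _)
      exact pow_eq_zero_iff two_ne_zero |>.1 h1
    have hinf : {r | P.IsRoot r}.Infinite := by
      have h1 : (radius M '' Iic a).Infinite := by
        refine (Iic_infinite a).image fun x _ y _ hxy => ?_
        rw [← tortoise_radius hM x, ← tortoise_radius hM y, hxy]
      refine h1.mono ?_
      rintro _ ⟨x, hx, rfl⟩
      have := hz x hx
      simp only [hu, div_eq_zero_iff, hL.ne', or_false] at this
      exact this
    have hP := P.eq_zero_of_infinite_isRoot hinf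
    obtain ⟨x, hx⟩ := hev.exists
    simp [hu, hP] at hx
  refine ⟨u, hs, fun x => ?_, hu_lim⟩
  by_contra hx
  obtain ⟨y, hy⟩ := (hev.and (eventually_ge_atTop x)).exists
  obtain ⟨z, _, hz⟩ := intermediate_value_Icc hy.2 hs.continuous.continuousOn
    (show (0 : ℝ) ∈ Icc (u x) (u y) from ⟨not_lt.1 hx, hy.1.le⟩)
  exact hne0 z hz

theorem integrableOn_inv_sq {u : ℝ → ℝ} (hu : Continuous u) {l : ℕ} {a : ℝ}
    (hpos : ∀ x, a ≤ x → 0 < u x)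
    (hlim : Tendsto (fun x : ℝ => u x / (x ^ (l + 1) / (2 * (l : ℝ) + 1))) atTop (𝓝 1)) :
    IntegrableOn (fun x => (u x ^ 2)⁻¹) (Ici a) := by
  have hc : ContinuousOn (fun x => (u x ^ 2)⁻¹) (Ici a) :=
    (hu.pow 2).continuousOn.inv₀ fun x hx => pow_ne_zero 2 (hpos x hx).ne'
  refine (hc.locallyIntegrableOn measurableSet_Ici).integrableOn_of_isBigO_atTop
    (g := fun x : ℝ => x ^ (-2 : ℝ)) ?_
    ⟨Ioi 1, Ioi_mem_atTop 1, integrableOn_Ioi_rpow_of_lt (by norm_num) one_pos⟩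
  refine Asymptotics.IsBigO.of_bound ((2 * (2 * (l : ℝ) + 1)) ^ 2) ?_
  filter_upwards [hlim.eventually (lt_mem_nhds (show (1 / 2 : ℝ) < 1 by norm_num)),
    eventually_ge_atTop 1, eventually_ge_atTop a] with x hx hx1 hxa
  have hx0 : 0 < x := by linarith
  have hL : (0 : ℝ) < 2 * (l : ℝ) + 1 := by positivity
  rw [lt_div_iff₀ (by positivity)] at hx
  have h1 : x ≤ x ^ (l + 1) := le_self_pow₀ hx1 (by omega)
  have h2 : x ≤ 2 * (2 * (l : ℝ) + 1) * u x := by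
    rw [div_mul_div_comm, one_mul, div_lt_iff₀ (by positivity)] at hx
    nlinarith
  have hu0 := hpos x hxa
  rw [Real.norm_of_nonneg (by positivity), Real.norm_of_nonneg (by positivity),
    Real.rpow_neg hx0.le, Real.rpow_two, ← div_eq_mul_inv, inv_eq_one_div,
    div_le_div_iff₀ (by positivity) (by positivity), one_mul, ← mul_pow]
  gcongr

/-- Reduction of order: the second solution is `u ∫_x^∞ u⁻²`, and l'Hôpital's rule gives `∫_x^∞ u⁻²
~ (2ℓ+1) x^{-(2ℓ+1)}`. -/
theorem exists_isZeroEnergyBasis {V u : ℝ → ℝ} {l : ℕ} (hV : Continuous V)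
    (hu : IsSolution V 0 u) (hpos : ∀ x, 0 < u x)
    (hlim : Tendsto (fun x : ℝ => u x / (x ^ (l + 1) / (2 * (l : ℝ) + 1))) atTop (𝓝 1)) :
    ∃ w : ℝ → ℝ, IsZeroEnergyBasis V l ![u, w] := by
  have hi : ∀ a, IntegrableOn (fun x => (u x ^ 2)⁻¹) (Ioi a) := fun a =>
    (integrableOn_inv_sq hu.continuous (fun x _ => hpos x) hlim).mono_set Ioi_subset_Ici_self
  have hL : (0 : ℝ) < 2 * (l : ℝ) + 1 := by positivity
  have hc : Continuous fun x => (u x ^ 2)⁻¹ :=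
    (hu.continuous.pow 2).inv₀ fun x => pow_ne_zero 2 (hpos x).ne'
  set J : ℝ → ℝ := fun x => ∫ y in Ioi x, (u y ^ 2)⁻¹ with hJ
  have hJd : ∀ x, HasDerivAt J (-(u x ^ 2)⁻¹) x := hasDerivAt_integral_Ioi hc hi
  obtain ⟨hs, hsd⟩ := IsSolution.of_hasDerivAt (V := V) (E := 0) (f := fun x => u x * J x)
    (g := fun x => deriv u x * J x - (u x)⁻¹) hV
    (fun x => by
      refine ((hu.hasDerivAt x).mul (hJd x)).congr_deriv ?_
      have := (hpos x).ne'
      field_simp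
      ring)
    (fun x => by
      refine (((hu.hasDerivAt_deriv x).mul (hJd x)).sub
        ((hu.hasDerivAt x).inv (hpos x).ne')).congr_deriv ?_
      have := (hpos x).ne'
      simp only [smul_eq_mul, sub_zero]
      field_simp
      ring)
  refine ⟨fun x => u x * J x, ⟨fun j => ?_, hlim, ?_, fun x => ?_⟩⟩
  · fin_cases j
    · exact hu
    · exact hs
  · have h1 : Tendsto (fun x => J x / (x ^ (2 * l + 1))⁻¹) atTop (𝓝 (2 * (l : ℝ) + 1)) := by
      refine HasDerivAt.lhopital_zero_atTop (f' := fun x => -(u x ^ 2)⁻¹)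
        (g' := fun x => -(((2 * l + 1 : ℕ) : ℝ) * x ^ (2 * l)) / (x ^ (2 * l + 1)) ^ 2)
        (Eventually.of_forall hJd) ?_ ?_ (tendsto_integral_Ioi_zero hi) ?_ ?_
      · filter_upwards [eventually_gt_atTop 0] with x hx
        exact (hasDerivAt_pow (2 * l + 1) x).inv (by positivity)
      · filter_upwards [eventually_gt_atTop 0] with x hx
        have : 0 < ((2 * l + 1 : ℕ) : ℝ) := by positivity
        rw [neg_div]
        exact neg_ne_zero.2 (by positivity)
      · exact (tendsto_pow_atTop (by omega)).inv_tendsto_atTop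
      · have h2 := ((hlim.inv₀ one_ne_zero).pow 2).const_mul (2 * (l : ℝ) + 1)
        rw [inv_one, one_pow, mul_one] at h2
        refine h2.congr' ?_
        filter_upwards [eventually_gt_atTop 0] with x hx
        have := (hpos x).ne'
        push_cast
        field_simp
        ring
    have h3 := (hlim.mul h1).div_const (2 * (l : ℝ) + 1)
    rw [one_mul, div_self hL.ne'] at h3
    refine h3.congr' ?_
    filter_upwards [eventually_gt_atTop 0] with x hx
    simp only [Matrix.cons_val_one, Matrix.cons_val_fin_one]
    field_simp
    ring
  · simp only [wronskian, Matrix.cons_val_zero, Matrix.cons_val_one, Matrix.cons_val_fin_one, hsd]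
    have := (hpos x).ne'
    field_simp
    ring

end ZeroEnergy

end ReggeWheeler

namespace ReggeWheeler
open MeasureTheory

/-! ## Perturbation in the energy -/

section Energy

variable {V u : ℝ → ℝ} {D x0 c1 c2 : ℝ} {l : ℕ}

/-- A real solution at energy `lam²` in terms of the Jost solution. -/
theorem IsSolution.eq_im_mul_conj {lam : ℝ} {U : ℝ → ℝ} {f : ℝ → ℂ} (hV : Continuous V)
    (hVb : ∀ x, |V x| ≤ D / (1 + x ^ 2)) (hlam : 0 < lam) (hf : IsJostPlus V lam f)
    (hU : IsSolution V (lam ^ 2) U) (x y : ℝ) :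
    (wronskian f (fun x => (U x : ℂ)) y * starRingEnd ℂ (f x)).im = -lam * U x := by
  obtain ⟨hs, hsd⟩ := hU.ofReal hV
  rw [wronskian_const hf.sol hs y x, wronskian, hsd]
  have h1 := hf.im_deriv_mul_conj hV hVb hlam x
  simp only [Complex.mul_im, Complex.conj_re, Complex.conj_im, Complex.sub_re, Complex.sub_im,
    Complex.mul_re, Complex.ofReal_re, Complex.ofReal_im] at h1 ⊢
  linear_combination -(U x) * h1

theorem IsSolution.monotoneOn_deriv (hVpos : ∀ x, 0 ≤ V x) (hu : IsSolution V 0 u)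
    (hpos : ∀ x, x0 ≤ x → 0 ≤ u x) : MonotoneOn (deriv u) (Ici x0) := by
  refine monotoneOn_of_deriv_nonneg (convex_Ici _)
    (continuous_iff_continuousAt.2 fun x => (hu.hasDerivAt_deriv x).continuousAt).continuousOn
    (fun x _ => (hu.hasDerivAt_deriv x).differentiableAt.differentiableWithinAt) fun x hx => ?_
  rw [interior_Ici] at hx
  rw [(hu.hasDerivAt_deriv x).deriv, sub_zero]
  exact mul_nonneg (hVpos x) (hpos x (le_of_lt hx))

/-- By convexity `u'` is bounded below by `u'(x0)` and above by a difference quotient to the right,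
which the growth of `u` controls. -/
theorem IsSolution.abs_deriv_le (hVpos : ∀ x, 0 ≤ V x) (hu : IsSolution V 0 u) (hx0 : 0 ≤ x0)
    (hc1 : 0 < c1) (hul : ∀ x, x0 ≤ x → c1 * (1 + x) ^ (l + 1) ≤ u x)
    (huu : ∀ x, x0 ≤ x → u x ≤ c2 * (1 + x) ^ (l + 1)) :
    ∃ C, 0 < C ∧ ∀ x, x0 ≤ x → |deriv u x| ≤ C * (1 + x) ^ l := by
  have hupos : ∀ x, x0 ≤ x → 0 < u x := fun x hx =>
    lt_of_lt_of_le (by have : 0 ≤ x := hx0.trans hx; positivity) (hul x hx)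
  have hmono := hu.monotoneOn_deriv hVpos fun x hx => (hupos x hx).le
  have hc2 : 0 < c2 := by
    have h1 := (hupos x0 le_rfl).trans_le (huu x0 le_rfl)
    exact pos_of_mul_pos_left h1 (by positivity)
  refine ⟨c2 * 2 ^ (l + 1) + |deriv u x0|, by positivity, fun x hx => ?_⟩
  have hxn : 0 ≤ x := hx0.trans hx
  have hp : 1 ≤ (1 + x) ^ l := one_le_pow₀ (by linarith)
  have hup : deriv u x ≤ c2 * 2 ^ (l + 1) * (1 + x) ^ l := by
    -- The interval has length `1 + x`, so that its right end is still comparable to `1 + x` and the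
    -- quotient gains one power.
    obtain ⟨ξ, hξ, hξe⟩ := exists_deriv_eq_slope u (show x < x + (1 + x) by linarith)
      hu.continuous.continuousOn (fun y _ => (hu.hasDerivAt y).differentiableAt.differentiableWithinAt)
    have h1 := hmono (show x ∈ Ici x0 from hx) (show ξ ∈ Ici x0 from hx.trans hξ.1.le) hξ.1.le
    rw [hξe, add_sub_cancel_left, le_div_iff₀ (by linarith)] at h1
    have h2 := huu (x + (1 + x)) (by linarith)
    have h3 := (hupos x hx).le
    have h4 : c2 * (1 + (x + (1 + x))) ^ (l + 1) = c2 * 2 ^ (l + 1) * (1 + x) ^ l * (1 + x) := by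
      rw [show 1 + (x + (1 + x)) = 2 * (1 + x) by ring, mul_pow]
      ring
    refine le_of_mul_le_mul_right ?_ (show 0 < 1 + x by linarith)
    linarith
  have hlo := hmono (show x0 ∈ Ici x0 from self_mem_Ici) (show x ∈ Ici x0 from hx) hx
  have h5 := neg_abs_le (deriv u x0)
  rw [abs_le]
  constructor
  · have h6 : |deriv u x0| ≤ (c2 * 2 ^ (l + 1) + |deriv u x0|) * (1 + x) ^ l := by
      refine le_trans ?_ (le_mul_of_one_le_right (by positivity) hp)
      have : 0 < c2 * 2 ^ (l + 1) := by positivity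
      linarith
    linarith
  · refine hup.trans ?_
    have := abs_nonneg (deriv u x0)
    gcongr
    linarith

/-- For `t ≥ y` one has `(1+t)^{-2(l+1)} ≤ (1+y)^{-2l} (1+t)⁻²`, and the last factor has an
elementary primitive. The second bound controls the kernel of the energy perturbation. -/
theorem sq_mul_integral_inv_sq_le (hu : Continuous u) (hx0 : 0 ≤ x0)
    (hc1 : 0 < c1) (hul : ∀ x, x0 ≤ x → c1 * (1 + x) ^ (l + 1) ≤ u x)
    (huu : ∀ x, x0 ≤ x → u x ≤ c2 * (1 + x) ^ (l + 1)) {x y : ℝ} (hy : x0 ≤ y) (hyx : y ≤ x) :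
    (∫ t in y..x, (u t ^ 2)⁻¹) ≤ (c1 ^ 2)⁻¹ * ((1 + y) ^ (2 * l + 1))⁻¹ ∧
    u y ^ 2 * ∫ t in y..x, (u t ^ 2)⁻¹ ≤ (c2 / c1) ^ 2 * (1 + y) := by
  have hupos : ∀ x, x0 ≤ x → 0 < u x := fun x hx =>
    lt_of_lt_of_le (by have : 0 ≤ x := hx0.trans hx; positivity) (hul x hx)
  have hy0 : 0 ≤ y := hx0.trans hy
  have hint : IntervalIntegrable (fun t => (u t ^ 2)⁻¹) volume y x := by
    refine ContinuousOn.intervalIntegrable ?_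
    rw [uIcc_of_le hyx]
    exact (hu.pow 2).continuousOn.inv₀ fun t ht => pow_ne_zero 2 (hupos t (hy.trans ht.1)).ne'
  have hder : ∀ t ∈ uIcc y x, HasDerivAt (fun t => -((c1 ^ 2 * (1 + y) ^ (2 * l))⁻¹ * (1 + t)⁻¹))
      ((c1 ^ 2 * (1 + y) ^ (2 * l))⁻¹ * ((1 + t) ^ 2)⁻¹) t := by
    intro t ht
    rw [uIcc_of_le hyx] at ht
    have : 0 < 1 + t := by linarith [ht.1]
    refine (((((hasDerivAt_id t).const_add 1).inv this.ne').const_mul _).neg).congr_deriv ?_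
    simp only [id]
    field_simp
  have hint2 : IntervalIntegrable (fun t => (c1 ^ 2 * (1 + y) ^ (2 * l))⁻¹ * ((1 + t) ^ 2)⁻¹)
      volume y x := by
    refine ContinuousOn.intervalIntegrable ?_
    rw [uIcc_of_le hyx]
    refine continuousOn_const.mul (ContinuousOn.inv₀
      ((continuous_const.add continuous_id).pow 2).continuousOn fun t ht => ?_)
    have : 0 < 1 + t := by linarith [ht.1]
    positivity
  have h1 : (∫ t in y..x, (u t ^ 2)⁻¹) ≤ (c1 ^ 2)⁻¹ * ((1 + y) ^ (2 * l + 1))⁻¹ := by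
    refine (intervalIntegral.integral_mono_on hyx hint hint2 fun t ht => ?_).trans ?_
    · have ht0 : 0 ≤ t := hy0.trans ht.1
      rw [← mul_inv]
      refine inv_anti₀ (by positivity) ?_
      calc c1 ^ 2 * (1 + y) ^ (2 * l) * (1 + t) ^ 2
          ≤ c1 ^ 2 * (1 + t) ^ (2 * l) * (1 + t) ^ 2 := by
            have := ht.1
            gcongr
        _ = (c1 * (1 + t) ^ (l + 1)) ^ 2 := by ring
        _ ≤ u t ^ 2 := by
            have := hul t (hy.trans ht.1)
            gcongr
    · rw [intervalIntegral.integral_eq_sub_of_hasDerivAt hder hint2]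
      have h2 : 0 ≤ (c1 ^ 2 * (1 + y) ^ (2 * l))⁻¹ * (1 + x)⁻¹ := by
        have : 0 ≤ x := hy0.trans hyx
        positivity
      have h3 : (c1 ^ 2)⁻¹ * ((1 + y) ^ (2 * l + 1))⁻¹
          = (c1 ^ 2 * (1 + y) ^ (2 * l))⁻¹ * (1 + y)⁻¹ := by
        rw [pow_succ (1 + y) (2 * l), mul_inv, mul_inv, mul_assoc]
      rw [h3]
      linarith
  refine ⟨h1, ?_⟩
  have hu0 := (hupos y hy).le
  calc u y ^ 2 * ∫ t in y..x, (u t ^ 2)⁻¹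
      ≤ (c2 * (1 + y) ^ (l + 1)) ^ 2 * ((c1 ^ 2)⁻¹ * ((1 + y) ^ (2 * l + 1))⁻¹) := by
        have := huu y hy
        gcongr
        exact intervalIntegral.integral_nonneg hyx fun t _ => by positivity
    _ = (c2 / c1) ^ 2 * (1 + y) := by
        have : 0 < 1 + y := by linarith
        field_simp
        ring

set_option maxHeartbeats 1000000 in
/-- Solutions at energy `w` with the initial values of `u` at `x0`, in the form `u W(w, ·)` with
derivative `UD(w, ·)`, for complex `w`. -/
theorem exists_energy_perturbation (hV : Continuous V) (hVb : ∀ x, |V x| ≤ D / (1 + x ^ 2))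
    (hVpos : ∀ x, 0 ≤ V x) (hu : IsSolution V 0 u) (hx0 : 0 ≤ x0)
    (hc1 : 0 < c1) (hul : ∀ x, x0 ≤ x → c1 * (1 + x) ^ (l + 1) ≤ u x)
    (huu : ∀ x, x0 ≤ x → u x ≤ c2 * (1 + x) ^ (l + 1)) :
    ∃ (W UD : ℂ → ℝ → ℂ) (c0 C : ℝ), 0 < c0 ∧ 0 < C ∧
      (∀ w, Measurable (W w)) ∧
      (∀ x, x0 ≤ x → Differentiable ℂ (fun w => W w x) ∧ Differentiable ℂ (fun w => UD w x)) ∧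
      (∀ w x, W (starRingEnd ℂ w) x = starRingEnd ℂ (W w x)) ∧
      (∀ x, x0 ≤ x → W 0 x = 1) ∧
      (∀ w x, x0 ≤ x → ‖w‖ * (1 + x) ^ 2 ≤ c0 →
        ‖W w x - 1‖ ≤ 1 / 2 ∧ ‖UD w x‖ ≤ C * (1 + x) ^ l) ∧
      ∀ (lam : ℝ) (U : ℝ → ℝ), 0 < lam → IsSolution V (lam ^ 2) U → U x0 = u x0 →
        deriv U x0 = deriv u x0 → ∀ x, x0 ≤ x →
          (U x : ℂ) = u x * W ((lam : ℂ) ^ 2) x ∧ ((deriv U x : ℝ) : ℂ) = UD ((lam : ℂ) ^ 2) x := by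
  have hupos : ∀ x, x0 ≤ x → 0 < u x := fun x hx =>
    lt_of_lt_of_le (by have : 0 ≤ x := hx0.trans hx; positivity) (hul x hx)
  obtain ⟨C', hC', hC'd⟩ := hu.abs_deriv_le hVpos hx0 hc1 hul huu
  have hc2 : 0 < c2 := by
    have h1 := (hupos x0 le_rfl).trans_le (huu x0 le_rfl)
    exact pos_of_mul_pos_left h1 (by positivity)
  -- Freezing `u` to the left of `x0` gives a function that is continuous and positive on the whole
  -- line.
  set v : ℝ → ℝ := fun x => u (max x0 x) with hv
  have hvc : Continuous v := hu.continuous.comp (continuous_const.max continuous_id)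
  have hvpos : ∀ x, 0 < v x := fun x => hupos _ (le_max_left _ _)
  have hvu : ∀ x, x0 ≤ x → v x = u x := fun x hx => by simp only [hv, max_eq_right hx]
  have hvi : Continuous fun t => (v t ^ 2)⁻¹ :=
    (hvc.pow 2).inv₀ fun x => pow_ne_zero 2 (hvpos x).ne'
  set J : ℝ → ℝ := fun x => ∫ t in x0..x, (v t ^ 2)⁻¹ with hJ
  have hJd : ∀ x, HasDerivAt J ((v x ^ 2)⁻¹) x := fun x =>
    intervalIntegral.integral_hasDerivAt_right (hvi.intervalIntegrable _ _)
      (hvi.stronglyMeasurableAtFilter _ _) hvi.continuousAt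
  have hJc : Continuous J := continuous_iff_continuousAt.2 fun x => (hJd x).continuousAt
  set C : ℝ := (c2 / c1) ^ 2 with hC
  have hC0 : 0 < C := by positivity
  have hker : ∀ x y, x0 ≤ y → y ≤ x → |v y ^ 2 * (J x - J y)| ≤ C * (1 + y) := by
    intro x y hy hyx
    have h1 : J x - J y = ∫ t in y..x, (u t ^ 2)⁻¹ := by
      rw [hJ]
      simp only
      rw [intervalIntegral.integral_interval_sub_left (hvi.intervalIntegrable _ _)
        (hvi.intervalIntegrable _ _)]
      refine intervalIntegral.integral_congr fun t ht => ?_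
      rw [uIcc_of_le hyx] at ht
      simp only [hvu t (hy.trans ht.1)]
    rw [h1, hvu y hy, abs_of_nonneg]
    · exact (sq_mul_integral_inv_sq_le hu.continuous hx0 hc1 hul huu hy hyx).2
    · exact mul_nonneg (sq_nonneg _) (intervalIntegral.integral_nonneg hyx fun t _ => by positivity)
  -- Writing `U = u ψ`, the equation becomes `(u² ψ')' = -w u² ψ`; two integrations give `ψ(x) = 1 -
  -- w ∫ u(y)² (J(x) - J(y)) ψ(y) dy`. The kernel is linear in `w` and bounded by a multiple of `‖w‖
  -- (1 + y)`, so `ψ` is entire in `w`.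
  set k0 : ℂ → ℝ → ℝ → ℂ := fun w x y => -w * ((v y ^ 2 * (J x - J y) : ℝ) : ℂ) with hk0
  set K : ℂ → ℝ → ℝ → ℂ := fun w x => (Iic x).indicator (k0 w x) with hK
  have hKm : ∀ w, Measurable (fun p : ℝ × ℝ => K w p.1 p.2) := fun w =>
    measurable_indicator_Iic (Continuous.measurable (by
      exact continuous_const.mul (Complex.continuous_ofReal.comp
        (((hvc.comp continuous_snd).pow 2).mul
          ((hJc.comp continuous_fst).sub (hJc.comp continuous_snd))))))
  have hK0 : ∀ w x y, x0 ≤ y → y ≤ x → ‖k0 w x y‖ ≤ ‖w‖ * (C * (1 + y)) := by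
    intro w x y hy hyx
    simp only [hk0]
    rw [norm_mul, norm_neg, Complex.norm_real, Real.norm_eq_abs]
    exact mul_le_mul_of_nonneg_left (hker x y hy hyx) (norm_nonneg _)
  have hwt : ∀ ρ : ℝ, IsVolterraWeight (Ici x0)
      (fun t => (Iic t).indicator fun y => ρ * (C * (1 + y)))
      (fun t => Real.exp (2 * (ρ * C * (1 + t) ^ 2 / 2))) := fun ρ =>
    IsVolterraWeight.of_primitive_Iic
      (continuous_const.mul (continuous_const.mul (continuous_const.add continuous_id))) fun s => by
      refine ((((((hasDerivAt_id s).const_add 1).pow 2).const_mul (ρ * C)).div_const 2)).congr_deriv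
        ?_
      simp only [id]
      ring
  have hKb : ∀ ρ : ℝ, ∀ w : ℂ, ‖w‖ ≤ ρ → ∀ t ∈ Ici x0, ∀ s ∈ Ici x0,
      ‖K w t s‖ ≤ (Iic t).indicator (fun y => ρ * (C * (1 + y))) s := by
    intro ρ w hw t _ s hs
    refine norm_indicator_le_indicator fun hst => (hK0 w t s hs hst).trans ?_
    have : 0 ≤ s := hx0.trans hs
    gcongr
  have hφb : ∀ ρ : ℝ, 0 ≤ ρ → ∀ s ∈ Ici x0,
      ‖(1 : ℂ)‖ ≤ 1 * Real.exp (2 * (ρ * C * (1 + s) ^ 2 / 2)) := by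
    intro ρ hρ s _
    rw [norm_one, one_mul]
    exact Real.one_le_exp (by positivity)
  set W : ℂ → ℝ → ℂ := fun w => volterraSol (Ici x0) (K w) (fun _ => 1) with hW
  have hWm : ∀ w, Measurable (W w) := fun w => volterraSol_measurable (hKm w) measurable_const
  have hWb : ∀ ρ : ℝ, 0 ≤ ρ → ∀ w : ℂ, ‖w‖ ≤ ρ → ∀ x ∈ Ici x0,
      ‖W w x‖ ≤ 2 * Real.exp (ρ * C * (1 + x) ^ 2) := by
    intro ρ hρ w hw x hx
    have := (hwt ρ).norm_sol_le (hKm w) measurable_const (hKb ρ w hw) (hφb ρ hρ) x hx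
    rwa [mul_one, mul_div_cancel₀ _ (two_ne_zero)] at this
  have hWeq : ∀ w, ∀ x ∈ Ici x0, W w x = 1 + ∫ y in Ici x0, K w x y * W w y := fun w x hx =>
    (hwt ‖w‖).sol_eq (hKm w) measurable_const (hKb ‖w‖ w le_rfl) (hφb _ (norm_nonneg _)) x hx
  have hset : ∀ (w : ℂ) (ψ : ℝ → ℂ) (x : ℝ), ∫ y in Ici x0, K w x y * ψ y
      = ∫ y in Icc x0 x, k0 w x y * ψ y := by
    intro w ψ x
    rw [← Ici_inter_Iic, ← setIntegral_indicator measurableSet_Iic]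
    congr 1
    ext y
    by_cases hy : y ∈ Iic x
    · simp only [hK, indicator_of_mem hy]
    · simp only [hK, indicator_of_notMem hy, zero_mul]
  have hWd : ∀ x, x0 ≤ x → Differentiable ℂ (fun w => W w x) := by
    intro x hx w
    have hwU : w ∈ Metric.ball (0 : ℂ) (‖w‖ + 1) := by simp
    have := (hwt (‖w‖ + 1)).sol_differentiableOn (K := K) (φ₀ := fun _ _ => 1)
      (Metric.isOpen_ball (x := (0 : ℂ)) (ε := ‖w‖ + 1)) (fun z _ => hKm z)
      (fun _ _ => measurable_const)
      (fun z hz => hKb _ z (by simpa using (le_of_lt (mem_ball_zero_iff.1 hz))))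
      (fun _ _ => hφb _ (by positivity))
      (fun t _ s _ => by
        by_cases hs : s ∈ Iic t
        · simp only [hK, indicator_of_mem hs, hk0]
          exact (differentiable_id.neg.mul_const _).differentiableOn
        · simp only [hK, indicator_of_notMem hs]
          exact differentiableOn_const _)
      (fun t _ => differentiableOn_const _) x hx
    exact this.differentiableAt (Metric.isOpen_ball.mem_nhds hwU)
  set A : ℂ → ℝ → ℂ := fun w x => ∫ y in Icc x0 x, ((v y ^ 2 : ℝ) : ℂ) * W w y with hA
  have hAd : ∀ x, x0 ≤ x → Differentiable ℂ (fun w => A w x) := by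
    intro x hx w
    have hwU : w ∈ Metric.ball (0 : ℂ) (‖w‖ + 1) := by simp
    have hc : Continuous fun y => v y ^ 2 * (2 * Real.exp ((‖w‖ + 1) * C * (1 + y) ^ 2)) :=
      (hvc.pow 2).mul (continuous_const.mul (Real.continuous_exp.comp
        (continuous_const.mul ((continuous_const.add continuous_id).pow 2))))
    have hb1 : ∀ᵐ y ∂volume.restrict (Icc x0 x), ∀ z ∈ Metric.ball (0 : ℂ) (‖w‖ + 1),
        ‖((v y ^ 2 : ℝ) : ℂ) * W z y‖ ≤ v y ^ 2 * (2 * Real.exp ((‖w‖ + 1) * C * (1 + y) ^ 2)) := by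
      refine (ae_restrict_mem measurableSet_Icc).mono fun y hy z hz => ?_
      rw [norm_mul, Complex.norm_real, Real.norm_of_nonneg (sq_nonneg _)]
      exact mul_le_mul_of_nonneg_left (hWb _ (by positivity) z
        (le_of_lt (mem_ball_zero_iff.1 hz)) y hy.1) (sq_nonneg _)
    have hd1 : ∀ᵐ y ∂volume.restrict (Icc x0 x), DifferentiableOn ℂ
        (fun z => ((v y ^ 2 : ℝ) : ℂ) * W z y) (Metric.ball (0 : ℂ) (‖w‖ + 1)) :=
      (ae_restrict_mem measurableSet_Icc).mono fun y hy =>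
        ((hWd y hy.1).const_mul _).differentiableOn
    have := differentiableOn_integral_of_dominated Metric.isOpen_ball
      (fun z _ => ((Complex.continuous_ofReal.comp (hvc.pow 2)).measurable.mul
        (hWm z)).aestronglyMeasurable)
      (hc.continuousOn.integrableOn_compact isCompact_Icc) hb1 hd1
    exact this.differentiableAt (Metric.isOpen_ball.mem_nhds hwU)
  -- From the integrated Wronskian identity `u U' - u' U = -w A`, which makes it unnecessary to
  -- differentiate `W` in `x`.
  set UD : ℂ → ℝ → ℂ := fun w x => ((deriv u x : ℝ) : ℂ) * W w x - w * A w x / u x with hUD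
  -- With this constant the a priori bound is `‖W‖ ≤ 2 e^{1/8} ≤ 4`, and one pass through the
  -- integral equation yields `4/8 = 1/2`.
  set c0 : ℝ := 1 / (8 * C) with hc0
  have hW1 : ∀ w x, x0 ≤ x → ‖w‖ * (1 + x) ^ 2 ≤ c0 → ‖W w x - 1‖ ≤ 1 / 2 := by
    intro w x hx hw
    have hxn : 0 ≤ x := hx0.trans hx
    rw [hWeq w x hx, add_sub_cancel_left, hset]
    have h4 : ∀ y ∈ Icc x0 x, ‖W w y‖ ≤ 4 := by
      intro y hy
      refine (hWb _ (norm_nonneg _) w le_rfl y hy.1).trans ?_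
      have h5 : ‖w‖ * C * (1 + y) ^ 2 ≤ 1 / 8 := by
        have h6 : ‖w‖ * (1 + y) ^ 2 ≤ c0 := by
          refine le_trans ?_ hw
          have := hy.2
          have : 0 ≤ y := hx0.trans hy.1
          gcongr
        rw [hc0, le_div_iff₀ (by positivity)] at h6
        nlinarith
      have h7 : Real.exp (‖w‖ * C * (1 + y) ^ 2) ≤ Real.exp (1 / 8) := Real.exp_le_exp.2 h5
      have h8 : Real.exp (1 / 8) ≤ 2 := by
        have := Real.exp_bound_div_one_sub_of_interval (x := 1 / 8) (by norm_num) (by norm_num)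
        norm_num at this ⊢
        linarith
      linarith
    have h5 : ∀ y ∈ Icc x0 x, ‖k0 w x y * W w y‖ ≤ ‖w‖ * (C * (1 + x)) * 4 := by
      intro y hy
      rw [norm_mul]
      refine mul_le_mul ((hK0 w x y hy.1 hy.2).trans ?_) (h4 y hy) (norm_nonneg _) (by positivity)
      have := hy.2
      gcongr
    have h6 := norm_setIntegral_le_of_norm_le_const (μ := volume) (s := Icc x0 x)
      measure_Icc_lt_top h5
    refine h6.trans ?_
    rw [Real.volume_real_Icc_of_le hx]
    rw [hc0, le_div_iff₀ (by positivity)] at hw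
    calc ‖w‖ * (C * (1 + x)) * 4 * (x - x0) ≤ ‖w‖ * (C * (1 + x)) * 4 * (1 + x) := by
          gcongr
          linarith
      _ ≤ 1 / 2 := by nlinarith
  have hW2 : ∀ w x, x0 ≤ x → ‖w‖ * (1 + x) ^ 2 ≤ c0 → ‖W w x‖ ≤ 2 := by
    intro w x hx hw
    have h1 := hW1 w x hx hw
    have h2 := norm_add_le (W w x - 1) 1
    rw [sub_add_cancel, norm_one] at h2
    linarith
  have hA1 : ∀ w x, x0 ≤ x → ‖w‖ * (1 + x) ^ 2 ≤ c0 →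
      ‖A w x‖ ≤ 2 * c2 ^ 2 * (1 + x) ^ (2 * l + 3) := by
    intro w x hx hw
    have hxn : 0 ≤ x := hx0.trans hx
    have h5 : ∀ y ∈ Icc x0 x, ‖((v y ^ 2 : ℝ) : ℂ) * W w y‖
        ≤ (c2 * (1 + x) ^ (l + 1)) ^ 2 * 2 := by
      intro y hy
      rw [norm_mul, Complex.norm_real, Real.norm_of_nonneg (sq_nonneg _), hvu y hy.1]
      have hyn : 0 ≤ y := hx0.trans hy.1
      have h0 := (hupos y hy.1).le
      have h1 := (huu y hy.1).trans (show c2 * (1 + y) ^ (l + 1) ≤ c2 * (1 + x) ^ (l + 1) by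
        have := hy.2
        gcongr)
      have h2 : ‖W w y‖ ≤ 2 := hW2 w y hy.1 (by
        refine le_trans ?_ hw
        have := hy.2
        gcongr)
      gcongr
    have h6 := norm_setIntegral_le_of_norm_le_const (μ := volume) (s := Icc x0 x)
      measure_Icc_lt_top h5
    refine h6.trans ?_
    rw [Real.volume_real_Icc_of_le hx]
    calc (c2 * (1 + x) ^ (l + 1)) ^ 2 * 2 * (x - x0)
        ≤ (c2 * (1 + x) ^ (l + 1)) ^ 2 * 2 * (1 + x) := by
          gcongr
          linarith
      _ = _ := by ring
  refine ⟨W, UD, c0, 2 * C' + c0 * (2 * c2 ^ 2) / c1, by positivity, by positivity, hWm,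
    fun x hx => ⟨hWd x hx, ?_⟩, ?_, ?_, fun w x hx hw => ⟨hW1 w x hx hw, ?_⟩, ?_⟩
  · exact ((hWd x hx).const_mul _).sub ((differentiable_id.mul (hAd x hx)).div_const _)
  · intro w x
    refine volterraSol_conj (fun t s => ?_) (fun t => (map_one _).symm) x
    by_cases hs : s ∈ Iic t
    · simp only [hK, indicator_of_mem hs, hk0, map_mul, map_neg, Complex.conj_ofReal]
    · simp only [hK, indicator_of_notMem hs, map_zero]
  · intro x hx
    rw [hWeq 0 x hx, hset]
    simp [hk0]
  · have hxn : 0 ≤ x := hx0.trans hx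
    have h1 := norm_sub_le (((deriv u x : ℝ) : ℂ) * W w x) (w * A w x / u x)
    refine h1.trans ?_
    rw [add_mul]
    have hux := hupos x hx
    refine add_le_add ?_ ?_
    · rw [norm_mul, Complex.norm_real, Real.norm_eq_abs]
      calc |deriv u x| * ‖W w x‖ ≤ (C' * (1 + x) ^ l) * 2 :=
            mul_le_mul (hC'd x hx) (hW2 w x hx hw) (norm_nonneg _) (by positivity)
        _ = _ := by ring
    · rw [norm_div, norm_mul, Complex.norm_real, Real.norm_of_nonneg hux.le, div_le_iff₀ hux]
      calc ‖w‖ * ‖A w x‖ ≤ ‖w‖ * (2 * c2 ^ 2 * (1 + x) ^ (2 * l + 3)) := by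
            gcongr
            exact hA1 w x hx hw
        _ = ‖w‖ * (1 + x) ^ 2 * (2 * c2 ^ 2) * (1 + x) ^ (2 * l + 1) := by ring
        _ ≤ c0 * (2 * c2 ^ 2) * (1 + x) ^ (2 * l + 1) := by gcongr
        _ = c0 * (2 * c2 ^ 2) / c1 * (1 + x) ^ l * (c1 * (1 + x) ^ (l + 1)) := by
            field_simp
            ring
        _ ≤ _ := by
            have := hul x hx
            gcongr
  · intro lam U hlam hU hU0 hU1
    obtain ⟨f, hf⟩ := exists_isJostPlus hV hVb hlam
    obtain ⟨B, hB⟩ := hf.exists_norm_le x0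
    set c := wronskian f (fun x => (U x : ℂ)) x0 with hc
    -- Uniqueness needs an a priori bound for `ψ`; it comes from expressing `U` through the Jost
    -- solution, which is bounded on `[x0, ∞)`.
    have hUb : ∀ x, x0 ≤ x → |U x| ≤ ‖c‖ * |B| / lam := by
      intro x hx
      rw [le_div_iff₀ hlam]
      have h1 := hU.eq_im_mul_conj hV hVb hlam hf x x0
      have h2 := Complex.abs_im_le_norm (c * starRingEnd ℂ (f x))
      rw [h1, abs_mul, abs_neg, abs_of_pos hlam, norm_mul, RCLike.norm_conj] at h2
      have h3 : ‖c‖ * ‖f x‖ ≤ ‖c‖ * |B| := by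
        gcongr
        exact (hB x hx).trans (le_abs_self B)
      linarith
    set ψ : ℝ → ℝ := fun x => U (max x0 x) / v x with hψ
    have hψc : Continuous ψ :=
      (hU.continuous.comp (continuous_const.max continuous_id)).div hvc fun x => (hvpos x).ne'
    have hψU : ∀ x, x0 ≤ x → ψ x * u x = U x := by
      intro x hx
      simp only [hψ, hvu x hx, max_eq_right hx]
      exact div_mul_cancel₀ _ (hupos x hx).ne'
    set a : ℝ → ℝ := fun x => ∫ y in x0..x, v y ^ 2 * ψ y with ha
    set b : ℝ → ℝ := fun x => ∫ y in x0..x, v y ^ 2 * J y * ψ y with hb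
    have hac : Continuous fun y => v y ^ 2 * ψ y := (hvc.pow 2).mul hψc
    have hbc : Continuous fun y => v y ^ 2 * J y * ψ y := ((hvc.pow 2).mul hJc).mul hψc
    have had : ∀ x, HasDerivAt a (v x ^ 2 * ψ x) x := fun x =>
      intervalIntegral.integral_hasDerivAt_right (hac.intervalIntegrable _ _)
        (hac.stronglyMeasurableAtFilter _ _) hac.continuousAt
    have hbd : ∀ x, HasDerivAt b (v x ^ 2 * J x * ψ x) x := fun x =>
      intervalIntegral.integral_hasDerivAt_right (hbc.intervalIntegrable _ _)
        (hbc.stronglyMeasurableAtFilter _ _) hbc.continuousAt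
    have hder_eq : ∀ {g h : ℝ → ℝ} {g' : ℝ → ℝ}, (∀ x, x0 ≤ x → HasDerivAt g (g' x) x) →
        (∀ x, x0 ≤ x → HasDerivAt h (g' x) x) → g x0 = h x0 → ∀ x, x0 ≤ x → g x = h x := by
      intro g h g' hg hh h0 x hx
      refine eq_of_has_deriv_right_eq (a := x0) (b := x)
        (fun y hy => (hg y hy.1).hasDerivWithinAt) (fun y hy => (hh y hy.1).hasDerivWithinAt)
        (fun y hy => (hg y hy.1).continuousAt.continuousWithinAt)
        (fun y hy => (hh y hy.1).continuousAt.continuousWithinAt) h0 x (right_mem_Icc.2 hx)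
    have hwr : ∀ x, x0 ≤ x → u x * deriv U x - deriv u x * U x = -lam ^ 2 * a x := by
      refine hder_eq (g' := fun x => -lam ^ 2 * (v x ^ 2 * ψ x)) (fun x hx => ?_)
        (fun x _ => (had x).const_mul _) ?_
      · refine (((hu.hasDerivAt x).mul (hU.hasDerivAt_deriv x)).sub
          ((hu.hasDerivAt_deriv x).mul (hU.hasDerivAt x))).congr_deriv ?_
        simp only [smul_eq_mul, hvu x hx]
        have := hψU x hx
        linear_combination lam ^ 2 * u x * this
      · simp only [ha, intervalIntegral.integral_same, hU0, hU1]
        ring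
    have hψeq : ∀ x, x0 ≤ x → U x / u x = 1 - lam ^ 2 * (J x * a x - b x) := by
      refine hder_eq (g' := fun x => -lam ^ 2 * a x / u x ^ 2) (fun x hx => ?_)
        (fun x hx => ?_) ?_
      · have hne := (hupos x hx).ne'
        refine ((hU.hasDerivAt x).div (hu.hasDerivAt x) hne).congr_deriv ?_
        rw [← hwr x hx]
        ring
      · have hne := (hupos x hx).ne'
        refine (((((hJd x).mul (had x)).sub (hbd x)).const_mul (lam ^ 2)).const_sub 1).congr_deriv
          ?_
        simp only [hvu x hx]
        field_simp
        ring
      · simp only [ha, hb, hJ, intervalIntegral.integral_same, hU0]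
        rw [div_self (hupos x0 le_rfl).ne']
        ring
    have hlam2 : ‖((lam : ℂ) ^ 2)‖ ≤ lam ^ 2 := by
      rw [norm_pow, Complex.norm_real, Real.norm_of_nonneg hlam.le]
    have hψeq' : ∀ x ∈ Ici x0, (ψ x : ℂ) = 1 + ∫ y in Ici x0, K ((lam : ℂ) ^ 2) x y * (ψ y : ℂ) := by
      intro x hx
      have hx' : x0 ≤ x := hx
      rw [hset, integral_Icc_eq_integral_Ioc, ← intervalIntegral.integral_of_le hx']
      have h1 : ψ x = 1 - lam ^ 2 * (J x * a x - b x) := by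
        rw [← hψeq x hx', ← hψU x hx', mul_div_cancel_right₀ _ (hupos x hx').ne']
      have h2 : J x * a x - b x = ∫ y in x0..x, v y ^ 2 * (J x - J y) * ψ y := by
        simp only [ha, hb]
        rw [← intervalIntegral.integral_const_mul, ← intervalIntegral.integral_sub
          ((hac.intervalIntegrable _ _).const_mul _) (hbc.intervalIntegrable _ _)]
        refine intervalIntegral.integral_congr fun y _ => ?_
        ring
      rw [h1, h2]
      push_cast
      rw [← intervalIntegral.integral_ofReal, ← intervalIntegral.integral_const_mul, sub_eq_add_neg,
        ← intervalIntegral.integral_neg]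
      congr 1
      refine intervalIntegral.integral_congr fun y _ => ?_
      simp only [hk0]
      push_cast
      ring
    have hfin : ∀ x, x0 ≤ x → (ψ x : ℂ) = W ((lam : ℂ) ^ 2) x := fun x hx =>
      (hwt (lam ^ 2)).unique (hKm _) measurable_const (hKb _ _ hlam2)
        (hφb _ (sq_nonneg _)) (ψ := fun x => (ψ x : ℂ)) (B := ‖c‖ * |B| / lam / c1)
        (Complex.continuous_ofReal.comp hψc).measurable
        (fun s hs => by
          have hs' : x0 ≤ s := hs
          have hsn : 0 ≤ s := hx0.trans hs'
          rw [Complex.norm_real, Real.norm_eq_abs]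
          have h1 : |ψ s| ≤ ‖c‖ * |B| / lam / c1 := by
            rw [le_div_iff₀ hc1]
            have h2 := hUb s hs'
            rw [← hψU s hs', abs_mul, abs_of_pos (hupos s hs')] at h2
            refine le_trans ?_ h2
            have h3 : c1 ≤ u s := by
              refine le_trans ?_ (hul s hs')
              exact le_mul_of_one_le_right hc1.le (one_le_pow₀ (by linarith))
            gcongr
          refine h1.trans (le_mul_of_one_le_right (by positivity) (Real.one_le_exp (by positivity))))
        hψeq' x hx
    intro x hx
    have hne : (u x : ℂ) ≠ 0 := by exact_mod_cast (hupos x hx).ne'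
    have hUW : (U x : ℂ) = u x * W ((lam : ℂ) ^ 2) x := by
      rw [← hfin x hx, ← hψU x hx]
      push_cast
      ring
    refine ⟨hUW, ?_⟩
    have hAx : A ((lam : ℂ) ^ 2) x = (a x : ℂ) := by
      simp only [hA, ha]
      rw [integral_Icc_eq_integral_Ioc, ← intervalIntegral.integral_of_le hx,
        ← intervalIntegral.integral_ofReal]
      refine intervalIntegral.integral_congr fun y hy => ?_
      rw [uIcc_of_le hx] at hy
      rw [← hfin y hy.1]
      push_cast
      ring
    have h1 : (u x : ℂ) * ((deriv U x : ℝ) : ℂ) - ((deriv u x : ℝ) : ℂ) * U x = -lam ^ 2 * a x := by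
      exact_mod_cast hwr x hx
    simp only [hUD, hAx]
    rw [hUW] at h1
    field_simp
    linear_combination h1

end Energy

end ReggeWheeler

namespace ReggeWheeler
open MeasureTheory

/-! ## Expansion of parameter integrals with shrinking domains of holomorphy -/

section Expansion

theorem integral_Ioi_inv_one_add_sq {X : ℝ} (hX : 0 ≤ X) :
    IntegrableOn (fun y : ℝ => ((1 + y) ^ 2)⁻¹) (Ioi X) ∧
      ∫ y in Ioi X, ((1 + y) ^ 2)⁻¹ = (1 + X)⁻¹ := by
  have hd : ∀ y ∈ Ici X, HasDerivAt (fun y : ℝ => -(1 + y)⁻¹) ((1 + y) ^ 2)⁻¹ y := by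
    intro y hy
    have : 0 < 1 + y := by linarith [mem_Ici.1 hy]
    refine ((((hasDerivAt_id y).const_add 1).inv this.ne').neg).congr_deriv ?_
    simp only [id]
    field_simp
  have hn : ∀ y ∈ Ioi X, 0 ≤ ((1 + y) ^ 2)⁻¹ := fun y _ => by positivity
  have hl : Tendsto (fun y : ℝ => -(1 + y)⁻¹) atTop (𝓝 0) := by
    have := (tendsto_atTop_add_const_left atTop (1 : ℝ) tendsto_id).inv_tendsto_atTop.neg
    simpa using this
  refine ⟨integrableOn_Ioi_deriv_of_nonneg' hd hn hl, ?_⟩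
  rw [integral_Ioi_of_hasDerivAt_of_nonneg' hd hn hl]
  ring

theorem norm_integral_Ioi_le_of_decay {X B : ℝ} {n : ℕ} {h : ℝ → ℂ} (hX : 0 ≤ X)
    (hm : AEStronglyMeasurable h (volume.restrict (Ioi X)))
    (hb : ∀ y, X ≤ y → ‖h y‖ * (1 + y) ^ (2 * (n + 1)) ≤ B) :
    IntegrableOn h (Ioi X) ∧ ‖∫ y in Ioi X, h y‖ * (1 + X) ^ (2 * (n + 1)) ≤ B * (1 + X) := by
  obtain ⟨hi, he⟩ := integral_Ioi_inv_one_add_sq hX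
  have hB : 0 ≤ B := le_trans (by positivity) (hb X le_rfl)
  have hle : ∀ y ∈ Ioi X, ‖h y‖ ≤ B * ((1 + X) ^ (2 * n))⁻¹ * ((1 + y) ^ 2)⁻¹ := by
    intro y hy
    have hy' : X < y := hy
    have h1 := hb y hy'.le
    have h2 : 0 < 1 + y := by linarith
    rw [mul_assoc, ← mul_inv, ← div_eq_mul_inv, le_div_iff₀ (by positivity)]
    refine le_trans ?_ h1
    rw [mul_add, pow_add]
    gcongr
  have hint : IntegrableOn h (Ioi X) := by
    refine (hi.const_mul (B * ((1 + X) ^ (2 * n))⁻¹)).mono' hm ?_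
    filter_upwards [ae_restrict_mem measurableSet_Ioi] with y hy using hle y hy
  refine ⟨hint, ?_⟩
  have h3 : ‖∫ y in Ioi X, h y‖ ≤ B * ((1 + X) ^ (2 * n))⁻¹ * (1 + X)⁻¹ := by
    rw [← he, ← integral_const_mul]
    refine norm_integral_le_of_norm_le (hi.const_mul _) ?_
    filter_upwards [ae_restrict_mem measurableSet_Ioi] with y hy using hle y hy
  have h4 : 0 < 1 + X := by linarith
  calc _ ≤ B * ((1 + X) ^ (2 * n))⁻¹ * (1 + X)⁻¹ * (1 + X) ^ (2 * (n + 1)) := by gcongr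
    _ = B * (1 + X) := by
      rw [mul_add, pow_add]
      field_simp

/-- Split `b w = b 0 + w b₁`. The integral of `b 0` up to `X` is a constant minus a tail of size
`(1+X)^{1-2n}`. By the Schwarz lemma the divided difference `b₁` decays by two powers less, so
induction applies to it, and the factor `‖w‖ ≤ c (1+X)⁻²` restores these two powers. The function
`P` produced this way is a polynomial of degree less than `n`, but only its differentiability is
needed. -/
theorem exists_entire_approximation {x0 c : ℝ} (hx0 : 0 ≤ x0) (hc : 0 < c) (n : ℕ) :
    ∀ (b : ℂ → ℝ → ℂ) (B : ℝ),
      (∀ w, AEStronglyMeasurable (b w) (volume.restrict (Ici x0))) →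
      (∀ y, x0 ≤ y →
        DifferentiableOn ℂ (fun w => b w y) (Metric.ball 0 (c / (1 + y) ^ 2))) →
      (∀ y, x0 ≤ y → ∀ w ∈ Metric.ball (0 : ℂ) (c / (1 + y) ^ 2),
        ‖b w y‖ * (1 + y) ^ (2 * n) ≤ B) →
      ∃ (P : ℂ → ℂ) (C : ℝ), 0 ≤ C ∧ Differentiable ℂ P ∧ ∀ X, x0 ≤ X →
        ∀ w ∈ Metric.ball (0 : ℂ) (c / (1 + X) ^ 2),
          ‖(∫ y in x0..X, b w y) - P w‖ * (1 + X) ^ (2 * n) ≤ C * (1 + X) := by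
  have hball : ∀ {y X : ℝ} {w : ℂ}, x0 ≤ y → y ≤ X → w ∈ Metric.ball (0 : ℂ) (c / (1 + X) ^ 2) →
      w ∈ Metric.ball (0 : ℂ) (c / (1 + y) ^ 2) := by
    intro y X w hy hyX hw
    refine Metric.ball_subset_ball ?_ hw
    have : 0 ≤ y := hx0.trans hy
    gcongr
  induction n with
  | zero =>
    intro b B _ _ hb
    have hB : 0 ≤ B := le_trans (by positivity) (hb x0 le_rfl 0 (Metric.mem_ball_self (by positivity)))
    refine ⟨fun _ => 0, B, hB, differentiable_const _, fun X hX w hw => ?_⟩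
    rw [sub_zero, mul_zero, pow_zero, mul_one]
    have := intervalIntegral.norm_integral_le_of_norm_le_const (a := x0) (b := X) (C := B)
      (f := b w) (fun y hy => by
        rw [uIoc_of_le hX] at hy
        have := hb y hy.1.le w (hball hy.1.le hy.2 hw)
        simpa using this)
    refine this.trans ?_
    rw [abs_of_nonneg (by linarith)]
    gcongr
    linarith
  | succ n ih =>
    intro b B hm hd hb
    have hB : 0 ≤ B := le_trans (by positivity) (hb x0 le_rfl 0 (Metric.mem_ball_self (by positivity)))
    set b1 : ℂ → ℝ → ℂ := fun w y => dslope (fun w => b w y) 0 w with hb1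
    have hnhds : ∀ y, x0 ≤ y → Metric.ball (0 : ℂ) (c / (1 + y) ^ 2) ∈ 𝓝 0 := fun y hy => by
      have : 0 ≤ y := hx0.trans hy
      exact Metric.ball_mem_nhds _ (by positivity)
    have hslope : ∀ w, w ≠ 0 → b1 w = fun y => w⁻¹ * (b w y - b 0 y) := by
      intro w hw
      ext y
      simp only [hb1]
      rw [dslope_of_ne _ hw, slope_def_module, sub_zero, smul_eq_mul]
    have hm1' : ∀ w, w ≠ 0 → AEStronglyMeasurable (b1 w) (volume.restrict (Ici x0)) := by
      intro w hw
      rw [hslope w hw]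
      exact ((hm w).sub (hm 0)).const_mul _
    have hm1 : ∀ w, AEStronglyMeasurable (b1 w) (volume.restrict (Ici x0)) := by
      intro w
      by_cases hw : w = 0
      -- At `w = 0` the divided difference is a derivative; it is measurable as the limit of its
      -- values at `1/(k+1)`.
      · have hlim : Tendsto (fun k : ℕ => (1 / ((k : ℂ) + 1))) atTop (𝓝[≠] 0) := by
          refine tendsto_nhdsWithin_iff.2 ⟨?_, Eventually.of_forall fun k => ?_⟩
          · have := (Complex.continuous_ofReal.tendsto 0).comp
              (tendsto_one_div_add_atTop_nhds_zero_nat (𝕜 := ℝ))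
            simpa [Function.comp_def] using this
          · exact one_div_ne_zero (Nat.cast_add_one_ne_zero k)
        refine aestronglyMeasurable_of_tendsto_ae atTop
          (f := fun k : ℕ => b1 (1 / ((k : ℂ) + 1)))
          (fun k => hm1' _ (one_div_ne_zero (Nat.cast_add_one_ne_zero k))) ?_
        filter_upwards [ae_restrict_mem measurableSet_Ici] with y hy
        have h1 : DifferentiableAt ℂ (fun w => b w y) 0 := (hd y hy).differentiableAt (hnhds y hy)
        have h2 := (continuousAt_dslope_same.2 h1).tendsto
        rw [hw]
        exact (h2.mono_left nhdsWithin_le_nhds).comp hlim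
      · exact hm1' w hw
    have hb1b : ∀ y, x0 ≤ y → ∀ w ∈ Metric.ball (0 : ℂ) (c / (1 + y) ^ 2),
        ‖b1 w y‖ * (1 + y) ^ (2 * n) ≤ 2 * B / c := by
      intro y hy w hw
      have hy0 : 0 < 1 + y := by linarith
      have h0 : (0 : ℂ) ∈ Metric.ball (0 : ℂ) (c / (1 + y) ^ 2) :=
        Metric.mem_ball_self (by positivity)
      have hbd : ∀ w ∈ Metric.ball (0 : ℂ) (c / (1 + y) ^ 2),
          ‖b w y‖ ≤ B / (1 + y) ^ (2 * (n + 1)) := fun w hw => by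
        rw [le_div_iff₀ (by positivity)]
        exact hb y hy w hw
      have h1 := Complex.norm_dslope_le_div_of_mapsTo_ball (f := fun w => b w y)
        (R₂ := 2 * (B / (1 + y) ^ (2 * (n + 1)))) (hd y hy) (fun z hz => by
          rw [mem_closedBall_iff_norm]
          have := norm_sub_le (b z y) (b 0 y)
          have h2 := hbd z hz
          have h3 := hbd 0 h0
          linarith) hw
      calc ‖b1 w y‖ * (1 + y) ^ (2 * n)
          ≤ 2 * (B / (1 + y) ^ (2 * (n + 1))) / (c / (1 + y) ^ 2) * (1 + y) ^ (2 * n) := by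
            gcongr
        _ = 2 * B / c := by
            rw [mul_add, pow_add]
            field_simp
    obtain ⟨P1, C1, hC1, hP1, hP1b⟩ := ih b1 (2 * B / c) hm1
      (fun y hy => (Complex.differentiableOn_dslope (hnhds y hy)).2 (hd y hy)) hb1b
    have h0b : ∀ y, x0 ≤ y → (0 : ℂ) ∈ Metric.ball (0 : ℂ) (c / (1 + y) ^ 2) := fun y hy => by
      have : 0 ≤ y := hx0.trans hy
      exact Metric.mem_ball_self (by positivity)
    have htail : ∀ X, x0 ≤ X → IntegrableOn (b 0) (Ioi X) ∧
        ‖∫ y in Ioi X, b 0 y‖ * (1 + X) ^ (2 * (n + 1)) ≤ B * (1 + X) := fun X hX =>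
      norm_integral_Ioi_le_of_decay (hx0.trans hX)
        ((hm 0).mono_measure (Measure.restrict_mono (fun y hy => hX.trans (le_of_lt hy)) le_rfl))
        fun y hy => hb y (hX.trans hy) 0 (h0b y (hX.trans hy))
    refine ⟨fun w => (∫ y in Ioi x0, b 0 y) + w * P1 w, B + c * C1, by positivity,
      (differentiable_const _).add (differentiable_id.mul hP1), fun X hX w hw => ?_⟩
    have hX0 : 0 < 1 + X := by linarith
    have hint1 : IntervalIntegrable (b1 w) volume x0 X := by
      rw [intervalIntegrable_iff_integrableOn_Ioc_of_le hX]
      refine (integrable_const (2 * B / c)).mono'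
        ((hm1 w).mono_set fun y (hy : y ∈ Ioc x0 X) => hy.1.le) ?_
      filter_upwards [ae_restrict_mem measurableSet_Ioc] with y hy
      refine le_trans ?_ (hb1b y hy.1.le w (hball hy.1.le hy.2 hw))
      exact le_mul_of_one_le_right (norm_nonneg _) (one_le_pow₀ (by linarith [hy.1]))
    have hint0 : IntervalIntegrable (b 0) volume x0 X := by
      rw [intervalIntegrable_iff_integrableOn_Ioc_of_le hX]
      exact (htail x0 le_rfl).1.mono_set Ioc_subset_Ioi_self
    have hsplit : ∫ y in x0..X, b w y = (∫ y in x0..X, b 0 y) + w * ∫ y in x0..X, b1 w y := by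
      rw [← intervalIntegral.integral_const_mul, ← intervalIntegral.integral_add hint0
        (hint1.const_mul w)]
      refine intervalIntegral.integral_congr fun y _ => ?_
      have := sub_smul_dslope (fun w => b w y) 0 w
      simp only [sub_zero, smul_eq_mul] at this
      simp only [hb1, this]
      ring
    have hI : (∫ y in Ioi x0, b 0 y) = (∫ y in x0..X, b 0 y) + ∫ y in Ioi X, b 0 y :=
      (intervalIntegral.integral_interval_add_Ioi (htail x0 le_rfl).1 (htail X hX).1).symm
    have hdiff : (∫ y in x0..X, b w y) - ((∫ y in Ioi x0, b 0 y) + w * P1 w)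
        = -(∫ y in Ioi X, b 0 y) + w * ((∫ y in x0..X, b1 w y) - P1 w) := by
      rw [hsplit, hI]
      ring
    simp only [hdiff]
    have h1 := norm_add_le (-(∫ y in Ioi X, b 0 y)) (w * ((∫ y in x0..X, b1 w y) - P1 w))
    rw [norm_neg, norm_mul] at h1
    have h2 := hP1b X hX w hw
    have h3 : ‖w‖ * (1 + X) ^ 2 ≤ c := by
      rw [mem_ball_zero_iff, lt_div_iff₀ (by positivity)] at hw
      exact hw.le
    calc _ ≤ (‖∫ y in Ioi X, b 0 y‖ + ‖w‖ * ‖(∫ y in x0..X, b1 w y) - P1 w‖)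
            * (1 + X) ^ (2 * (n + 1)) := by gcongr
      _ = ‖∫ y in Ioi X, b 0 y‖ * (1 + X) ^ (2 * (n + 1)) + (‖w‖ * (1 + X) ^ 2)
            * (‖(∫ y in x0..X, b1 w y) - P1 w‖ * (1 + X) ^ (2 * n)) := by
          rw [mul_add 2 n 1, pow_add]
          ring
      _ ≤ B * (1 + X) + c * (C1 * (1 + X)) := by
          exact add_le_add (htail X hX).2 (mul_le_mul h3 h2 (by positivity) hc.le)
      _ = _ := by ring

/-- Expansion of `∫_{x0}^X u(y)⁻² W(w, y)⁻² dy`, uniformly in `X` for `w = O(X⁻²)`. -/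
theorem exists_inv_sq_expansion {u : ℝ → ℝ} {W : ℂ → ℝ → ℂ} {x0 c0 c1 : ℝ} {l : ℕ}
    (hu : Continuous u) (hx0 : 0 ≤ x0) (hc0 : 0 < c0) (hc1 : 0 < c1)
    (hul : ∀ x, x0 ≤ x → c1 * (1 + x) ^ (l + 1) ≤ u x)
    (hWm : ∀ w, Measurable (W w)) (hWd : ∀ x, x0 ≤ x → Differentiable ℂ (fun w => W w x))
    (hWc : ∀ w x, W (starRingEnd ℂ w) x = starRingEnd ℂ (W w x))
    (hW0 : ∀ x, x0 ≤ x → W 0 x = 1)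
    (hWb : ∀ w x, x0 ≤ x → ‖w‖ * (1 + x) ^ 2 ≤ c0 → ‖W w x - 1‖ ≤ 1 / 2) :
    ∃ (P : ℂ → ℂ) (C : ℝ), 0 ≤ C ∧ Differentiable ℂ P ∧
      (∀ w, P (starRingEnd ℂ w) = starRingEnd ℂ (P w)) ∧
      P 0 = ((∫ y in Ioi x0, (u y ^ 2)⁻¹ : ℝ) : ℂ) ∧
      ∀ X, x0 ≤ X →
        DifferentiableOn ℂ (fun w => ∫ y in x0..X, ((u y * W w y) ^ 2)⁻¹)
          (Metric.ball 0 (c0 / (1 + X) ^ 2)) ∧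
        ∀ w ∈ Metric.ball (0 : ℂ) (c0 / (1 + X) ^ 2),
          ‖(∫ y in x0..X, ((u y * W w y) ^ 2)⁻¹) - P w‖ * (1 + X) ^ (2 * l + 1) ≤ C := by
  have hupos : ∀ x, x0 ≤ x → 0 < u x := fun x hx =>
    lt_of_lt_of_le (by have : 0 ≤ x := hx0.trans hx; positivity) (hul x hx)
  set b : ℂ → ℝ → ℂ := fun w y => ((u y * W w y) ^ 2)⁻¹ with hb
  have hWlow : ∀ y, x0 ≤ y → ∀ w ∈ Metric.ball (0 : ℂ) (c0 / (1 + y) ^ 2), 1 / 2 ≤ ‖W w y‖ := by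
    intro y hy w hw
    have hy0 : 0 < 1 + y := by linarith
    rw [mem_ball_zero_iff, lt_div_iff₀ (by positivity)] at hw
    have h1 := hWb w y hy hw.le
    have h2 := norm_sub_norm_le 1 (1 - W w y)
    rw [sub_sub_cancel, norm_one, norm_sub_rev] at h2
    linarith
  have hbm : ∀ w, Measurable (b w) := fun w =>
    (((Complex.continuous_ofReal.comp hu).measurable.mul (hWm w)).pow_const 2).inv
  have hbd : ∀ y, x0 ≤ y →
      DifferentiableOn ℂ (fun w => b w y) (Metric.ball 0 (c0 / (1 + y) ^ 2)) := by
    intro y hy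
    refine (((hWd y hy).const_mul _).pow 2).differentiableOn.inv fun w hw => ?_
    have h1 : 0 < ‖W w y‖ := lt_of_lt_of_le (by norm_num) (hWlow y hy w hw)
    have h2 : (u y : ℂ) ≠ 0 := by exact_mod_cast (hupos y hy).ne'
    exact pow_ne_zero 2 (mul_ne_zero h2 (norm_pos_iff.1 h1))
  have hbb : ∀ y, x0 ≤ y → ∀ w ∈ Metric.ball (0 : ℂ) (c0 / (1 + y) ^ 2),
      ‖b w y‖ * (1 + y) ^ (2 * (l + 1)) ≤ 4 / c1 ^ 2 := by
    intro y hy w hw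
    have hy0 : 0 < 1 + y := by linarith
    have h1 := hWlow y hy w hw
    have h2 := hul y hy
    have h3 : c1 * (1 + y) ^ (l + 1) * (1 / 2) ≤ ‖(u y : ℂ) * W w y‖ := by
      rw [norm_mul, Complex.norm_real, Real.norm_of_nonneg (hupos y hy).le]
      have := (hupos y hy).le
      gcongr
    simp only [hb]
    rw [norm_inv, norm_pow, inv_mul_le_iff₀ (by
      refine pow_pos (lt_of_lt_of_le ?_ h3) 2
      positivity), ← mul_div_assoc, le_div_iff₀ (by positivity)]
    calc (1 + y) ^ (2 * (l + 1)) * c1 ^ 2 = (c1 * (1 + y) ^ (l + 1) * (1 / 2)) ^ 2 * 4 := by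
          rw [pow_mul']
          ring
      _ ≤ _ := by gcongr
  -- Applied with `n = l + 1` because `u⁻²` decays like `(1+y)^{-2(l+1)}`; the resulting error is of
  -- size `(1+X)^{-(2l+1)}`.
  obtain ⟨P, C, hC, hPd, hP⟩ := exists_entire_approximation hx0 hc0 (l + 1) b (4 / c1 ^ 2)
    (fun w => (hbm w).aestronglyMeasurable) hbd hbb
  have hP' : ∀ X, x0 ≤ X → ∀ w ∈ Metric.ball (0 : ℂ) (c0 / (1 + X) ^ 2),
      ‖(∫ y in x0..X, b w y) - P w‖ * (1 + X) ^ (2 * l + 1) ≤ C := by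
    intro X hX w hw
    have hX0 : 0 < 1 + X := by linarith
    refine le_of_mul_le_mul_right ?_ hX0
    refine le_trans (le_of_eq ?_) (hP X hX w hw)
    ring
  have hconjmem : ∀ {w : ℂ} {r : ℝ}, w ∈ Metric.ball (0 : ℂ) r →
      starRingEnd ℂ w ∈ Metric.ball (0 : ℂ) r := by
    intro w r hw
    rwa [mem_ball_zero_iff, RCLike.norm_conj, ← mem_ball_zero_iff]
  have hbc : ∀ w X, ∫ y in x0..X, b (starRingEnd ℂ w) y
      = starRingEnd ℂ (∫ y in x0..X, b w y) := by
    intro w X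
    rw [intervalIntegral, intervalIntegral, map_sub, ← integral_conj, ← integral_conj]
    simp only [hb, hWc, map_inv₀, map_pow, map_mul, Complex.conj_ofReal]
  have hint0 : IntegrableOn (fun y => (u y ^ 2)⁻¹) (Ioi x0) := by
    have h0 : ∀ y, x0 ≤ y → (0 : ℂ) ∈ Metric.ball (0 : ℂ) (c0 / (1 + y) ^ 2) := fun y hy => by
      have : 0 ≤ y := hx0.trans hy
      exact Metric.mem_ball_self (by positivity)
    have h1 := (norm_integral_Ioi_le_of_decay (n := l) hx0 (hbm 0).aestronglyMeasurable
      fun y hy => hbb y hy 0 (h0 y hy)).1.re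
    refine h1.congr ?_
    filter_upwards [ae_restrict_mem measurableSet_Ioi] with y hy
    simp only [hb]
    rw [hW0 y (le_of_lt hy), mul_one, ← Complex.ofReal_pow, ← Complex.ofReal_inv]
    exact Complex.ofReal_re _
  have hP0 : P 0 = ((∫ y in Ioi x0, (u y ^ 2)⁻¹ : ℝ) : ℂ) := by
    have h1 : Tendsto (fun X => ((∫ y in x0..X, (u y ^ 2)⁻¹ : ℝ) : ℂ)) atTop
        (𝓝 ((∫ y in Ioi x0, (u y ^ 2)⁻¹ : ℝ) : ℂ)) :=
      (Complex.continuous_ofReal.tendsto _).comp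
        (intervalIntegral_tendsto_integral_Ioi x0 hint0 tendsto_id)
    refine tendsto_nhds_unique ?_ h1
    have h2 : Tendsto (fun X : ℝ => C * (1 + X)⁻¹) atTop (𝓝 0) := by
      have := (tendsto_atTop_add_const_left atTop (1 : ℝ) tendsto_id).inv_tendsto_atTop.const_mul C
      simpa using this
    refine tendsto_iff_norm_sub_tendsto_zero.2 ?_
    refine squeeze_zero' (Eventually.of_forall fun _ => norm_nonneg _) ?_ h2
    filter_upwards [eventually_ge_atTop x0] with X hX
    have hX0 : 0 < 1 + X := by linarith
    have h3 := hP' X hX 0 (Metric.mem_ball_self (by positivity))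
    have h4 : (∫ y in x0..X, b 0 y) = ((∫ y in x0..X, (u y ^ 2)⁻¹ : ℝ) : ℂ) := by
      rw [← intervalIntegral.integral_ofReal]
      refine intervalIntegral.integral_congr fun y hy => ?_
      rw [uIcc_of_le hX] at hy
      simp only [hb]
      rw [hW0 y hy.1, mul_one, ← Complex.ofReal_pow, ← Complex.ofReal_inv]
    rw [h4] at h3
    rw [← div_eq_mul_inv, le_div_iff₀ hX0]
    refine le_trans ?_ h3
    exact mul_le_mul_of_nonneg_left (show 1 + X ≤ (1 + X) ^ (2 * l + 1) from
      le_self_pow₀ (by linarith) (by omega)) (norm_nonneg _)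
  -- Averaging with the reflected conjugate makes `P` real on the real axis. The error bound
  -- persists because the integral itself has this symmetry.
  refine ⟨fun w => (P w + starRingEnd ℂ (P (starRingEnd ℂ w))) / 2, C, hC, ?_, fun w => ?_, ?_,
    fun X hX => ⟨?_, fun w hw => ?_⟩⟩
  · exact (hPd.add fun w => by
      simpa [Function.comp_def] using (hPd (starRingEnd ℂ w)).conj_conj).div_const 2
  · simp only [Complex.conj_conj, map_div₀, map_add, Complex.conj_ofNat]
    ring
  · simp only [map_zero, hP0, Complex.conj_ofReal]
    ring
  · have hX0 : 0 < 1 + X := by linarith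
    simp only [intervalIntegral.integral_of_le hX]
    have hsub : ∀ y ∈ Ioc x0 X, Metric.ball (0 : ℂ) (c0 / (1 + X) ^ 2)
        ⊆ Metric.ball (0 : ℂ) (c0 / (1 + y) ^ 2) := by
      intro y hy
      refine Metric.ball_subset_ball ?_
      have h1 : 0 < 1 + y := by linarith [hy.1]
      have := hy.2
      gcongr
    refine differentiableOn_integral_of_dominated (g := fun _ => 4 / c1 ^ 2) Metric.isOpen_ball
      (fun w _ => (hbm w).aestronglyMeasurable) (integrable_const _) ?_ ?_
    · refine (ae_restrict_mem measurableSet_Ioc).mono fun y hy w hw => ?_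
      refine le_trans ?_ (hbb y hy.1.le w (hsub y hy hw))
      exact le_mul_of_one_le_right (norm_nonneg _) (one_le_pow₀ (by linarith [hy.1]))
    · exact (ae_restrict_mem measurableSet_Ioc).mono fun y hy => (hbd y hy.1.le).mono (hsub y hy)
  · have hX0 : 0 < 1 + X := by linarith
    have h1 := hP' X hX w hw
    have h2 := hP' X hX _ (hconjmem hw)
    rw [hbc, ← RCLike.norm_conj, map_sub, Complex.conj_conj] at h2
    have h3 : (∫ y in x0..X, b w y) - (P w + starRingEnd ℂ (P (starRingEnd ℂ w))) / 2
        = (((∫ y in x0..X, b w y) - P w) +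
          ((∫ y in x0..X, b w y) - starRingEnd ℂ (P (starRingEnd ℂ w)))) / 2 := by ring
    rw [h3, norm_div, Complex.norm_ofNat]
    have h4 := norm_add_le ((∫ y in x0..X, b w y) - P w)
      ((∫ y in x0..X, b w y) - starRingEnd ℂ (P (starRingEnd ℂ w)))
    have h5 := mul_le_mul_of_nonneg_right h4 (pow_nonneg hX0.le (2 * l + 1))
    linarith

end Expansion

end ReggeWheeler

namespace ReggeWheeler
open MeasureTheory

/-! ## Low energy behaviour of the connection coefficients -/

/-- The properties of the Regge-Wheeler potential that the low energy analysis uses. -/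
structure IsAdmissible (V : ℝ → ℝ) : Prop where
  continuous : Continuous V
  pos : ∀ x, 0 < V x
  decay : ∃ D : ℝ, ∀ x, |V x| ≤ D / (1 + x ^ 2)
  exp_decay : ∃ C b : ℝ, 0 < b ∧ ∀ x, |V x| ≤ C * Real.exp (b * x)
  complex : ∃ (Vc : ℂ → ℂ) (R C : ℝ), 0 < C ∧ DifferentiableOn ℂ Vc (sector R) ∧
    (∀ z ∈ sector R, ‖Vc z‖ ≤ C / ‖z‖ ^ 2) ∧ ∀ x : ℝ, R < x → Vc x = V x

theorem isAdmissible_potential {M : ℝ} (hM : 0 < M) {l : ℕ} {σ : ℝ}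
    (hσ : σ = -3 ∨ σ = 0 ∨ σ = 1)
    (hne : ¬(l = 0 ∧ σ = 0) ∧ ¬(l = 0 ∧ σ = -3) ∧ ¬(l = 1 ∧ σ = -3)) :
    IsAdmissible (potential M l σ) := by
  have hpos := potential_pos hM hσ hne
  obtain ⟨C, _, h1, h2⟩ := exists_potential_le hM l σ
  obtain ⟨Vc, R, C', _, hC', h3, h4, h5⟩ := exists_complex_potential hM l σ
  refine ⟨continuous_potential hM l σ, hpos, ⟨C, fun x => ?_⟩,
    ⟨C, 1 / (2 * M), by positivity, fun x => ?_⟩, ⟨Vc, R, C', hC', h3, h4, h5⟩⟩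
  · rw [abs_of_pos (hpos x)]
    exact h1 x
  · rw [abs_of_pos (hpos x), one_div_mul_eq_div]
    exact h2 x

section Quotient

variable {V : ℝ → ℝ} {E : ℝ} {U : ℝ → ℝ} {f : ℝ → ℂ}

theorem wronskian_ofReal (hV : Continuous V) (hU : IsSolution V E U) (x : ℝ) :
    wronskian f (fun x => (U x : ℂ)) x = f x * ((deriv U x : ℝ) : ℂ) - deriv f x * U x := by
  rw [wronskian, (hU.ofReal hV).2]

/-- The derivative of `f/U` is `-W(f, U)/U²`, with constant Wronskian. -/
theorem quotient_sub_eq (hV : Continuous V) (hf : IsSolution V E f) (hU : IsSolution V E U)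
    {a b : ℝ} (hab : a ≤ b) (hne : ∀ x ∈ Icc a b, U x ≠ 0) (y : ℝ) :
    f b / U b - f a / U a
      = -(wronskian f (fun x => (U x : ℂ)) y) * ∫ x in a..b, ((U x : ℂ) ^ 2)⁻¹ := by
  have hd : ∀ x ∈ uIcc a b, HasDerivAt (fun x => f x / (U x : ℂ))
      (-(wronskian f (fun x => (U x : ℂ)) y) * ((U x : ℂ) ^ 2)⁻¹) x := by
    intro x hx
    rw [uIcc_of_le hab] at hx
    have h0 : (U x : ℂ) ≠ 0 := by exact_mod_cast hne x hx
    refine ((hf.hasDerivAt x).div (hU.hasDerivAt x).ofReal_comp h0).congr_deriv ?_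
    rw [wronskian_const hf (hU.ofReal hV).1 y x, wronskian_ofReal hV hU]
    field_simp
    ring
  have hint : IntervalIntegrable (fun x => -(wronskian f (fun x => (U x : ℂ)) y)
      * ((U x : ℂ) ^ 2)⁻¹) volume a b := by
    refine ContinuousOn.intervalIntegrable ?_
    rw [uIcc_of_le hab]
    refine continuousOn_const.mul (ContinuousOn.inv₀
      ((Complex.continuous_ofReal.comp hU.continuous).pow 2).continuousOn fun x hx => ?_)
    have h0 : (U x : ℂ) ≠ 0 := by exact_mod_cast hne x hx
    exact pow_ne_zero 2 h0
  rw [← intervalIntegral.integral_const_mul,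
    intervalIntegral.integral_eq_sub_of_hasDerivAt hd hint]

end Quotient

theorem exists_two_sided_bound {u : ℝ → ℝ} {l : ℕ} {x0 : ℝ} (hu : Continuous u) (hx0 : 0 ≤ x0)
    (hpos : ∀ x, x0 ≤ x → 0 < u x)
    (hlim : Tendsto (fun x : ℝ => u x / (x ^ (l + 1) / (2 * (l : ℝ) + 1))) atTop (𝓝 1)) :
    ∃ c1 c2 : ℝ, 0 < c1 ∧ (∀ x, x0 ≤ x → c1 * (1 + x) ^ (l + 1) ≤ u x) ∧
      ∀ x, x0 ≤ x → u x ≤ c2 * (1 + x) ^ (l + 1) := by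
  set g : ℝ → ℝ := fun x => u x / (1 + x) ^ (l + 1) with hg
  have hL : (0 : ℝ) < 2 * (l : ℝ) + 1 := by positivity
  have hg_lim : Tendsto g atTop (𝓝 (1 / (2 * (l : ℝ) + 1))) := by
    have h1 : Tendsto (fun x : ℝ => x / (1 + x)) atTop (𝓝 1) := by
      have h2 := (tendsto_atTop_add_const_left atTop (1 : ℝ) tendsto_id).inv_tendsto_atTop.const_sub 1
      rw [sub_zero] at h2
      refine h2.congr' ?_
      filter_upwards [eventually_ge_atTop 0] with x hx
      have : 0 < 1 + x := by linarith
      simp only [Pi.inv_apply, id]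
      field_simp
      ring
    have h3 := (hlim.mul (h1.pow (l + 1))).div_const (2 * (l : ℝ) + 1)
    rw [one_pow, one_mul] at h3
    refine h3.congr' ?_
    filter_upwards [eventually_gt_atTop 0] with x hx
    have : 0 < 1 + x := by linarith
    simp only [hg, div_pow]
    field_simp
  have hlow : ∀ᶠ x in atTop, 1 / (2 * (l : ℝ) + 1) / 2 < g x :=
    hg_lim.eventually (lt_mem_nhds (half_lt_self (by positivity)))
  have hup : ∀ᶠ x in atTop, g x < 1 / (2 * (l : ℝ) + 1) + 1 :=
    hg_lim.eventually (gt_mem_nhds (by linarith))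
  obtain ⟨X, hX⟩ := eventually_atTop.1 (hlow.and hup)
  have hgc : ContinuousOn g (Icc x0 (max x0 X)) := by
    refine hu.continuousOn.div (by fun_prop) fun x hx => ?_
    have : 0 < 1 + x := by linarith [hx.1]
    positivity
  have hgpos : ∀ x, x0 ≤ x → 0 < g x := fun x hx => by
    have h1 : 0 < 1 + x := by linarith
    have h2 := hpos x hx
    simp only [hg]
    positivity
  have hne : (Icc x0 (max x0 X)).Nonempty := ⟨x0, le_rfl, le_max_left _ _⟩
  obtain ⟨p, hp, hpm⟩ := isCompact_Icc.exists_isMinOn hne hgc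
  obtain ⟨q, hq, hqm⟩ := isCompact_Icc.exists_isMaxOn hne hgc
  refine ⟨min (g p) (1 / (2 * (l : ℝ) + 1) / 2), max (g q) (1 / (2 * (l : ℝ) + 1) + 1),
    lt_min (hgpos p hp.1) (by positivity), fun x hx => ?_, fun x hx => ?_⟩
  all_goals
    have h1 : 0 < 1 + x := by linarith
  · rw [← le_div_iff₀ (by positivity)]
    by_cases hxX : x ≤ max x0 X
    · exact (min_le_left _ _).trans (hpm ⟨hx, hxX⟩)
    · exact (min_le_right _ _).trans
        (hX x ((le_max_right _ _).trans (not_le.1 hxX).le)).1.le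
  · rw [← div_le_iff₀ (by positivity)]
    by_cases hxX : x ≤ max x0 X
    · exact le_trans (hqm ⟨hx, hxX⟩) (le_max_left _ _)
    · exact le_trans (hX x ((le_max_right _ _).trans (not_le.1 hxX).le)).2.le (le_max_right _ _)

section Core

variable {V u : ℝ → ℝ} {x0 c1 c2 a0 : ℝ} {l : ℕ} {U : ℝ → ℝ → ℝ} {fm fp : ℝ → ℝ → ℂ}

/-- The Jost solution at `δ / lam` as a function of `lam`. -/
theorem isHolSymbol_jost_far (hA : IsAdmissible V) (hfp : ∀ y, 0 < y → IsJostPlus V y (fp y))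
    {δ : ℝ} (hδ : 0 < δ) : ∃ a, 0 < a ∧ IsHolSymbol a 0 (fun y => fp y (δ / y)) := by
  obtain ⟨D, hD⟩ := hA.decay
  obtain ⟨Vc, R, C, hC, hVd, hVc, hVR⟩ := hA.complex
  obtain ⟨B₀, hB₀, H⟩ := exists_far_extension hA.continuous hD hC hVd hVc hVR hδ
  refine ⟨δ / (2 * |R| + 1), by positivity, 1 / 10, B₀, by norm_num, by norm_num, hB₀.le,
    fun m hm => ?_⟩
  have hm2 := hm.2
  rw [lt_div_iff₀ (by positivity)] at hm2
  have hRm : 2 * R * m ≤ δ := by nlinarith [hm.1, le_abs_self R]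
  obtain ⟨A, B, hAd, -, hb, he⟩ := H m (fun _ => δ) hm.1 hRm (differentiableOn_const _)
    (fun z _ => by simpa using (by positivity : 0 ≤ δ / 10))
  rw [one_div_mul_eq_div]
  refine ⟨A, hAd, fun z hz => ?_, fun y hy hyb => ?_⟩
  · rw [zpow_zero, mul_one]
    exact (hb z hz).1
  · exact ((he y δ (fp y) hy.1 hyb rfl (hfp y hy.1)).1).symm

/-- Everything is evaluated at a matching point `X = η/m`, fixed while the energy runs through the
disc around `m`. There `f₊ = O(1)`, `f₊' = O(λ)`, `U = O(X^{ℓ+1})` and `U' = O(X^ℓ)`, whence `c₀⁺ =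
O(λ^{-ℓ})`. The lower bound comes from `Im (c₀⁺ conj f₊(X)) = -λ U(X)`. Finally `quotient_sub_eq` on
`[x0, X]` expresses the last symbol as `-f₊(X)/U(X)` plus `c₀⁺` times the error of `P`, both of
order `λ^{ℓ+1}`. -/
theorem exists_coeff_symbols (hA : IsAdmissible V) (hu : IsSolution V 0 u) (hx0 : 0 ≤ x0)
    (hc1 : 0 < c1) (hul : ∀ x, x0 ≤ x → c1 * (1 + x) ^ (l + 1) ≤ u x)
    (huu : ∀ x, x0 ≤ x → u x ≤ c2 * (1 + x) ^ (l + 1)) (ha0 : 0 < a0)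
    (hU : ∀ y ∈ Ioo 0 a0, IsSolution V (y ^ 2) (U y) ∧ U y x0 = u x0 ∧
      deriv (U y) x0 = deriv u x0) (hfp : ∀ y, 0 < y → IsJostPlus V y (fp y)) :
    ∃ (a c : ℝ) (P : ℂ → ℂ), 0 < a ∧ a ≤ a0 ∧ 0 < c ∧ Differentiable ℂ P ∧
      (∀ w, P (starRingEnd ℂ w) = starRingEnd ℂ (P w)) ∧
      P 0 = ((∫ y in Ioi x0, (u y ^ 2)⁻¹ : ℝ) : ℂ) ∧
      (∀ y ∈ Ioo 0 a, c * y ^ (-(l : ℤ))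
        ≤ ‖wronskian (fp y) (fun x => (U y x : ℂ)) x0‖) ∧
      IsHolSymbol a (-(l : ℤ)) (fun y => wronskian (fp y) (fun x => (U y x : ℂ)) x0) ∧
      IsHolSymbol a ((l + 1 : ℕ) : ℤ) (fun y => wronskian (fp y) (fun x => (U y x : ℂ)) x0
        * P ((y : ℂ) ^ 2) - fp y x0 / u x0) := by
  obtain ⟨D, hD⟩ := hA.decay
  obtain ⟨Vc, R, C, hC, hVd, hVc, hVR⟩ := hA.complex
  have hV := hA.continuous
  obtain ⟨W, UD, c0, C1, hc0, hC1, hWm, hWd, hWc, hW0, hWb, hWU⟩ :=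
    exists_energy_perturbation hV hD (fun x => (hA.pos x).le) hu hx0 hc1 hul huu
  obtain ⟨P, CP, hCP, hPd, hPc, hP0, hPκ⟩ := exists_inv_sq_expansion hu.continuous hx0 hc0 hc1 hul
    hWm (fun x hx => (hWd x hx).1) hWc hW0 (fun w x hx hw => (hWb w x hx hw).1)
  have hupos : ∀ x, x0 ≤ x → 0 < u x := fun x hx =>
    lt_of_lt_of_le (by have : 0 ≤ x := hx0.trans hx; positivity) (hul x hx)
  have hc2 : 0 < c2 := by
    have h1 := (hupos x0 le_rfl).trans_le (huu x0 le_rfl)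
    exact pos_of_mul_pos_left h1 (by positivity)
  -- Then `‖z‖ (1 + η/m) ≤ 2.2 η < 4 η = √c0`, so `w = z²` is admissible in the energy perturbation
  -- up to `X = η/m`.
  set η : ℝ := Real.sqrt c0 / 4 with hη
  have hη0 : 0 < η := by positivity
  have hη2 : 16 * η ^ 2 = c0 := by
    rw [hη, div_pow, Real.sq_sqrt hc0.le]
    ring
  clear_value η
  obtain ⟨B₀, hB₀, H⟩ := exists_far_extension hV hD hC hVd hVc hVR hη0
  set a : ℝ := min a0 (η / (1 + x0 + 2 * |R|)) with ha
  have hapos : 0 < a := lt_min ha0 (by positivity)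
  have hax : ∀ m ∈ Ioo 0 a, m ≤ η ∧ m * x0 ≤ η ∧ 2 * R * m ≤ η := by
    intro m hm
    have h1 : m < η / (1 + x0 + 2 * |R|) := hm.2.trans_le (min_le_right _ _)
    rw [lt_div_iff₀ (by positivity)] at h1
    have h2 := hm.1
    have h3 := mul_nonneg h2.le hx0
    have h4 := mul_nonneg h2.le (abs_nonneg R)
    have h5 := mul_le_mul_of_nonneg_left (le_abs_self R) h2.le
    refine ⟨by linarith, by linarith, by linarith⟩
  have key : ∀ m ∈ Ioo 0 a, x0 ≤ η / m ∧ 1 ≤ η / m ∧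
      (∀ z ∈ Metric.ball (m : ℂ) (m / 10), ‖z‖ ≤ 11 / 10 * m ∧ z ^ 2 ∈
        Metric.ball (0 : ℂ) (c0 / (1 + η / m) ^ 2) ∧ ‖z ^ 2‖ * (1 + η / m) ^ 2 ≤ c0) ∧
      ∃ A B : ℂ → ℂ, DifferentiableOn ℂ A (Metric.ball (m : ℂ) (m / 10)) ∧
        DifferentiableOn ℂ B (Metric.ball (m : ℂ) (m / 10)) ∧
        (∀ z ∈ Metric.ball (m : ℂ) (m / 10), ‖A z‖ ≤ B₀ ∧ ‖B z‖ ≤ B₀) ∧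
        ∀ y ∈ Ioo 0 a, (y : ℂ) ∈ Metric.ball (m : ℂ) (m / 10) →
          fp y (η / m) = A y ∧ deriv (fp y) (η / m) = y * B y := by
    intro m hm
    obtain ⟨h1, h2, h3⟩ := hax m hm
    have hm0 := hm.1
    refine ⟨?_, ?_, fun z hz => ?_, ?_⟩
    · rw [le_div_iff₀ hm0]
      linarith
    · rw [le_div_iff₀ hm0]
      linarith
    · have h4 : ‖z‖ ≤ 11 / 10 * m := by
        rw [Metric.mem_ball, dist_eq_norm] at hz
        have h5 := norm_add_le (z - m) m
        rw [sub_add_cancel, Complex.norm_real, Real.norm_of_nonneg hm0.le] at h5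
        linarith
      have h5 : ‖z ^ 2‖ * (1 + η / m) ^ 2 < c0 := by
        rw [norm_pow, ← mul_pow]
        have h6 : ‖z‖ * (1 + η / m) ≤ 11 / 10 * (2 * η) := by
          calc ‖z‖ * (1 + η / m) ≤ 11 / 10 * m * (1 + η / m) := by gcongr
            _ = 11 / 10 * (m + η) := by field_simp
            _ ≤ _ := by linarith
        have h7 : 0 ≤ ‖z‖ * (1 + η / m) := by positivity
        calc (‖z‖ * (1 + η / m)) ^ 2 ≤ (11 / 10 * (2 * η)) ^ 2 := by gcongr
          _ < c0 := by
            rw [← hη2]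
            nlinarith [sq_pos_of_pos hη0]
      refine ⟨h4, ?_, h5.le⟩
      rw [mem_ball_zero_iff, lt_div_iff₀ (by positivity)]
      exact h5
    -- The linear choice of `θ` keeps the point `θ(y)/y = η/m` fixed on the whole disc.
    · obtain ⟨A, B, hAd, hBd, hAB, hABf⟩ := H m (fun z => z * ((η / m : ℝ) : ℂ)) hm0 h3
        (by fun_prop) (fun z hz => by
          have h4 : z * ((η / m : ℝ) : ℂ) - η = (z - m) * ((η / m : ℝ) : ℂ) := by
            have : (m : ℂ) ≠ 0 := by exact_mod_cast hm0.ne'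
            push_cast
            field_simp
          rw [h4, norm_mul, Complex.norm_real, Real.norm_of_nonneg (by positivity)]
          rw [Metric.mem_ball, dist_eq_norm] at hz
          calc ‖z - m‖ * (η / m) ≤ m / 10 * (η / m) := by gcongr
            _ = η / 10 := by field_simp)
      refine ⟨A, B, hAd, hBd, hAB, fun y hy hyb => ?_⟩
      have := hABf y (y * (η / m)) (fp y) hy.1 hyb (by push_cast; ring) (hfp y hy.1)
      rwa [mul_div_cancel_left₀ _ hy.1.ne'] at this
  have haU : ∀ y ∈ Ioo 0 a, y ∈ Ioo 0 a0 := fun y hy => ⟨hy.1, hy.2.trans_le (min_le_left _ _)⟩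
  have hWn : ∀ w x, x0 ≤ x → ‖w‖ * (1 + x) ^ 2 ≤ c0 → 1 / 2 ≤ ‖W w x‖ ∧ ‖W w x‖ ≤ 3 / 2 := by
    intro w x hx hw
    have h1 := (hWb w x hx hw).1
    have h2 := norm_sub_norm_le 1 (1 - W w x)
    have h3 := norm_add_le (W w x - 1) 1
    rw [sub_sub_cancel, norm_one, norm_sub_rev] at h2
    rw [sub_add_cancel, norm_one] at h3
    constructor <;> linarith
  set c0p : ℝ → ℂ := fun y => wronskian (fp y) (fun x => (U y x : ℂ)) x0 with hc0p
  set K1 : ℝ := B₀ * C1 + 4 * B₀ * c2 * η with hK1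
  have hK1pos : 0 < K1 := by positivity
  have hcoef : ∀ m ∈ Ioo 0 a, ∃ F : ℂ → ℂ,
      DifferentiableOn ℂ F (Metric.ball (m : ℂ) (m / 10)) ∧
      (∀ z ∈ Metric.ball (m : ℂ) (m / 10), ‖F z‖ ≤ K1 * (2 * (η / m)) ^ l) ∧
      ∀ y ∈ Ioo 0 a, (y : ℂ) ∈ Metric.ball (m : ℂ) (m / 10) → F y = c0p y := by
    intro m hm
    obtain ⟨hX, hX1, hz, A, B, hAd, hBd, hAB, hABf⟩ := key m hm
    have hm0 := hm.1
    set X := η / m with hXdef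
    refine ⟨fun z => A z * UD (z ^ 2) X - z * B z * (u X * W (z ^ 2) X), ?_, fun z hzb => ?_,
      fun y hy hyb => ?_⟩
    · have h1 : Differentiable ℂ fun z => UD (z ^ 2) X :=
        (hWd X hX).2.comp (differentiable_id.pow 2)
      have h2 : Differentiable ℂ fun z => W (z ^ 2) X := (hWd X hX).1.comp (differentiable_id.pow 2)
      exact (hAd.mul h1.differentiableOn).sub ((differentiableOn_id.mul hBd).mul
        (h2.differentiableOn.const_mul _))
    · obtain ⟨hz1, hz2, hz3⟩ := hz z hzb
      obtain ⟨hAz, hBz⟩ := hAB z hzb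
      have h1 := (hWb _ X hX hz3).2
      have h2 := (hWn _ X hX hz3).2
      have h3 := huu X hX
      have h4 : 1 + X ≤ 2 * X := by linarith
      have h5 : (1 + X) ^ l ≤ (2 * X) ^ l := by gcongr
      have h6 : m * X = η := by
        rw [hXdef]
        field_simp
      refine (norm_sub_le _ _).trans ?_
      rw [hK1, add_mul]
      refine add_le_add ?_ ?_
      · rw [norm_mul]
        calc ‖A z‖ * ‖UD (z ^ 2) X‖ ≤ B₀ * (C1 * (1 + X) ^ l) := by gcongr
          _ ≤ B₀ * (C1 * (2 * X) ^ l) := by gcongr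
          _ = _ := by ring
      · rw [norm_mul, norm_mul, norm_mul, Complex.norm_real, Real.norm_of_nonneg (hupos X hX).le]
        calc ‖z‖ * ‖B z‖ * (u X * ‖W (z ^ 2) X‖)
            ≤ 11 / 10 * m * B₀ * (c2 * (1 + X) ^ (l + 1) * (3 / 2)) := by
              have := (hupos X hX).le
              gcongr
          _ ≤ 11 / 10 * m * B₀ * (c2 * (2 * X) ^ (l + 1) * (3 / 2)) := by gcongr
          _ = 33 / 10 * B₀ * c2 * (m * X) * (2 * X) ^ l := by ring
          _ ≤ _ := by
              rw [h6]
              gcongr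
              norm_num
    · obtain ⟨hfX, hfX'⟩ := hABf y hy hyb
      obtain ⟨hs, hi0, hi1⟩ := hU y (haU y hy)
      obtain ⟨hw1, hw2⟩ := hWU y (U y) hy.1 hs hi0 hi1 X hX
      simp only [hc0p]
      rw [wronskian_const (hfp y hy.1).sol (hs.ofReal hV).1 x0 X, wronskian_ofReal hV hs, hfX, hfX',
        hw1, hw2]
  have hlow : ∀ y ∈ Ioo 0 a, c1 * η ^ (l + 1) / (2 * B₀) * y ^ (-(l : ℤ)) ≤ ‖c0p y‖ := by
    intro y hy
    obtain ⟨hX, hX1, hz, A, B, hAd, hBd, hAB, hABf⟩ := key y hy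
    have hy0 := hy.1
    have hyb : (y : ℂ) ∈ Metric.ball (y : ℂ) (y / 10) := Metric.mem_ball_self (by positivity)
    obtain ⟨hfX, -⟩ := hABf y hy hyb
    obtain ⟨hs, hi0, hi1⟩ := hU y (haU y hy)
    obtain ⟨hw1, -⟩ := hWU y (U y) hy0 hs hi0 hi1 _ hX
    have h1 := hs.eq_im_mul_conj hV hD hy0 (hfp y hy0) (η / y) x0
    have h2 := Complex.abs_im_le_norm (c0p y * starRingEnd ℂ (fp y (η / y)))
    simp only [hc0p] at h2 ⊢
    rw [h1, abs_mul, abs_neg, abs_of_pos hy0, norm_mul, RCLike.norm_conj, hfX] at h2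
    have h3 : u (η / y) * (1 / 2) ≤ |U y (η / y)| := by
      have h4 : |U y (η / y)| = u (η / y) * ‖W ((y : ℂ) ^ 2) (η / y)‖ := by
        rw [← Real.norm_eq_abs, ← Complex.norm_real, hw1, norm_mul, Complex.norm_real,
          Real.norm_of_nonneg (hupos _ hX).le]
      rw [h4]
      have := (hupos _ hX).le
      have := (hWn _ _ hX (hz y hyb).2.2).1
      gcongr
    have h5 : c1 * (η / y) ^ (l + 1) ≤ u (η / y) := by
      refine le_trans ?_ (hul _ hX)
      gcongr
      linarith
    have h6 := (hAB y hyb).1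
    have h7 : y * (c1 * (η / y) ^ (l + 1) * (1 / 2))
        ≤ ‖wronskian (fp y) (fun x => (U y x : ℂ)) x0‖ * B₀ := by
      calc y * (c1 * (η / y) ^ (l + 1) * (1 / 2)) ≤ y * |U y (η / y)| := by
            gcongr
            linarith
        _ ≤ _ := h2
        _ ≤ _ := by gcongr
    rw [← div_le_iff₀ hB₀] at h7
    refine le_trans (le_of_eq ?_) h7
    rw [zpow_neg, zpow_natCast, div_pow]
    field_simp
    ring
  refine ⟨a, c1 * η ^ (l + 1) / (2 * B₀), P, hapos, min_le_left _ _, by positivity, hPd, hPc, hP0,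
    hlow, ?_, ?_⟩
  · refine ⟨1 / 10, K1 * (2 * η) ^ l, by norm_num, by norm_num, by positivity, fun m hm => ?_⟩
    obtain ⟨F, hF, hFb, hFe⟩ := hcoef m hm
    rw [one_div_mul_eq_div]
    refine ⟨F, hF, fun z hz => (hFb z hz).trans (le_of_eq ?_), hFe⟩
    rw [zpow_neg, zpow_natCast, ← mul_div_assoc, div_pow]
    ring
  · refine ⟨1 / 10, (2 * B₀ / c1 + K1 * CP * 2 ^ l) * (η ^ (l + 1))⁻¹, by norm_num, by norm_num,
      by positivity, fun m hm => ?_⟩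
    obtain ⟨F, hF, hFb, hFe⟩ := hcoef m hm
    obtain ⟨hX, hX1, hz, A, B, hAd, hBd, hAB, hABf⟩ := key m hm
    have hm0 := hm.1
    rw [one_div_mul_eq_div]
    set X := η / m with hXdef
    have hX0 : 0 < X := by linarith
    have huX : (u X : ℂ) ≠ 0 := by exact_mod_cast (hupos X hX).ne'
    obtain ⟨hκd, hκb⟩ := hPκ X hX
    refine ⟨fun z => -(A z / (u X * W (z ^ 2) X))
      + F z * (P (z ^ 2) - ∫ y in x0..X, ((u y * W (z ^ 2) y) ^ 2)⁻¹), ?_, fun z hzb => ?_,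
      fun y hy hyb => ?_⟩
    · have h2 : Differentiable ℂ fun z => W (z ^ 2) X := (hWd X hX).1.comp (differentiable_id.pow 2)
      have h3 : Differentiable ℂ fun z => P (z ^ 2) := hPd.comp (differentiable_id.pow 2)
      have h4 : DifferentiableOn ℂ (fun z : ℂ => ∫ y in x0..X, ((u y * W (z ^ 2) y) ^ 2)⁻¹)
          (Metric.ball (m : ℂ) (m / 10)) :=
        hκd.comp (differentiable_id.pow 2).differentiableOn fun z hzb => (hz z hzb).2.1
      refine (hAd.div (h2.differentiableOn.const_mul _) fun z hzb => mul_ne_zero huX ?_).neg.add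
        (hF.mul (h3.differentiableOn.sub h4))
      have := (hWn _ X hX (hz z hzb).2.2).1
      exact norm_pos_iff.1 (by linarith)
    · obtain ⟨hz1, hz2, hz3⟩ := hz z hzb
      have h1 := (hWn _ X hX hz3).1
      have h2 := hκb _ hz2
      rw [norm_sub_rev, ← le_div_iff₀ (by positivity)] at h2
      have h3 : (η ^ (l + 1))⁻¹ * m ^ (l + 1) = (X ^ (l + 1))⁻¹ := by
        rw [hXdef, div_pow, inv_div, div_eq_inv_mul (m ^ (l + 1))]
      rw [zpow_natCast, mul_assoc, h3]
      refine (norm_add_le _ _).trans ?_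
      rw [add_mul, norm_neg, norm_div, norm_mul, norm_mul, Complex.norm_real,
        Real.norm_of_nonneg (hupos X hX).le]
      have h4 : c1 * X ^ (l + 1) ≤ u X := by
        refine le_trans ?_ (hul X hX)
        gcongr
        linarith
      refine add_le_add ?_ ?_
      · calc ‖A z‖ / (u X * ‖W (z ^ 2) X‖) ≤ B₀ / (c1 * X ^ (l + 1) * (1 / 2)) := by
              have := (hAB z hzb).1
              have := (hupos X hX).le
              gcongr
          _ = _ := by field_simp
      · calc _ ≤ K1 * (2 * X) ^ l * (CP / (1 + X) ^ (2 * l + 1)) := by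
              gcongr
              exact hFb z hzb
          _ ≤ K1 * (2 * X) ^ l * (CP / X ^ (2 * l + 1)) := by
              gcongr
              linarith
          _ = _ := by
              rw [mul_pow, show 2 * l + 1 = l + (l + 1) by ring, pow_add X l (l + 1)]
              field_simp
    · obtain ⟨hfX, -⟩ := hABf y hy hyb
      obtain ⟨hs, hi0, hi1⟩ := hU y (haU y hy)
      have hWy : ∀ x ∈ Icc x0 X, (U y x : ℂ) = u x * W ((y : ℂ) ^ 2) x ∧ U y x ≠ 0 := by
        intro x hx
        have h1 := (hWU y (U y) hy.1 hs hi0 hi1 x hx.1).1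
        refine ⟨h1, fun h0 => ?_⟩
        have hx' : 0 ≤ x := hx0.trans hx.1
        have h2 := (hWn ((y : ℂ) ^ 2) x hx.1 (by
          refine le_trans ?_ (hz y hyb).2.2
          have := hx.2
          gcongr)).1
        rw [h0, Complex.ofReal_zero, eq_comm, mul_eq_zero] at h1
        rcases h1 with h1 | h1
        · exact (hupos x hx.1).ne' (by exact_mod_cast h1)
        · rw [h1, norm_zero] at h2
          linarith
      have h1 := quotient_sub_eq hV (hfp y hy.1).sol hs hX (fun x hx => (hWy x hx).2) x0
      have h2 : ∫ x in x0..X, ((U y x : ℂ) ^ 2)⁻¹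
          = ∫ x in x0..X, ((u x * W ((y : ℂ) ^ 2) x) ^ 2)⁻¹ := by
        refine intervalIntegral.integral_congr fun x hx => ?_
        rw [uIcc_of_le hX] at hx
        simp only [(hWy x hx).1]
      rw [h2, (hWy X ⟨hX, le_rfl⟩).1, hi0, hfX] at h1
      simp only [hFe y hy hyb]
      simp only [hc0p]
      linear_combination -h1

end Core

end ReggeWheeler

namespace ReggeWheeler
open MeasureTheory

/-! ## Low energy expansions -/

section LowEnergy

variable {V u : ℝ → ℝ} {x0 c1 c2 a0 : ℝ} {l : ℕ} {U : ℝ → ℝ → ℝ} {fm fp : ℝ → ℝ → ℂ}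

/-- Since `u'` is increasing, `u'(x0) u⁻² ≤ u' u⁻² = (-1/u)'`. This decides the sign of `Q 0` in the
low energy expansion. -/
theorem deriv_mul_integral_inv_sq_le (hVpos : ∀ x, 0 ≤ V x) (hu : IsSolution V 0 u)
    (hpos : ∀ x, x0 ≤ x → 0 < u x) (hi : IntegrableOn (fun x => (u x ^ 2)⁻¹) (Ioi x0)) :
    deriv u x0 * ∫ y in Ioi x0, (u y ^ 2)⁻¹ ≤ (u x0)⁻¹ := by
  have hmono := hu.monotoneOn_deriv hVpos fun x hx => (hpos x hx).le
  have hlim := (intervalIntegral_tendsto_integral_Ioi x0 hi tendsto_id).const_mul (deriv u x0)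
  refine le_of_tendsto hlim ?_
  filter_upwards [eventually_ge_atTop x0] with X hX
  have hc : ContinuousOn (fun y => (u y ^ 2)⁻¹) (uIcc x0 X) := by
    rw [uIcc_of_le hX]
    exact (hu.continuous.pow 2).continuousOn.inv₀ fun y hy => pow_ne_zero 2 (hpos y hy.1).ne'
  have hdc : Continuous (deriv u) :=
    continuous_iff_continuousAt.2 fun x => (hu.hasDerivAt_deriv x).continuousAt
  have hd : ∀ y ∈ uIcc x0 X, HasDerivAt (fun y => -(u y)⁻¹) (deriv u y * (u y ^ 2)⁻¹) y := by
    intro y hy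
    rw [uIcc_of_le hX] at hy
    refine ((hu.hasDerivAt y).inv (hpos y hy.1).ne').neg.congr_deriv ?_
    rw [neg_div, neg_neg, div_eq_mul_inv]
  have hint : IntervalIntegrable (fun y => deriv u y * (u y ^ 2)⁻¹) volume x0 X :=
    ContinuousOn.intervalIntegrable (hdc.continuousOn.mul hc)
  rw [← intervalIntegral.integral_const_mul]
  refine (intervalIntegral.integral_mono_on hX (hc.intervalIntegrable.const_mul _) hint
    fun y hy => ?_).trans ?_
  · exact mul_le_mul_of_nonneg_right
      (hmono (show x0 ∈ Ici x0 from self_mem_Ici) (show y ∈ Ici x0 from hy.1) hy.1) (by positivity)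
  · rw [intervalIntegral.integral_eq_sub_of_hasDerivAt hd hint]
    have := inv_pos.2 (hpos X hX)
    linarith

/-- All three quotients become functions of `N`, `A`, `P`, `Q`, which are holomorphic at zero with
the conjugation symmetry, and of the single error `E = O(λ^{2l+1})`. The phase `e^{iλx0}` and the
singular factor `c₀⁺` cancel. -/
theorem exists_low_energy_expansion (hA : IsAdmissible V) (hu : IsSolution V 0 u) (hx0 : 0 ≤ x0)
    (hc1 : 0 < c1) (hul : ∀ x, x0 ≤ x → c1 * (1 + x) ^ (l + 1) ≤ u x)
    (huu : ∀ x, x0 ≤ x → u x ≤ c2 * (1 + x) ^ (l + 1))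
    (hi : IntegrableOn (fun x => (u x ^ 2)⁻¹) (Ioi x0)) (ha0 : 0 < a0)
    (hU : ∀ y ∈ Ioo 0 a0, IsSolution V (y ^ 2) (U y) ∧ U y x0 = u x0 ∧
      deriv (U y) x0 = deriv u x0)
    (hfm : ∀ y, 0 < y → IsJostMinus V y (fm y)) (hfp : ∀ y, 0 < y → IsJostPlus V y (fp y)) :
    ∃ a c : ℝ, 0 < a ∧ a ≤ a0 ∧ 0 < c ∧
      (∀ y ∈ Ioo 0 a, c * y ^ (-(l : ℤ)) ≤ ‖wronskian (fp y) (fun x => (U y x : ℂ)) x0‖) ∧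
      IsHolSymbol a (-(l : ℤ)) (fun y => wronskian (fp y) (fun x => (U y x : ℂ)) x0) ∧
      (∀ y ∈ Ioo 0 a, wronskian (fm y) (fp y) x0 ≠ 0) ∧
      IsHolSymbol a 0 (fun y => wronskian (fm y) (fun x => (U y x : ℂ)) x0
        * wronskian (fp y) (fun x => (U y x : ℂ)) x0 / wronskian (fm y) (fp y) x0) ∧
      (∃ P : Polynomial ℝ, P.degree < (l : WithBot ℕ) ∧ IsHolSymbol a ((2 * l + 1 : ℕ) : ℤ)
        (fun y => (((wronskian (fm y) (fun x => (U y x : ℂ)) x0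
          * wronskian (fp y) (fun x => (U y x : ℂ)) x0 / wronskian (fm y) (fp y) x0).im
          - y * P.eval (y ^ 2) : ℝ) : ℂ))) ∧
      ∃ P : Polynomial ℝ, P.degree < (l : WithBot ℕ) ∧ IsHolSymbol a ((2 * l + 1 : ℕ) : ℤ)
        (fun y => (((fm y x0 * fp y x0 / wronskian (fm y) (fp y) x0).im
          - y * P.eval (y ^ 2) : ℝ) : ℂ)) := by
  have hV := hA.continuous
  have hupos : ∀ x, x0 ≤ x → 0 < u x := fun x hx =>
    lt_of_lt_of_le (by have : 0 ≤ x := hx0.trans hx; positivity) (hul x hx)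
  have hu0 := hupos x0 le_rfl
  obtain ⟨a1, c, P, ha1, ha1', hc, hPd, hPc, hP0, hlow, hsym, hS⟩ :=
    exists_coeff_symbols hA hu hx0 hc1 hul huu ha0 hU hfp
  obtain ⟨D, hD⟩ := hA.decay
  obtain ⟨C, b, hb, hVe⟩ := hA.exp_decay
  obtain ⟨ρ, A, B, hρ, hAd, hBd, hABc, ⟨α, β, hα, hβ, hA0, hB0⟩, hABf⟩ :=
    exists_near_extension hV hD hb hVe hA.pos x0
  set v : ℂ := (u x0 : ℂ) with hv
  set v' : ℂ := ((deriv u x0 : ℝ) : ℂ) with hv'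
  have hv0 : v ≠ 0 := by
    rw [hv]
    exact_mod_cast hu0.ne'
  set N : ℂ → ℂ := fun z => A z * v' - B z * v with hN
  set Q : ℂ → ℂ := fun z => -(A z / v) + P (z ^ 2) * N z with hQ
  have hP2 : Differentiable ℂ fun z : ℂ => P (z ^ 2) := hPd.comp (differentiable_id.pow 2)
  have hNd : DifferentiableOn ℂ N (Metric.ball 0 ρ) := (hAd.mul_const _).sub (hBd.mul_const _)
  have hQd : DifferentiableOn ℂ Q (Metric.ball 0 ρ) :=
    (hAd.div_const _).neg.add (hP2.differentiableOn.mul hNd)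
  have hNc : ∀ x : ℝ, N (-(x : ℂ)) = starRingEnd ℂ (N x) := by
    intro x
    simp only [hN, (hABc x).1, (hABc x).2, map_sub, map_mul, hv, hv', Complex.conj_ofReal]
  have hPr : ∀ x : ℝ, P ((x : ℂ) ^ 2) = starRingEnd ℂ (P ((x : ℂ) ^ 2)) := by
    intro x
    rw [← hPc, map_pow, Complex.conj_ofReal]
  have hQc : ∀ x : ℝ, Q (-(x : ℂ)) = starRingEnd ℂ (Q x) := by
    intro x
    simp only [hQ, hNc, (hABc x).1, map_add, map_neg, map_div₀, map_mul, neg_sq, ← hPr]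
    rw [hv, Complex.conj_ofReal]
  -- With `J = ∫ u⁻²` one has `Q 0 = -α/u + J (α u' - β u)` at `x0`. Because `J u' ≤ 1/u` this is at
  -- most `-J β u`, and it equals `-α/u` if `J = 0`; in either case it is negative.
  have hQ0 : Q 0 ≠ 0 := by
    set J : ℝ := ∫ y in Ioi x0, (u y ^ 2)⁻¹ with hJ
    have hJ0 : 0 ≤ J := setIntegral_nonneg measurableSet_Ioi fun y _ => by positivity
    have h1 := deriv_mul_integral_inv_sq_le (fun x => (hA.pos x).le) hu hupos hi
    have h2 : Q 0 = ((-(α / u x0) + J * (α * deriv u x0 - β * u x0) : ℝ) : ℂ) := by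
      simp only [hQ, hN, hA0, hB0, ne_eq, OfNat.ofNat_ne_zero, not_false_eq_true, zero_pow, hP0,
        hv, hv']
      push_cast
      ring
    rw [h2]
    refine Complex.ofReal_ne_zero.2 (ne_of_lt ?_)
    rcases hJ0.eq_or_lt with h0 | h0
    · rw [← h0]
      have : 0 < α / u x0 := by positivity
      linarith
    · have h3 : 0 < J * (β * u x0) := by positivity
      have h4 := mul_le_mul_of_nonneg_left h1 hα.le
      rw [← div_eq_mul_inv] at h4
      linarith
  have hq : 0 < ‖Q 0‖ := norm_pos_iff.2 hQ0
  obtain ⟨ρ', hρ', hρρ, hQlow⟩ : ∃ ρ', 0 < ρ' ∧ ρ' ≤ ρ ∧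
      ∀ z ∈ Metric.ball (0 : ℂ) ρ', ‖Q 0‖ / 2 ≤ ‖Q z‖ := by
    have h1 : ContinuousAt Q 0 := (hQd.differentiableAt (Metric.ball_mem_nhds _ hρ)).continuousAt
    obtain ⟨ε, hε, h2⟩ := Metric.eventually_nhds_iff_ball.1
      (h1.norm.eventually (lt_mem_nhds (half_lt_self hq)))
    exact ⟨min ε ρ, lt_min hε hρ, min_le_right _ _, fun z hz =>
      (h2 z (Metric.ball_subset_ball (min_le_left _ _) hz)).le⟩
  set c0p : ℝ → ℂ := fun y => wronskian (fp y) (fun x => (U y x : ℂ)) x0 with hc0p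
  set S : ℝ → ℂ := fun y => c0p y * P ((y : ℂ) ^ 2) - fp y x0 / u x0 with hSdef
  set E : ℝ → ℂ := fun y => S y * (c0p y)⁻¹ with hE
  have hEsym : IsHolSymbol a1 ((2 * l + 1 : ℕ) : ℤ) E := by
    have := hS.mul (hsym.inv hc hlow)
    have h1 : (((l + 1 : ℕ) : ℤ) + - -(l : ℤ)) = ((2 * l + 1 : ℕ) : ℤ) := by
      push_cast
      ring
    rwa [h1] at this
  set a2 : ℝ := min a1 (ρ' / 2) with ha2
  have ha2pos : 0 < a2 := lt_min ha1 (by positivity)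
  have ha2ρ : 2 * a2 ≤ ρ' := by
    have := min_le_right a1 (ρ' / 2)
    linarith
  have hNsym2 : IsHolSymbol a2 0 (fun y => N y) :=
    IsHolSymbol.of_differentiableOn hNd (ha2ρ.trans hρρ)
  obtain ⟨CE, hCE, hEb⟩ := hEsym.exists_norm_le
  obtain ⟨CN, hCN, hNb⟩ := hNsym2.exists_norm_le
  set a : ℝ := min a2 (min 1 (‖Q 0‖ / (4 * (CE * CN + 1)))) with ha
  have hapos : 0 < a := lt_min ha2pos (lt_min one_pos (by positivity))
  have haa2 : a ≤ a2 := min_le_left _ _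
  have haa1 : a ≤ a1 := haa2.trans (min_le_left _ _)
  have haρ : 2 * a ≤ ρ' := by linarith
  have hmem : ∀ y ∈ Ioo 0 a, (y : ℂ) ∈ Metric.ball (0 : ℂ) ρ' := by
    intro y hy
    rw [mem_ball_zero_iff, Complex.norm_real, Real.norm_of_nonneg hy.1.le]
    linarith [hy.2, hy.1]
  set Dt : ℝ → ℂ := fun y => Q y - E y * N y with hDt
  have hDlow : ∀ y ∈ Ioo 0 a, ‖Q 0‖ / 4 * y ^ (0 : ℤ) ≤ ‖Dt y‖ := by
    intro y hy
    rw [zpow_zero, mul_one]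
    have h1 := hQlow y (hmem y hy)
    have h2 := hEb y ⟨hy.1, hy.2.trans_le haa1⟩
    have h3 := hNb y ⟨hy.1, hy.2.trans_le haa2⟩
    rw [zpow_zero, mul_one] at h3
    have hy1 : y ≤ 1 := hy.2.le.trans ((min_le_right _ _).trans (min_le_left _ _))
    have hy2 : y ≤ ‖Q 0‖ / (4 * (CE * CN + 1)) :=
      hy.2.le.trans ((min_le_right _ _).trans (min_le_right _ _))
    have hy0 := hy.1
    rw [le_div_iff₀ (by positivity)] at hy2
    have h4 : y ^ (2 * l + 1) ≤ y := by
      have := pow_le_pow_of_le_one hy0.le hy1 (show 1 ≤ 2 * l + 1 by omega)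
      simpa using this
    have h5 : ‖E y * N y‖ ≤ ‖Q 0‖ / 4 := by
      rw [norm_mul]
      rw [zpow_natCast] at h2
      calc ‖E y‖ * ‖N y‖ ≤ CE * y ^ (2 * l + 1) * CN := by gcongr
        _ ≤ CE * y * CN := by gcongr
        _ ≤ ‖Q 0‖ / 4 := by nlinarith
    have h6 := norm_sub_norm_le (Q y) (E y * N y)
    simp only [hDt]
    linarith
  have hD0 : ∀ y ∈ Ioo 0 a, Dt y ≠ 0 := by
    intro y hy
    have := hDlow y hy
    rw [zpow_zero, mul_one] at this
    exact norm_pos_iff.1 (lt_of_lt_of_le (by positivity) this)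
  have hQne : ∀ z ∈ Metric.ball (0 : ℂ) ρ', Q z ≠ 0 := fun z hz =>
    norm_pos_iff.1 (lt_of_lt_of_le (by positivity) (hQlow z hz))
  have hc0ne : ∀ y ∈ Ioo 0 a, c0p y ≠ 0 := by
    intro y hy
    have := hlow y ⟨hy.1, hy.2.trans_le haa1⟩
    have h1 := hy.1
    exact norm_pos_iff.1 (lt_of_lt_of_le (by positivity) this)
  have hEs : IsHolSymbol a ((2 * l + 1 : ℕ) : ℤ) E := hEsym.mono haa1
  have hNs : IsHolSymbol a 0 (fun y => N y) := hNsym2.mono haa2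
  have hQs : IsHolSymbol a 0 (fun y => Q y) :=
    IsHolSymbol.of_differentiableOn hQd (haρ.trans hρρ)
  have hAs : IsHolSymbol a 0 (fun y => A y) :=
    IsHolSymbol.of_differentiableOn hAd (haρ.trans hρρ)
  have hDs : IsHolSymbol a 0 Dt := by
    refine hQs.sub ((hEs.mul hNs).weaken ?_)
    positivity
  have hDi : IsHolSymbol a 0 (fun y => (Dt y)⁻¹) := by
    simpa using hDs.inv (by positivity) hDlow
  have hQi : IsHolSymbol a 0 (fun y => (Q y)⁻¹) := by
    have := hQs.inv (c := ‖Q 0‖ / 2) (by positivity) (fun y hy => by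
      rw [zpow_zero, mul_one]
      exact hQlow y (hmem y hy))
    simpa using this
  have hid : ∀ y ∈ Ioo 0 a, ∃ e : ℂ, e ≠ 0 ∧ e * fm y x0 = A y ∧
      e * wronskian (fm y) (fun x => (U y x : ℂ)) x0 = N y ∧
      e * wronskian (fm y) (fp y) x0 = c0p y * Dt y ∧
      fp y x0 = v * (c0p y * (P ((y : ℂ) ^ 2) - E y)) := by
    intro y hy
    have hyρ : y ∈ Ioo 0 ρ := ⟨hy.1, by linarith [hy.2, hy.1]⟩
    obtain ⟨h1, h2⟩ := hABf y (fm y) hyρ (hfm y hy.1)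
    obtain ⟨hs, hi0, hi1⟩ := hU y ⟨hy.1, hy.2.trans_le (haa1.trans ha1')⟩
    have hcp : c0p y = fp y x0 * v' - deriv (fp y) x0 * v := by
      simp only [hc0p]
      rw [wronskian_ofReal hV hs, hi0, hi1]
    have hSE : S y = E y * c0p y := by
      simp only [hE]
      rw [inv_mul_cancel_right₀ (hc0ne y hy)]
    have hS' : fp y x0 = v * (c0p y * P ((y : ℂ) ^ 2) - E y * c0p y) := by
      rw [← hSE]
      rw [show S y = c0p y * P ((y : ℂ) ^ 2) - fp y x0 / v from rfl]
      field_simp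
      ring
    refine ⟨Complex.exp (Complex.I * y * x0), Complex.exp_ne_zero _, h1, ?_, ?_, ?_⟩
    · rw [wronskian_ofReal hV hs, hi0, hi1]
      simp only [hN]
      rw [← h1, ← h2]
      ring
    · have h3 : c0p y * Dt y = (fp y x0 * N y - c0p y * A y) / v := by
        rw [hS']
        simp only [hDt, hQ]
        field_simp
        ring
      rw [h3, hcp, wronskian]
      simp only [hN]
      rw [← h1, ← h2]
      field_simp
      ring
    · rw [hS']
      ring
  refine ⟨a, c, hapos, haa1.trans ha1', hc, fun y hy => hlow y ⟨hy.1, hy.2.trans_le haa1⟩,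
    hsym.mono haa1, fun y hy => ?_, ?_, ?_, ?_⟩
  · obtain ⟨e, he, -, -, h3, -⟩ := hid y hy
    intro h0
    rw [h0, mul_zero] at h3
    exact mul_ne_zero (hc0ne y hy) (hD0 y hy) h3.symm
  all_goals
    have hZ : ∀ y ∈ Ioo 0 a, wronskian (fm y) (fun x => (U y x : ℂ)) x0 * c0p y
        / wronskian (fm y) (fp y) x0 = N y / Dt y := by
      intro y hy
      obtain ⟨e, he, -, h2, h3, -⟩ := hid y hy
      rw [← mul_div_mul_left _ _ he, h3, ← mul_assoc, h2, mul_comm (c0p y),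
        mul_div_mul_right _ _ (hc0ne y hy)]
  · have := hNs.mul hDi
    rw [add_zero] at this
    exact this.congr fun y hy => by rw [← div_eq_mul_inv, ← hZ y hy]
  -- Separates the symmetric holomorphic part: `N/Dt = N/Q + N² E/(Q Dt)`.
  · have hg := (hNs.mul hNs).mul (hEs.mul (hQi.mul hDi))
    rw [show (0 : ℤ) + 0 + (((2 * l + 1 : ℕ) : ℤ) + (0 + 0)) = ((2 * l + 1 : ℕ) : ℤ) by ring] at hg
    refine exists_im_expansion l haρ (h := fun z => N z / Q z)
      ((hNd.mono (Metric.ball_subset_ball hρρ)).div (hQd.mono (Metric.ball_subset_ball hρρ)) hQne)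
      (fun x _ => by simp only [hNc, hQc, map_div₀]) hg fun y hy => ?_
    rw [hZ y hy]
    congr 1
    have h1 := hQne y (hmem y hy)
    have h2 := hD0 y hy
    have h3 : Q y = Dt y + E y * N y := by
      simp only [hDt]
      ring
    field_simp
    rw [h3]
    ring
  -- Here the quotient is `A v (P - E)/Dt = A v P/Q + A² E/(Q Dt)`, by `v Q = -A + v P N`.
  · have hg := (hAs.mul hAs).mul (hEs.mul (hQi.mul hDi))
    rw [show (0 : ℤ) + 0 + (((2 * l + 1 : ℕ) : ℤ) + (0 + 0)) = ((2 * l + 1 : ℕ) : ℤ) by ring] at hg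
    refine exists_im_expansion l haρ (h := fun z => A z * v * P (z ^ 2) / Q z)
      ((((hAd.mono (Metric.ball_subset_ball hρρ)).mul_const _).mul hP2.differentiableOn).div
        (hQd.mono (Metric.ball_subset_ball hρρ)) hQne)
      (fun x _ => by
        simp only [hQc, (hABc x).1, map_div₀, map_mul, neg_sq, ← hPr]
        rw [hv, Complex.conj_ofReal]) hg fun y hy => ?_
    obtain ⟨e, he, h1, -, h3, h4⟩ := hid y hy
    rw [← mul_div_mul_left _ _ he, h3, ← mul_assoc, h1, h4]
    congr 1
    have h5 := hQne y (hmem y hy)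
    have h6 := hD0 y hy
    have h7 := hc0ne y hy
    have h8 : Dt y = Q y - E y * N y := rfl
    have h9 : v * Q y = -A y + v * (P ((y : ℂ) ^ 2) * N y) := by
      simp only [hQ]
      field_simp
    field_simp
    rw [h8]
    linear_combination (-(E y) * A y) * h9

end LowEnergy

end ReggeWheeler

namespace ReggeWheeler
open MeasureTheory

/-! ## Existence of the energy bases and estimates for the coefficients -/

section Estimates

variable {V : ℝ → ℝ} {u : Fin 2 → ℝ → ℝ} {x0 δ lam0 : ℝ} {l : ℕ} {U : Fin 2 → ℝ → ℝ → ℝ}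
  {fm fp : ℝ → ℝ → ℂ}

/-- `U₁` vanishes at `X` with slope `-1/U₀(X)`. Since the formula for `U₁` is given only up to `X`,
the derivative is computed at an interior point and transported to `X` by `quotient_sub_eq`. -/
theorem wronskian_eq_neg_div {E a X : ℝ} {f : ℝ → ℂ} {U₀ U₁ : ℝ → ℝ} (hV : Continuous V)
    (hf : IsSolution V E f) (h₀ : IsSolution V E U₀) (h₁ : IsSolution V E U₁) (haX : a < X)
    (hne : ∀ x ∈ Icc a X, U₀ x ≠ 0)
    (heq : ∀ x ∈ Icc a X, U₁ x = U₀ x * ∫ y in x..X, 1 / U₀ y ^ 2) (p : ℝ) :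
    wronskian f (fun x => (U₁ x : ℂ)) p = -(f X / U₀ X) := by
  obtain ⟨x, hx⟩ := exists_between haX
  have hx0 := hne x ⟨hx.1.le, hx.2.le⟩
  have hc : ContinuousOn (fun y => 1 / U₀ y ^ 2) (Icc a X) :=
    continuousOn_const.div (h₀.continuous.pow 2).continuousOn fun y hy => pow_ne_zero 2 (hne y hy)
  have hint : IntervalIntegrable (fun y => 1 / U₀ y ^ 2) volume x X := by
    refine (hc.mono ?_).intervalIntegrable
    rw [uIcc_of_le hx.2.le]
    exact Icc_subset_Icc_left hx.1.le
  have hm : Measurable fun y => 1 / U₀ y ^ 2 :=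
    measurable_const.div (h₀.continuous.measurable.pow_const 2)
  have hd := (h₀.hasDerivAt x).mul (intervalIntegral.integral_hasDerivAt_left hint
    (hm.stronglyMeasurable.stronglyMeasurableAtFilter) (hc.continuousAt (Icc_mem_nhds hx.1 hx.2)))
  have hd' : deriv U₁ x = deriv U₀ x * (∫ y in x..X, 1 / U₀ y ^ 2) + U₀ x * -(1 / U₀ x ^ 2) := by
    refine (hd.congr_of_eventuallyEq ?_).deriv
    filter_upwards [Icc_mem_nhds hx.1 hx.2] with y hy using heq y hy
  have hq := quotient_sub_eq hV hf h₀ hx.2.le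
    (fun y hy => hne y ⟨hx.1.le.trans hy.1, hy.2⟩) x
  have hκ : ∫ y in x..X, ((U₀ y : ℂ) ^ 2)⁻¹ = ((∫ y in x..X, 1 / U₀ y ^ 2 : ℝ) : ℂ) := by
    rw [← intervalIntegral.integral_ofReal]
    refine intervalIntegral.integral_congr fun y _ => ?_
    simp
  have hx0' : (U₀ x : ℂ) ≠ 0 := by exact_mod_cast hx0
  rw [wronskian_const hf (h₁.ofReal hV).1 p x, wronskian_ofReal hV h₁, hd',
    heq x ⟨hx.1.le, hx.2.le⟩]
  rw [hκ, wronskian_ofReal hV h₀] at hq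
  rw [show -(f X / (U₀ X : ℂ)) = -(f X / (U₀ X : ℂ) - f x / (U₀ x : ℂ)) - f x / (U₀ x : ℂ) by ring,
    hq]
  push_cast
  field_simp
  ring

theorem IsEnergyBasis.pos (hE : IsEnergyBasis V u x0 δ lam0 U) {y : ℝ} (hy : y ∈ Ioo 0 lam0) :
    ∀ x ∈ Icc x0 (δ / y), 1 / 2 * u 0 x ≤ U 0 y x ∧ 0 < U 0 y x := by
  intro x hx
  have h1 := (abs_le.1 (hE.close y hy x hx)).1
  have h2 := hE.u_zero_pos x hx.1
  have h3 : 1 / 2 ≤ U 0 y x / u 0 x := by linarith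
  rw [le_div_iff₀ h2] at h3
  exact ⟨h3, by linarith⟩

theorem IsEnergyBasis.lt_div (hE : IsEnergyBasis V u x0 δ lam0 U) {y : ℝ} (hy : y ∈ Ioo 0 lam0) :
    x0 < δ / y := by
  rw [lt_div_iff₀ hy.1]
  exact (mul_lt_mul_of_pos_left hy.2 hE.x0_pos).trans_le hE.x0_mul_lam0_le

theorem IsZeroEnergyBasis.integrableOn (hz : IsZeroEnergyBasis V l u)
    (hpos : ∀ x, x0 ≤ x → 0 < u 0 x) : IntegrableOn (fun x => (u 0 x ^ 2)⁻¹) (Ioi x0) :=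
  (integrableOn_inv_sq (hz.sol 0).continuous hpos hz.asymp_zero).mono_set Ioi_subset_Ici_self

/-- Put `m = c₁⁺/c₀⁺`, which is `O(λ^{2l+1})`, and let `Z` be the quotient in `A₀₀`. Eliminating
`c₁⁻` by `c₁⁻c₀⁺ = W + c₀⁻c₁⁺` turns the four quotients into `Z`, `Z m`, `1 + Z m` and `m + Z m²`.
-/
theorem exists_coefficient_estimates (hA : IsAdmissible V) (hz : IsZeroEnergyBasis V l u)
    (hE : IsEnergyBasis V u x0 δ lam0 U) (hfm : ∀ y, 0 < y → IsJostMinus V y (fm y))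
    (hfp : ∀ y, 0 < y → IsJostPlus V y (fp y)) :
    ∃ lam1 : ℝ, 0 < lam1 ∧ lam1 ≤ lam0 ∧
      (∀ lam ∈ Ioo 0 lam1, coeffDet fm fp U lam = wronskian (fm lam) (fp lam) 0 ∧
        coeffDet fm fp U lam ≠ 0) ∧
      IsOddO l lam1 (spectralCoeff fm fp U 0 0) ∧
      ∀ j k : Fin 2, 1 ≤ (j : ℕ) + (k : ℕ) →
        IsSymbolO (2 * (l : ℝ) + 1) lam1 (spectralCoeff fm fp U j k) := by
  have hV := hA.continuous
  have hx0 := hE.x0_pos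
  have hδ := hE.δ_pos
  obtain ⟨D, hD⟩ := hA.decay
  obtain ⟨c1, c2, hc1, hul, huu⟩ := exists_two_sided_bound (hz.sol 0).continuous hx0.le
    hE.u_zero_pos hz.asymp_zero
  obtain ⟨a1, c, ha1, ha1', hc, hlow, hc0s, hW0, hZs, ⟨P, -, hPs⟩, -⟩ :=
    exists_low_energy_expansion hA (hz.sol 0) hx0.le hc1 hul huu (hz.integrableOn hE.u_zero_pos)
      hE.lam0_pos (fun y hy => ⟨hE.sol 0 y hy, hE.init y hy, hE.init_deriv y hy⟩) hfm hfp
  obtain ⟨a2, ha2, hfar⟩ := isHolSymbol_jost_far hA hfp hδ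
  set a : ℝ := min a1 a2 with ha
  have hapos : 0 < a := lt_min ha1 ha2
  have haa1 : a ≤ a1 := min_le_left _ _
  have hal : ∀ y ∈ Ioo 0 a, y ∈ Ioo 0 lam0 := fun y hy =>
    ⟨hy.1, hy.2.trans_le (haa1.trans ha1')⟩
  have hal1 : ∀ y ∈ Ioo 0 a, y ∈ Ioo 0 a1 := fun y hy => ⟨hy.1, hy.2.trans_le haa1⟩
  set c0p : ℝ → ℂ := fun y => wronskian (fp y) (fun x => (U 0 y x : ℂ)) x0 with hc0p
  set c0m : ℝ → ℂ := fun y => wronskian (fm y) (fun x => (U 0 y x : ℂ)) x0 with hc0m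
  set Z : ℝ → ℂ := fun y => c0m y * c0p y / wronskian (fm y) (fp y) x0 with hZ
  set Ux : ℝ → ℝ := fun y => U 0 y (δ / y) with hUx
  set m : ℝ → ℂ := fun y => -(fp y (δ / y)) * (Ux y : ℂ)⁻¹ * (c0p y)⁻¹ with hm
  have hc0ne : ∀ y ∈ Ioo 0 a, c0p y ≠ 0 := by
    intro y hy
    have h1 := hlow y (hal1 y hy)
    have h2 := hy.1
    exact norm_pos_iff.1 (lt_of_lt_of_le (by positivity) h1)
  have hUxpos : ∀ y ∈ Ioo 0 a, 1 / 2 * u 0 (δ / y) ≤ Ux y ∧ 0 < Ux y := fun y hy =>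
    hE.pos (hal y hy) _ ⟨(hE.lt_div (hal y hy)).le, le_rfl⟩
  have hyinv : IsHolSymbol a (-((1 : ℕ) : ℤ)) (fun y => ((y : ℂ) ^ 1)⁻¹) :=
    (IsHolSymbol.pow a 1).inv one_pos fun y hy => by
      rw [one_mul, norm_pow, Complex.norm_real, Real.norm_of_nonneg hy.1.le, zpow_natCast]
  -- The identity `λ U = -Im (c₀⁺ conj f₊)` at `δ/λ` shows that `U` at this moving point is a
  -- symbol.
  have hUxs : IsHolSymbol a (-((l + 1 : ℕ) : ℤ)) (fun y => (Ux y : ℂ)) := by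
    have h1 := (hyinv.mul ((hc0s.mono haa1).mul (hfar.mono (min_le_right _ _)).conj).ofReal_im).neg
    rw [show -((1 : ℕ) : ℤ) + (-(l : ℤ) + 0) = -((l + 1 : ℕ) : ℤ) by push_cast; ring] at h1
    refine h1.congr fun y hy => ?_
    have h2 := (hE.sol 0 y (hal y hy)).eq_im_mul_conj hV hD hy.1 (hfp y hy.1) (δ / y) x0
    have h3 : (y : ℂ) ≠ 0 := by exact_mod_cast hy.1.ne'
    rw [h2]
    push_cast
    field_simp
    rfl
  have hUxi : IsHolSymbol a ((l + 1 : ℕ) : ℤ) (fun y => (Ux y : ℂ)⁻¹) := by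
    have h1 := hUxs.inv (c := 1 / 2 * (c1 * δ ^ (l + 1))) (by positivity) fun y hy => by
      have h2 := hUxpos y hy
      have h3 := hul (δ / y) (hE.lt_div (hal y hy)).le
      have hy0 := hy.1
      have h4 : c1 * (δ / y) ^ (l + 1) ≤ c1 * (1 + δ / y) ^ (l + 1) := by
        gcongr
        linarith
      rw [Complex.norm_real, Real.norm_of_nonneg h2.2.le, zpow_neg, zpow_natCast, mul_assoc,
        mul_assoc, ← div_eq_mul_inv, ← div_pow]
      linarith
    rwa [neg_neg] at h1
  have hms : IsHolSymbol a ((2 * l + 1 : ℕ) : ℤ) m := by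
    have h1 := ((hfar.mono (min_le_right _ _)).neg.mul hUxi).mul
      ((hc0s.mono haa1).inv hc fun y hy => hlow y (hal1 y hy))
    rwa [show (0 : ℤ) + ((l + 1 : ℕ) : ℤ) + - -(l : ℤ) = ((2 * l + 1 : ℕ) : ℤ) by
      push_cast; ring] at h1
  have hZs' : IsHolSymbol a 0 Z := hZs.mono haa1
  have hcoef : ∀ y ∈ Ioo 0 a, connCoeff fm U 0 y = c0m y ∧ connCoeff fp U 0 y = c0p y ∧
      connCoeff fm U 1 y = -(fm y (δ / y) / Ux y) ∧ connCoeff fp U 1 y = -(fp y (δ / y) / Ux y) := by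
    intro y hy
    have hs0 := hE.sol 0 y (hal y hy)
    have hs1 := hE.sol 1 y (hal y hy)
    have hlt := hE.lt_div (hal y hy)
    have hne : ∀ x ∈ Icc x0 (δ / y), U 0 y x ≠ 0 := fun x hx =>
      (hE.pos (hal y hy) x hx).2.ne'
    refine ⟨wronskian_const (hfm y hy.1).sol (hs0.ofReal hV).1 _ _,
      wronskian_const (hfp y hy.1).sol (hs0.ofReal hV).1 _ _,
      wronskian_eq_neg_div hV (hfm y hy.1).sol hs0 hs1 hlt hne (hE.U_one y (hal y hy)) 0,
      wronskian_eq_neg_div hV (hfp y hy.1).sol hs0 hs1 hlt hne (hE.U_one y (hal y hy)) 0⟩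
  have hUxne : ∀ y ∈ Ioo 0 a, (Ux y : ℂ) ≠ 0 := fun y hy => by
    exact_mod_cast (hUxpos y hy).2.ne'
  have hdet : ∀ y ∈ Ioo 0 a, coeffDet fm fp U y = wronskian (fm y) (fp y) x0 := by
    intro y hy
    obtain ⟨h1, h2, h3, h4⟩ := hcoef y hy
    have hs0 := hE.sol 0 y (hal y hy)
    have hu0 := hUxne y hy
    rw [coeffDet, h1, h2, h3, h4, wronskian_const (hfm y hy.1).sol (hfp y hy.1).sol x0 (δ / y)]
    simp only [hc0m, hc0p]
    rw [wronskian_const (hfm y hy.1).sol (hs0.ofReal hV).1 x0 (δ / y),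
      wronskian_const (hfp y hy.1).sol (hs0.ofReal hV).1 x0 (δ / y),
      wronskian_ofReal hV hs0, wronskian_ofReal hV hs0, wronskian]
    simp only [hUx] at hu0 ⊢
    field_simp
    ring
  have hdet0 : ∀ y ∈ Ioo 0 a, wronskian (fm y) (fp y) x0 ≠ 0 := fun y hy => hW0 y (hal1 y hy)
  have hp1 : ∀ y ∈ Ioo 0 a, connCoeff fp U 1 y = m y * c0p y := by
    intro y hy
    obtain ⟨-, -, -, h4⟩ := hcoef y hy
    have := hc0ne y hy
    rw [h4]
    simp only [hm]
    rw [inv_mul_cancel_right₀ this, neg_mul, div_eq_mul_inv]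
  have hm1 : ∀ y ∈ Ioo 0 a, connCoeff fm U 1 y * c0p y
      = wronskian (fm y) (fp y) x0 + c0m y * (m y * c0p y) := by
    intro y hy
    obtain ⟨h1, h2, -, -⟩ := hcoef y hy
    have h5 := hdet y hy
    rw [coeffDet, h1, h2, hp1 y hy] at h5
    rw [← h5]
    ring
  have hA00 : ∀ y ∈ Ioo 0 a, spectralCoeff fm fp U 0 0 y = (Z y).im := by
    intro y hy
    obtain ⟨h1, h2, -, -⟩ := hcoef y hy
    rw [spectralCoeff, h1, h2, hdet y hy]
  have hA01 : ∀ y ∈ Ioo 0 a, spectralCoeff fm fp U 0 1 y = (Z y * m y).im := by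
    intro y hy
    obtain ⟨h1, -, -, -⟩ := hcoef y hy
    rw [spectralCoeff, h1, hp1 y hy, hdet y hy]
    congr 1
    simp only [hZ]
    ring
  have hA10 : ∀ y ∈ Ioo 0 a, spectralCoeff fm fp U 1 0 y = (Z y * m y).im := by
    intro y hy
    obtain ⟨-, h2, -, -⟩ := hcoef y hy
    -- The leading term `1` is real and drops out of the imaginary part.
    rw [spectralCoeff, h2, hm1 y hy, hdet y hy, add_div, div_self (hdet0 y hy), Complex.add_im,
      Complex.one_im, zero_add]
    congr 1
    simp only [hZ]
    ring
  have hA11 : ∀ y ∈ Ioo 0 a, spectralCoeff fm fp U 1 1 y = (m y + Z y * m y * m y).im := by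
    intro y hy
    rw [spectralCoeff, hp1 y hy, hdet y hy]
    congr 1
    rw [show connCoeff fm U 1 y * (m y * c0p y) = connCoeff fm U 1 y * c0p y * m y by ring,
      hm1 y hy]
    have := hdet0 y hy
    simp only [hZ]
    field_simp
  have hZm : IsHolSymbol a ((2 * l + 1 : ℕ) : ℤ) (fun y => Z y * m y) := by
    simpa using hZs'.mul hms
  have hexp : ((((2 * l + 1 : ℕ) : ℤ) : ℝ)) = 2 * (l : ℝ) + 1 := by push_cast; ring
  have hsymb : ∀ {f : ℝ → ℝ} {g : ℝ → ℂ}, IsHolSymbol a ((2 * l + 1 : ℕ) : ℤ) g →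
      (∀ y ∈ Ioo 0 a, f y = (g y).im) → IsSymbolO (2 * (l : ℝ) + 1) a f := by
    intro f g hg hfg
    rw [← hexp]
    exact (hg.ofReal_im.congr fun y hy => by rw [hfg y hy]).isSymbolO
  refine ⟨a, hapos, haa1.trans ha1', fun y hy => ⟨?_, ?_⟩, ?_, fun j k hjk => ?_⟩
  · rw [hdet y hy]
    exact wronskian_const (hfm y hy.1).sol (hfp y hy.1).sol _ _
  · rw [hdet y hy]
    exact hdet0 y hy
  · exact IsOddO.of_isHolSymbol hapos P ((hPs.mono haa1).congr fun y hy => by rw [hA00 y hy])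
  · fin_cases j <;> fin_cases k
    · simp at hjk
    · exact hsymb hZm hA01
    · exact hsymb hZm hA10
    · refine hsymb (hms.add ?_) hA11
      refine (hZm.mul hms).weaken ?_
      push_cast
      omega

theorem IsSolution.add {E : ℝ} {f g : ℝ → ℝ} (hV : Continuous V) (hf : IsSolution V E f)
    (hg : IsSolution V E g) : IsSolution V E (fun x => f x + g x) :=
  (IsSolution.of_hasDerivAt hV (fun x => (hf.hasDerivAt x).add (hg.hasDerivAt x)) fun x =>
    ((hf.hasDerivAt_deriv x).add (hg.hasDerivAt_deriv x)).congr_deriv (smul_add _ _ _).symm).1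

/-- At positive energies the initial value problem is solved through Jost solutions. Positivity of
`u 0` on the whole line permits the base point `1`, and the closeness to `u 0` comes from
`exists_energy_perturbation`. -/
theorem exists_isEnergyBasis (hA : IsAdmissible V) (hz : IsZeroEnergyBasis V l u)
    (hpos : ∀ x, 0 < u 0 x) : ∃ (x0 δ lam0 : ℝ) (U : Fin 2 → ℝ → ℝ → ℝ),
      IsEnergyBasis V u x0 δ lam0 U := by
  have hV := hA.continuous
  obtain ⟨D, hD⟩ := hA.decay
  obtain ⟨c1, c2, hc1, hul, huu⟩ := exists_two_sided_bound (hz.sol 0).continuous zero_le_one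
    (fun x _ => hpos x) hz.asymp_zero
  obtain ⟨W, UD, c0, C1, hc0, hC1, -, -, -, -, hWb, hWU⟩ :=
    exists_energy_perturbation hV hD (fun x => (hA.pos x).le) (hz.sol 0) zero_le_one hc1 hul huu
  -- For `y < δ` and `y x ≤ δ` one has `y (1 + x) ≤ 2δ = √c0`, the range of the perturbation bound.
  set δ : ℝ := Real.sqrt c0 / 2 with hδ
  have hδ0 : 0 < δ := by positivity
  have hδ2 : (2 * δ) ^ 2 = c0 := by
    rw [hδ, mul_div_cancel₀ _ two_ne_zero, Real.sq_sqrt hc0.le]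
  clear_value δ
  have hex : ∀ y : ℝ, ∃ U₀ U₁ : ℝ → ℝ, y ∈ Ioo 0 δ → IsSolution V (y ^ 2) U₀ ∧
      IsSolution V (y ^ 2) U₁ ∧ U₀ 1 = u 0 1 ∧ deriv U₀ 1 = deriv (u 0) 1 ∧
      (∀ x ∈ Icc 1 (δ / y), |U₀ x / u 0 x - 1| ≤ 1 / 2) ∧
      ∀ x ∈ Icc 1 (δ / y), U₁ x = U₀ x * ∫ t in x..(δ / y), 1 / U₀ t ^ 2 := by
    intro y
    by_cases hy : y ∈ Ioo 0 δ
    swap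
    · exact ⟨0, 0, fun h => absurd h hy⟩
    obtain ⟨U₀, hs, hi0, hi1⟩ := exists_isSolution_of_init hV hD hy.1 1 (u 0 1) (deriv (u 0) 1)
    obtain ⟨f, hf⟩ := exists_isJostPlus hV hD hy.1
    have hy0 := hy.1
    have hclose : ∀ x ∈ Icc 1 (δ / y), |U₀ x / u 0 x - 1| ≤ 1 / 2 := by
      intro x hx
      have h1 := (hWU y U₀ hy0 hs hi0 hi1 x hx.1).1
      have h2 := (hWb ((y : ℂ) ^ 2) x hx.1 (by
        rw [norm_pow, Complex.norm_real, Real.norm_of_nonneg hy0.le, ← mul_pow, ← hδ2]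
        have h3 : y * x ≤ δ := by
          have := hx.2
          rw [le_div_iff₀ hy0] at this
          linarith
        have h4 : 0 ≤ y * (1 + x) := by
          have := hx.1
          positivity
        have h5 : y * (1 + x) ≤ 2 * δ := by linarith [hy.2]
        gcongr)).1
      have h6 : (u 0 x : ℂ) ≠ 0 := by exact_mod_cast (hpos x).ne'
      have h7 : W ((y : ℂ) ^ 2) x - 1 = ((U₀ x / u 0 x - 1 : ℝ) : ℂ) := by
        push_cast
        rw [h1, mul_div_cancel_left₀ _ h6]
      rwa [h7, Complex.norm_real, Real.norm_eq_abs] at h2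
    have hne : ∀ x ∈ Icc 1 (δ / y), U₀ x ≠ 0 := by
      intro x hx h0
      have := hclose x hx
      rw [h0] at this
      norm_num at this
    set c : ℂ := wronskian f (fun x => (U₀ x : ℂ)) 1 with hc
    have h1y : 1 ≤ δ / y := by
      rw [le_div_iff₀ hy0]
      linarith [hy.2]
    have hcne : c ≠ 0 := by
      intro h0
      have h1 := hs.eq_im_mul_conj hV hD hy0 hf 1 1
      rw [← hc, h0, zero_mul, Complex.zero_im] at h1
      exact mul_ne_zero (neg_ne_zero.2 hy0.ne') (hne 1 ⟨le_rfl, h1y⟩) h1.symm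
    set k : ℂ := f (δ / y) / U₀ (δ / y) with hk
    -- By `quotient_sub_eq`, `U₀ ∫_x^{δ/y} U₀⁻² = c⁻¹ f - (k/c) U₀` on the interval. The right-hand
    -- side solves the equation on the whole line, and its real part is the required global
    -- extension.
    refine ⟨U₀, fun x => (c⁻¹ * f x).re + (-(k / c) * (U₀ x : ℂ)).re, fun _ => ⟨hs,
      (hf.sol.re_mul hV c⁻¹).1.add hV ((hs.ofReal hV).1.re_mul hV (-(k / c))).1, hi0, hi1, hclose,
      fun x hx => ?_⟩⟩
    have h1 := quotient_sub_eq hV hf.sol hs hx.2 (fun t ht => hne t ⟨hx.1.trans ht.1, ht.2⟩) 1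
    have hκ : ∫ t in x..(δ / y), ((U₀ t : ℂ) ^ 2)⁻¹
        = ((∫ t in x..(δ / y), 1 / U₀ t ^ 2 : ℝ) : ℂ) := by
      rw [← intervalIntegral.integral_ofReal]
      refine intervalIntegral.integral_congr fun t _ => ?_
      simp
    rw [hκ, ← hc, ← hk] at h1
    have h2 : (U₀ x : ℂ) ≠ 0 := by exact_mod_cast hne x hx
    have h3 : c⁻¹ * f x + -(k / c) * (U₀ x : ℂ)
        = ((U₀ x * ∫ t in x..(δ / y), 1 / U₀ t ^ 2 : ℝ) : ℂ) := by
      push_cast at h1 ⊢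
      field_simp at h1 ⊢
      linear_combination -h1
    beta_reduce
    rw [← Complex.add_re, h3, Complex.ofReal_re]
  choose U₀ U₁ hU using hex
  refine ⟨1, δ, δ, fun j => if j = 0 then U₀ else U₁, ⟨one_pos, hδ0, hδ0, by rw [one_mul],
    fun x _ => hpos x, fun j y hy => ?_, fun y hy => (hU y hy).2.2.1,
    fun y hy => (hU y hy).2.2.2.1, fun y hy => (hU y hy).2.2.2.2.1,
    fun y hy => (hU y hy).2.2.2.2.2⟩⟩
  fin_cases j
  · exact (hU y hy).1
  · exact (hU y hy).2.1

/-- Since `v` is positive everywhere, the low energy expansion may be based at `x0 = 0`, where the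
Green's function is evaluated; the solutions `U₀` are purely auxiliary. -/
theorem exists_green_expansion {v : ℝ → ℝ} (hA : IsAdmissible V) (hv : IsSolution V 0 v)
    (hpos : ∀ x, 0 < v x)
    (hlim : Tendsto (fun x : ℝ => v x / (x ^ (l + 1) / (2 * (l : ℝ) + 1))) atTop (𝓝 1))
    (hfm : ∀ y, 0 < y → IsJostMinus V y (fm y)) (hfp : ∀ y, 0 < y → IsJostPlus V y (fp y)) :
    ∃ (P : Polynomial ℝ) (lam1 : ℝ), P.degree < (l : WithBot ℕ) ∧ 0 < lam1 ∧
      IsSymbolO (2 * (l : ℝ) + 1) lam1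
        (fun lam : ℝ => (green fm fp 0 0 lam).im - lam * P.eval (lam ^ 2)) := by
  have hV := hA.continuous
  obtain ⟨D, hD⟩ := hA.decay
  obtain ⟨c1, c2, hc1, hul, huu⟩ := exists_two_sided_bound hv.continuous le_rfl
    (fun x _ => hpos x) hlim
  have hex : ∀ y : ℝ, ∃ U₀ : ℝ → ℝ, y ∈ Ioo 0 1 → IsSolution V (y ^ 2) U₀ ∧
      U₀ 0 = v 0 ∧ deriv U₀ 0 = deriv v 0 := by
    intro y
    by_cases hy : y ∈ Ioo (0 : ℝ) 1
    · obtain ⟨U₀, h⟩ := exists_isSolution_of_init hV hD hy.1 0 (v 0) (deriv v 0)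
      exact ⟨U₀, fun _ => h⟩
    · exact ⟨0, fun h => absurd h hy⟩
  choose U₀ hU using hex
  obtain ⟨a, -, ha, -, -, -, -, -, -, -, ⟨P, hP, hPs⟩⟩ :=
    exists_low_energy_expansion hA hv le_rfl hc1 hul huu
      ((integrableOn_inv_sq hv.continuous (fun x _ => hpos x) hlim).mono_set Ioi_subset_Ici_self)
      one_pos hU hfm hfp
  refine ⟨P, a, hP, ha, ?_⟩
  have hexp : ((((2 * l + 1 : ℕ) : ℤ) : ℝ)) = 2 * (l : ℝ) + 1 := by push_cast; ring
  have := hPs.isSymbolO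
  rw [hexp] at this
  simpa only [green, min_self, max_self] using this

end Estimates

end ReggeWheeler

theorem mainTheorem2 (M : ℝ) (hM : 0 < M) (l : ℕ) (σ : ℝ)
    (hσ : σ = -3 ∨ σ = 0 ∨ σ = 1)
    (hne : ¬(l = 0 ∧ σ = 0) ∧ ¬(l = 0 ∧ σ = -3) ∧ ¬(l = 1 ∧ σ = -3)) :
    -- the objects exist
    (∀ lam : ℝ, 0 < lam →
      (∃ f : ℝ → ℂ, ReggeWheeler.IsJostMinus (ReggeWheeler.potential M l σ) lam f) ∧
      (∃ f : ℝ → ℂ, ReggeWheeler.IsJostPlus (ReggeWheeler.potential M l σ) lam f)) ∧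
    (∃ (u : Fin 2 → ℝ → ℝ) (x0 δ lam0 : ℝ) (U : Fin 2 → ℝ → ℝ → ℝ),
      ReggeWheeler.IsZeroEnergyBasis (ReggeWheeler.potential M l σ) l u ∧
      ReggeWheeler.IsEnergyBasis (ReggeWheeler.potential M l σ) u x0 δ lam0 U) ∧
    -- and for the Jost solutions `fm lam`, `fp lam`:
    ∀ fm fp : ℝ → ℝ → ℂ,
      (∀ lam : ℝ, 0 < lam →
        ReggeWheeler.IsJostMinus (ReggeWheeler.potential M l σ) lam (fm lam)) →
      (∀ lam : ℝ, 0 < lam →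
        ReggeWheeler.IsJostPlus (ReggeWheeler.potential M l σ) lam (fp lam)) →
      -- the estimates for the coefficients, in every such basis
      (∀ (u : Fin 2 → ℝ → ℝ) (x0 δ lam0 : ℝ) (U : Fin 2 → ℝ → ℝ → ℝ),
        ReggeWheeler.IsZeroEnergyBasis (ReggeWheeler.potential M l σ) l u →
        ReggeWheeler.IsEnergyBasis (ReggeWheeler.potential M l σ) u x0 δ lam0 U →
        ∃ lam1 : ℝ, 0 < lam1 ∧ lam1 ≤ lam0 ∧
          (∀ lam ∈ Set.Ioo 0 lam1,
            ReggeWheeler.coeffDet fm fp U lam = ReggeWheeler.wronskian (fm lam) (fp lam) 0 ∧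
            ReggeWheeler.coeffDet fm fp U lam ≠ 0) ∧
          ReggeWheeler.IsOddO l lam1 (ReggeWheeler.spectralCoeff fm fp U 0 0) ∧
          ∀ j k : Fin 2, 1 ≤ (j : ℕ) + (k : ℕ) →
            ReggeWheeler.IsSymbolO (2 * (l : ℝ) + 1) lam1
              (ReggeWheeler.spectralCoeff fm fp U j k)) ∧
      -- the resulting expansion of the imaginary part of the Green's function
      (∃ (P : Polynomial ℝ) (lam1 : ℝ), P.degree < (l : WithBot ℕ) ∧ 0 < lam1 ∧
        ReggeWheeler.IsSymbolO (2 * (l : ℝ) + 1) lam1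
          (fun lam : ℝ =>
            (ReggeWheeler.green fm fp 0 0 lam).im - lam * P.eval (lam ^ 2))) := by
  have hA := ReggeWheeler.isAdmissible_potential hM hσ hne
  obtain ⟨D, hD⟩ := hA.decay
  obtain ⟨v, hv, hpos, hlim⟩ := ReggeWheeler.exists_growing_solution hM hσ hne
  refine ⟨fun lam hlam => ⟨ReggeWheeler.exists_isJostMinus hA.continuous hD hlam,
    ReggeWheeler.exists_isJostPlus hA.continuous hD hlam⟩, ?_, fun fm fp hfm hfp =>
    ⟨fun u x0 δ lam0 U hz hE => ReggeWheeler.exists_coefficient_estimates hA hz hE hfm hfp,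
      ReggeWheeler.exists_green_expansion hA hv hpos hlim hfm hfp⟩⟩
  obtain ⟨w, hz⟩ := ReggeWheeler.exists_isZeroEnergyBasis hA.continuous hv hpos hlim
  obtain ⟨x0, δ, lam0, U, hE⟩ := ReggeWheeler.exists_isEnergyBasis hA hz hpos
  exact ⟨_, x0, δ, lam0, U, hz, hE⟩
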